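/- **Setting.** Let $\Lambda=(\mathbb Z/L_0)^2$ be the periodic square lattice with $2L_0^2$ nearest-neighbour bonds, $\Omega=\{\pm1\}^\Lambda$, and $$H_0(\mathbf z)=\sum_{(i,j)}J_{ij}\,C_{ij}(\mathbf z),\qquad C_{ij}(\mathbf z)=\frac{1-z_iz_j}{2}\in\{0,1\}$$ (sum over the bonds). The functions $C_{ij}$ are called checks; a check is excited if it equals 1. Each check acts on at most $g=4$ sites and each site is acted on by at most $g=4$ checks. $H_0$ is also viewed as a diagonal operator on $\mathcal H=\mathbb C[\Omega]=(\mathbb C^2)^{\otimes\Lambda}$, and a subset of $\Omega$ also denotes the (orthogonal projection onto the) span of the corresponding basis vectors. Let $\ell$ be the global spin flip, generating $\mathbb Z_2$, and for $A\subset\Lambda$ let $\ell_A$ be the flip of the spins in $A$; $\partial A$ is the set of sites of $A$ with a nearest neighbour outside $A$. **Bottleneck structures.** Let $R\ge1$ be an integer. A *global bottleneck structure of range $R$* consists of wells $W_k\subset\Omega$, bottlenecks $\Phi_k\subset\Omega\setminus W_k$, finite families $\mathcal B_k$ and $\mathcal B_{\rm out}$ of sets of checks. With $P_k=W_k\cup\Phi_k$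 and $P_{\rm out}=\Omega\setminus\bigcup_kP_k$, it is required that different wells have Hamming distance $>R$; that $P_k$ contains every configuration within Hamming distance $R$ of $W_k$; and that every $\mathbf z\in\Phi_k$ has some $B\in\mathcal B_k$ all of whose checks are excited in $\mathbf z$. For a set $B$ of checks let $L_B=|B|$, let $E_B(\mathbf z)$ be the number of excited checks in $B$, and let $\mathcal Q_B=\{\mathbf z: E_B(\mathbf z)\ge\frac45L_B\}$. The structure *exhibits $\mathbb Z_2\to0$ SSB* if there are two nonempty wells, labelled by $k\in\mathbb Z_2$, with $\ell W_k=W_{k+1}$ and $\ell\Phi_k=\Phi_{k+1}$. **Global Peierls condition.** A Hermitian operator $H$ satisfies the $(\Delta,\theta,L,R)$-*global QPC* for the structure if (i) $(I-P_k)HW_k=0$, $P_k\cap P_{k'}=\emptyset$ and $P_kHP_{k'}=0$ for $k\ne k'$; (ii) $|\mathcal B_k|\le e^{\theta L}$, and $L_B\ge L$ for every $B\in\mathcal B_k$ and $B\in\mathcal B_{\rm out}$; (iii) every $\mathbf z\in P_{\rm out}$ has some $B\in\mathcal B_{\rm out}$ with all checks excited, and for every $m$ at most $e^{\theta m}$ of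 the $B\in\mathcal B_{\rm out}$ have $L_B=m$; (iv) $\langle\psi|H|\psi\rangle\ge\Delta L_B+H_{k,\min}$ for all $B\in\mathcal B_k$ and unit vectors $\psi$ in the span of $P_k\cap\mathcal Q_B$, where $H_{k,\min}$ is the lowest eigenvalue of the compression $P_kHP_k$ on $P_k$; (v) $\langle\psi|H|\psi\rangle\ge\Delta L_B+H_{\min}$ for all $B\in\mathcal B_{\rm out}$ and unit vectors $\psi$ in the span of $\mathcal Q_B$, where $H_{\min}$ is the lowest eigenvalue of $H$. The classical $H_0$ satisfies the *strengthened estimate* with constants $\Delta,c_\partial$ if for every $B\in\bigcup_k\mathcal B_k\cup\mathcal B_{\rm out}$ there is $A\subset\Lambda$ with $|\partial A|\le c_\partial L_B$ and $$H_0(\mathbf z)\ge\Delta L_B+H_0(\ell_A\mathbf z)\qquad\text{for all }\mathbf z\in\mathcal Q_B .$$ **Perturbations.** A $q$-local, locally symmetric perturbation is a Hermitian $V=\sum_{F\subset\Lambda}V_F$ with $V_F$ supported on $F$, $V_F=0$ if $|F|>q$, where each $V_F$ is (a scalar multiple of) a tensor product $\bigotimes_jV_{F;F_j}$ over a partition of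 $F$ into connected nonempty sets $F_j$, each $V_{F;F_j}$ being supported on $F_j$ and commuting with $\ell$. Its strength is $\epsilon=\max_i\sum_{F\ni i}\|V_F\|$. **Theorem.** For every integer $R\ge1$ there are constants $\theta,c_R,c_\partial>0$, depending only on $R$, such that for all sufficiently large $L_0$ (depending only on $R$) there is a global bottleneck structure of range $R$ on $\Omega$, exhibiting $\mathbb Z_2\to0$ SSB, for which the following holds with $L=c_RL_0$. Let the couplings $J_{ij}$ be i.i.d. with a law supported in $[-J_1,J_2]$ and $\mathbb P[J_{ij}>\Delta']=1-p$, where $0\le J_1<\Delta<\Delta'<J_2$ and $p>0$. Put $$a=\frac{4\Delta'-5\Delta-J_2}{5(\Delta'+J_1)},\qquad \chi=a\log\frac ap-a+p,$$ and suppose that $a>p$ and $\chi>\theta$. Then with probability at least $$1-\frac{e^{-(\chi-\theta)L}}{1-e^{-(\chi-\theta)}}$$ the following hold together. 1. $H_0$ satisfies the $(\Delta,\theta,L,R)$-global QPC for this structure, and the strengthened estimate with constants $\Delta,c_\partial$. 2. (Robust $\mathbb Z_2\to0$ SSB at low energies.) Let $1\le q\le R$, $0<\zeta<1$, let $V$ be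 a $q$-local locally symmetric perturbation of strength $\epsilon$, and put $\tilde\Delta=\Delta-2c_\partial\epsilon$, $g=4$. Suppose $$\epsilon\le\zeta\,\frac{\tilde\Delta}{3g}e^{-\frac52qg\theta}\quad\text{and}\quad\epsilon<\frac{\tilde\Delta}{3g}\min\Big(\tfrac1{\sqrt2},e^{-\frac52qg\theta}\Big).$$ Then $H=H_0+V$ satisfies the $(\tilde\Delta,\theta,L,R)$-global QPC for the same structure. Moreover every eigenvector $\psi$ of $H$ with $\ell\psi=\psi$ and eigenvalue $E\le\frac12\tilde\Delta L+H_{\min}$ has SSB: the two sets $P_k$ have Hamming distance greater than $R$, and $$\|P_{\rm out}\psi\|\le\Big(1-e^{-\frac{2}{5qg}\log\frac1\zeta}\Big)^{-1/2}e^{-\frac{L}{5qg}\log\frac1\zeta}\,\|\psi\| .$$ -/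

import Mathlib

open MeasureTheory

noncomputable section

namespace RBIM

/-! ### Classical configurations, checks and bottleneck structures -/

/-- Classical configurations on the site set `Λ`: one two-valued spin per site. -/
abbrev Config (Λ : Type) : Type := Λ → Bool

/-- The truncated spin flip `ℓ_A`: it flips exactly the spins in `A`. -/
def flipOn {Λ : Type} [DecidableEq Λ] (A : Finset Λ) (z : Config Λ) : Config Λ :=
  fun i => if i ∈ A then !(z i) else z i

/-- The global spin flip, i.e. the nontrivial element of the on-site symmetry group `ℤ₂`. -/
def flipAll {Λ : Type} (z : Config Λ) : Config Λ := fun i => !(z i)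

/-- The check `c` acts on the site `i`: its value depends on the spin at `i`. -/
def ActsOn {Λ : Type} [DecidableEq Λ] (c : Config Λ → Bool) (i : Λ) : Prop :=
  ∃ (z : Config Λ) (b : Bool), c (Function.update z i b) ≠ c z

/-- The graph on the sites defined by a family of checks: two sites are adjacent when one
check acts on both. -/
def checkGraph {Λ E : Type} [DecidableEq Λ] (C : E → Config Λ → Bool) : SimpleGraph Λ where
  Adj i j := i ≠ j ∧ ∃ e, ActsOn (C e) i ∧ ActsOn (C e) j
  symm := ⟨fun _ _ h => ⟨h.1.symm, h.2.imp fun _ h' => ⟨h'.2, h'.1⟩⟩⟩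
  loopless := ⟨fun _ h => h.1 rfl⟩

/-- The sites of `A` that are adjacent to the complement of `A`. -/
def innerBoundary {Λ E : Type} [DecidableEq Λ] (C : E → Config Λ → Bool) (A : Finset Λ) :
    Set Λ :=
  {i | i ∈ A ∧ ∃ j, j ∉ A ∧ (checkGraph C).Adj i j}

/-- `E_B(z)`: the number of excited checks among those of `B`.  The number `L_B` of checks
of `B` is `B.card`. -/
def excited {Λ E : Type} (C : E → Config Λ → Bool) (B : Finset E) (z : Config Λ) : ℕ :=
  (B.filter fun e => C e z = true).card

/-- The bottleneck indicator given by the set of checks `B` equals `1` on `z`: all the checks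
of `B` are excited. -/
def Detects {Λ E : Type} (C : E → Config Λ → Bool) (B : Finset E) (z : Config Λ) : Prop :=
  ∀ e ∈ B, C e z = true

/-- The window `E_B ≥ (4/5) L_B`. -/
def window {Λ E : Type} (C : E → Config Λ → Bool) (B : Finset E) : Set (Config Λ) :=
  {z | (4 / 5 : ℝ) * (B.card : ℝ) ≤ (excited C B z : ℝ)}

/-- The data of a global bottleneck structure whose wells are labelled by `K`: the wells
`W_k`, their bottlenecks `Φ_k`, the indicators `ℬ_k` and the outer indicators `ℬ_out`.  Each
indicator is given by its set of checks.  A set of configurations also stands for the subspace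
of the Hilbert space that is spanned by the corresponding basis vectors. -/
structure Bottleneck (Λ E K : Type) where
  well : K → Set (Config Λ)
  neck : K → Set (Config Λ)
  ind : K → Finset (Finset E)
  indOut : Finset (Finset E)

/-- `P_k`, the union of a well and its bottleneck. -/
def Bottleneck.sector {Λ E K : Type} (S : Bottleneck Λ E K) (k : K) : Set (Config Λ) :=
  S.well k ∪ S.neck k

/-- `P_out`, the configurations outside all wells and bottlenecks. -/
def Bottleneck.outer {Λ E K : Type} (S : Bottleneck Λ E K) : Set (Config Λ) :=
  {z | ∀ k, z ∉ S.sector k}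

/-- The axioms of a bottleneck structure of range `R`, with indicators built on checks of
locality and degree at most `g`. -/
structure IsBottleneck {Λ E K : Type} [Fintype Λ] [DecidableEq Λ]
    (C : E → Config Λ → Bool) (g R : ℕ) (S : Bottleneck Λ E K) : Prop where
  one_le : 1 ≤ R
  check_local : ∀ e, {i | ActsOn (C e) i}.ncard ≤ g
  check_degree : ∀ i, {e | ActsOn (C e) i}.ncard ≤ g ∧ {e | ActsOn (C e) i}.Finite
  well_sep : ∀ k k', k ≠ k' → ∀ z ∈ S.well k, ∀ z' ∈ S.well k', R < hammingDist z z'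
  neck_disjoint : ∀ k, Disjoint (S.well k) (S.neck k)
  neck_nbhd : ∀ k, ∀ z ∈ S.well k, ∀ z', hammingDist z z' ≤ R → z' ∈ S.sector k
  neck_detect : ∀ k, ∀ z ∈ S.neck k, ∃ B ∈ S.ind k, Detects C B z

/-- The bottleneck structure exhibits `ℤ₂ → 0` symmetry breaking: the checks are symmetric,
the (nonempty) wells and their bottlenecks are labelled by `ℤ₂` modulo the trivial group, and
the global flip acts on the labels by translation. -/
structure IsSSB {Λ E : Type} [Fintype Λ] [DecidableEq Λ]
    (C : E → Config Λ → Bool) (g R : ℕ) (S : Bottleneck Λ E (ZMod 2)) : Prop where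
  bottleneck : IsBottleneck C g R S
  check_symm : ∀ e z, C e (flipAll z) = C e z
  well_nonempty : ∀ k, (S.well k).Nonempty
  well_flip : ∀ k, flipAll '' S.well k = S.well (k + 1)
  neck_flip : ∀ k, flipAll '' S.neck k = S.neck (k + 1)

/-- The strengthened energy estimate for a classical Hamiltonian `H₀`.  For every indicator
`B` some truncated flip `ℓ_A` lowers the energy by at least `Δ L_B` on every configuration
with at least `(4/5) L_B` excited checks in `B`, and `|∂A| ≤ c L_B`. -/
def StrongEstimate {Λ E K : Type} [DecidableEq Λ]
    (C : E → Config Λ → Bool) (S : Bottleneck Λ E K) (Δ c : ℝ) (H₀ : Config Λ → ℝ) : Prop :=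
  ∀ B : Finset E, (B ∈ S.indOut ∨ ∃ k, B ∈ S.ind k) →
    ∃ A : Finset Λ,
      ((innerBoundary C A).ncard : ℝ) ≤ c * (B.card : ℝ) ∧
      ∀ z ∈ window C B, Δ * (B.card : ℝ) + H₀ (flipOn A z) ≤ H₀ z

/-! ### Operators on the many-qubit Hilbert space -/

/-- The Hilbert space `ℂ[Ω] = (ℂ²)^{⊗ Λ}` with orthonormal basis the configurations. -/
abbrev Hilb (Λ : Type) [Fintype Λ] [DecidableEq Λ] : Type := EuclideanSpace ℂ (Config Λ)

/-- Operators, with the operator norm. -/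
abbrev Op (Λ : Type) [Fintype Λ] [DecidableEq Λ] : Type := Hilb Λ →L[ℂ] Hilb Λ

section Operators

variable {Λ E K : Type} [Fintype Λ] [DecidableEq Λ]

/-- The diagonal operator of a classical Hamiltonian. -/
def diagOp (f : Config Λ → ℝ) : Op Λ :=
  Matrix.toEuclideanCLM (𝕜 := ℂ) (Matrix.diagonal fun z => (f z : ℂ))

open Classical in
/-- The orthogonal projection onto the span of the configurations in `X`. -/
def projOn (X : Set (Config Λ)) : Op Λ := diagOp fun z => if z ∈ X then 1 else 0

/-- The unitary `|z⟩ ↦ |flipAll z⟩`, i.e. the product of all Pauli `X` operators. -/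
def flipOp : Op Λ :=
  Matrix.toEuclideanCLM (𝕜 := ℂ)
    (Matrix.of fun z z' : Config Λ => if z = flipAll z' then (1 : ℂ) else 0)

/-- The matrix element `⟨z|O|z'⟩`. -/
def entry (O : Op Λ) (z z' : Config Λ) : ℂ := O (EuclideanSpace.single z' 1) z

/-- `O` is of the form `O'_F ⊗ 1`, with `O'_F` acting on the sites in `F`. -/
def SupportedOn (F : Finset Λ) (O : Op Λ) : Prop :=
  (∀ z z', (∃ i, i ∉ F ∧ z i ≠ z' i) → entry O z z' = 0) ∧
  ∀ z z' w w', (∀ i ∈ F, z i = w i ∧ z' i = w' i) →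
    (∀ i, i ∉ F → z i = z' i ∧ w i = w' i) → entry O z z' = entry O w w'

/-- `ψ` lies in the span of the configurations in `X`. -/
def InSpan (X : Set (Config Λ)) (ψ : Hilb Λ) : Prop := ∀ z, z ∉ X → ψ z = 0

/-- `⟨ψ|H|ψ⟩`, a real number for Hermitian `H`. -/
def energy (H : Op Λ) (ψ : Hilb Λ) : ℝ := (inner ℂ ψ (H ψ)).re

/-- The lowest eigenvalue of `H` compressed to the span of `X`: the minimum of `⟨ψ|H|ψ⟩` over
the unit vectors `ψ` of this span. -/
def minEnergyOn (H : Op Λ) (X : Set (Config Λ)) : ℝ :=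
  sInf {x | ∃ ψ : Hilb Λ, ‖ψ‖ = 1 ∧ InSpan X ψ ∧ x = energy H ψ}

/-- The lowest eigenvalue of `H`. -/
def minEnergy (H : Op Λ) : ℝ := minEnergyOn H Set.univ

/-- The `(Δ, θ, L, R)`-quantum Peierls condition for the bottleneck structure `S`. -/
structure IsQPC (C : E → Config Λ → Bool) (g R : ℕ) (S : Bottleneck Λ E K)
    (Δ θ L : ℝ) (H : Op Λ) : Prop where
  bottleneck : IsBottleneck C g R S
  hermitian : IsSelfAdjoint H
  no_bypass : ∀ k, (1 - projOn (S.sector k)) * H * projOn (S.well k) = 0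
  ind_count : ∀ k, ((S.ind k).card : ℝ) ≤ Real.exp (θ * L)
  ind_size : ∀ k, ∀ B ∈ S.ind k, L ≤ (B.card : ℝ)
  ind_energy : ∀ k, ∀ B ∈ S.ind k, ∀ ψ : Hilb Λ, ‖ψ‖ = 1 →
    InSpan (S.sector k ∩ window C B) ψ →
      Δ * (B.card : ℝ) + minEnergyOn H (S.sector k) ≤ energy H ψ

/-- The `(Δ, θ, L, R)`-global quantum Peierls condition for the bottleneck structure `S`.  For
diagonal `H` this is the classical global Peierls condition. -/
structure IsGlobalQPC (C : E → Config Λ → Bool) (g R : ℕ) (S : Bottleneck Λ E K)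
    (Δ θ L : ℝ) (H : Op Λ) : Prop where
  qpc : IsQPC C g R S Δ θ L H
  sector_disjoint : ∀ k k', k ≠ k' → Disjoint (S.sector k) (S.sector k')
  sector_decoupled : ∀ k k', k ≠ k' →
    projOn (S.sector k) * H * projOn (S.sector k') = 0
  out_detect : ∀ z ∈ S.outer, ∃ B ∈ S.indOut, Detects C B z
  out_energy : ∀ B ∈ S.indOut, ∀ ψ : Hilb Λ, ‖ψ‖ = 1 → InSpan (window C B) ψ →
    Δ * (B.card : ℝ) + minEnergy H ≤ energy H ψ
  out_size : ∀ B ∈ S.indOut, L ≤ (B.card : ℝ)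
  out_count : ∀ m : ℕ,
    ((S.indOut.filter fun B => B.card = m).card : ℝ) ≤ Real.exp (θ * (m : ℝ))

/-- The `q`-local perturbation `V = ∑_F V_F` is Hermitian and locally symmetric: every `V_F` is
a tensor product of symmetric operators supported on disjoint connected pieces that make up
`F` (an ordered product of operators with disjoint supports is their tensor product; the
scalar `c` only matters for the empty set). -/
structure IsLocallySymmetric (C : E → Config Λ → Bool) (q : ℕ) (V : Finset Λ → Op Λ) :
    Prop where
  hermitian : IsSelfAdjoint (∑ F, V F)
  supported : ∀ F, SupportedOn F (V F)
  card_le : ∀ F, V F ≠ 0 → F.card ≤ q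
  decomposition : ∀ F, ∃ (m : ℕ) (part : Fin m → Finset Λ) (op : Fin m → Op Λ) (c : ℂ),
    (∀ a b, a ≠ b → Disjoint (part a) (part b)) ∧
    Finset.univ.biUnion part = F ∧
    (∀ a, ((checkGraph C).induce (part a : Set Λ)).Connected) ∧
    (∀ a, SupportedOn (part a) (op a)) ∧
    (∀ a, flipOp * op a = op a * flipOp) ∧
    V F = c • (List.ofFn op).prod

/-- The local strength `max_i ∑_{F ∋ i} ‖V_F‖`. -/
def localStrength (V : Finset Λ → Op Λ) : ℝ :=
  ⨆ i : Λ, ∑ F with i ∈ F, ‖V F‖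

/-- The symmetric state `ψ` has `(R, δ, Lstar)`-SSB from `ℤ₂` to `0`, witnessed by `S`. -/
structure StateSSB (C : E → Config Λ → Bool) (g R : ℕ) (S : Bottleneck Λ E (ZMod 2))
    (δ : ℝ) (Lstar : ℕ) (ψ : Hilb Λ) : Prop where
  symmetric : flipOp ψ = ψ
  structure_ssb : IsSSB C g R S
  sector_sep : ∀ k k', k ≠ k' → ∀ z ∈ S.sector k, ∀ z' ∈ S.sector k',
    Lstar < hammingDist z z'
  outside_small : ‖projOn S.outer ψ‖ ≤ δ * ‖ψ‖

/-- Smallness of the perturbation strength `ε`, with margin `ζ`. -/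
def IsSmall (Δ θ : ℝ) (q g : ℕ) (ζ ε : ℝ) : Prop :=
  ε ≤ ζ * (Δ / (3 * g)) * Real.exp (-(5 / 2 * q * g * θ)) ∧
  ε < Δ / (3 * g) * min (1 / √2) (Real.exp (-(5 / 2 * q * g * θ)))

/-- The leakage `c_ζ exp(-L/(5qg) log(1/ζ))` with
`c_ζ = (1 - exp(-2/(5qg) log(1/ζ)))^{-1/2}`. -/
def leakage (L : ℝ) (q g : ℕ) (ζ : ℝ) : ℝ :=
  (1 / √(1 - Real.exp (-(2 / (5 * q * g) * Real.log (1 / ζ))))) *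
    Real.exp (-(L * (1 / (5 * q * g)) * Real.log (1 / ζ)))

/-- Robust `ℤ₂ → 0` SSB at low energies of the classical Hamiltonian `H₀` under small locally
symmetric perturbations: with `ε` the strength of `V`, the Hamiltonian `H₀ + V` satisfies the
global quantum Peierls condition with `Δ - 2cε` for the symmetry-breaking structure `S`, and
all its eigenstates in the trivial representation of `ℤ₂` with energy at most
`(Δ - 2cε) L / 2` above the lowest eigenvalue have SSB. -/
def RobustSSB (C : E → Config Λ → Bool) (g R : ℕ) (S : Bottleneck Λ E (ZMod 2))
    (Δ θ L c : ℝ) (H₀ : Config Λ → ℝ) : Prop :=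
  ∀ (q : ℕ) (V : Finset Λ → Op Λ) (ζ : ℝ), 1 ≤ q → q ≤ R → 0 < ζ → ζ < 1 →
    IsLocallySymmetric C q V →
    IsSmall (Δ - 2 * c * localStrength V) θ q g ζ (localStrength V) →
    IsGlobalQPC C g R S (Δ - 2 * c * localStrength V) θ L (diagOp H₀ + ∑ F, V F) ∧
    ∀ (ψ : Hilb Λ) (e : ℝ), ψ ≠ 0 → (diagOp H₀ + ∑ F, V F) ψ = (e : ℂ) • ψ →
      flipOp ψ = ψ →
      e ≤ (Δ - 2 * c * localStrength V) / 2 * L + minEnergy (diagOp H₀ + ∑ F, V F) →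
      StateSSB C g R S (leakage L q g ζ) R ψ

end Operators

/-! ### The random-bond Ising model on the periodic square lattice -/

/-- The sites of the `n × n` square lattice with periodic boundary conditions. -/
abbrev Torus (n : ℕ) : Type := ZMod n × ZMod n

/-- The bonds: `(i, false)` joins `i` to its neighbour in the first direction, and `(i, true)`
to its neighbour in the second direction. -/
abbrev Bond (n : ℕ) : Type := Torus n × Bool

/-- The second endpoint of a bond; the first one is `e.1`. -/
def bondEnd {n : ℕ} (e : Bond n) : Torus n :=
  if e.2 then (e.1.1, e.1.2 + 1) else (e.1.1 + 1, e.1.2)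

/-- The value `±1` of a spin. -/
def spin (b : Bool) : ℝ := if b then 1 else -1

/-- The check of a bond is excited when its two spins differ. -/
def isingCheck {n : ℕ} (e : Bond n) (z : Config (Torus n)) : Bool :=
  z e.1 != z (bondEnd e)

/-- The Ising energy `∑_{(i,j)} J_{ij} (1 - z_i z_j) / 2`. -/
def isingEnergy {n : ℕ} [NeZero n] (J : Bond n → ℝ) (z : Config (Torus n)) : ℝ :=
  ∑ e : Bond n, J e * ((1 - spin (z e.1) * spin (z (bondEnd e))) / 2)

/-- The threshold fraction `a`. -/
def fractionA (J₁ J₂ Δ Δ' : ℝ) : ℝ := (4 * Δ' - 5 * Δ - J₂) / (5 * (Δ' + J₁))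

/-- The large-deviation rate `χ = a log(a/p) - a + p`. -/
def rateChi (a p : ℝ) : ℝ := a * Real.log (a / p) - a + p

end RBIM

end

/-!
The domain walls of a configuration are its excited bonds.  They are grouped into clusters of
neighbouring bonds, where neighbours lie in a common `3 × 3` block of base points, so that the
bonds of a plaquette and the bonds at a site are pairwise neighbours.

*Structure.*  A cluster of fewer than `n` bonds misses a row and a column of the torus, and is
therefore the boundary of a region that misses them too (`exists_potential`, `fill`).  If all
clusters are that small, filling them in shows one constant spin value, the sign of the sea
(`seaSign`), which is unchanged by a few spin flips (`seaSign_eq_of_small`).  With `L = c n` and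
`M` a multiple of `L`, the sector `k` consists of the configurations with sign `k` and clusters of
fewer than `M` bonds, and the well of those with clusters of fewer than `L` bonds.  In the
bottlenecks and outside the sectors, the domain walls contain a cut all of whose clusters have at
least `L` bonds (`exists_detect_neck`, `exists_detect_outer`).  These cuts are the indicators.
There are at most `exp (19 m)` of size `m`, as each is fixed up to an exponential factor by a root
in each of its at most `m / L` clusters (`card_large_clusters_le`), and `L` exceeds the logarithm
of the number of bonds.

*Couplings.*  By the exponential Markov inequality and a union bound over the cuts, with the
stated probability no cut `B` has more than `a |B|` bonds with coupling at most `Δ'`.  The fraction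
`a` is the one for which flipping one side of `B` then lowers the energy by `Δ |B|` on the window
of `B` (`strongEstimate_isingEnergy`).

*Perturbations.*  A locally symmetric term commutes with a truncated flip unless it acts on the
boundary of the flipped region (`exists_mem_innerBoundary`), so the estimate persists with a
smaller gap (`energy_flipState_le`).  For an eigenvector of low energy, the gap on the window of
`B` forces the amplitude to drop by a factor `2 g ε / Δ̃` whenever the number of excited checks in
`B` increases by `q g` (`norm_level_le`), hence it is exponentially small where all checks of `B`
are excited (`norm_detects_le`).  Summing over the indicators bounds the leakage.

*Lowest energy of a sector.*  Flipping one side of a cut need not preserve a sector, so the flip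
only compares with the lowest energy overall.  The lowest energy of a sector is larger, but
only by an exponentially small multiple of `ε`: the ground state leaks little, because `θ` is
chosen larger than the entropy constant of the cuts, and the global flip exchanges the sectors
(`minEnergyOn_sector_le`).  The boundary constant `3` instead of `2` absorbs this difference.
-/


namespace RBIM

/-! ### Clusters of a finite set for a neighbourhood relation -/

section Clusters

variable {E : Type} {nb : E → Finset E}

/-- `a` and `b` are joined by a chain of neighbours inside `U`; every element is joined to
itself, also outside `U`. -/
def Linked (nb : E → Finset E) (U : Finset E) : E → E → Prop :=
  Relation.ReflTransGen fun a b => a ∈ U ∧ b ∈ U ∧ b ∈ nb a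

open Classical in
/-- The cluster of `e` in `U`: the elements of `U` that are joined to `e` inside `U`. -/
noncomputable def cluster (nb : E → Finset E) (U : Finset E) (e : E) : Finset E :=
  U.filter fun f => Linked nb U e f

theorem mem_cluster {U : Finset E} {e f : E} :
    f ∈ cluster nb U e ↔ f ∈ U ∧ Linked nb U e f := by
  simp [cluster]

theorem cluster_subset (U : Finset E) (e : E) : cluster nb U e ⊆ U := by
  intro f hf; exact (mem_cluster.1 hf).1

theorem mem_cluster_self {U : Finset E} {e : E} (he : e ∈ U) : e ∈ cluster nb U e :=
  mem_cluster.2 ⟨he, Relation.ReflTransGen.refl⟩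

theorem Linked.symm (hs : ∀ a b, b ∈ nb a → a ∈ nb b) {U : Finset E} {a b : E}
    (h : Linked nb U a b) : Linked nb U b a := by
  induction h with
  | refl => exact Relation.ReflTransGen.refl
  | tail _ hbc ih => exact Relation.ReflTransGen.head ⟨hbc.2.1, hbc.1, hs _ _ hbc.2.2⟩ ih

theorem Linked.trans {U : Finset E} {a b c : E}
    (h : Linked nb U a b) (h' : Linked nb U b c) : Linked nb U a c :=
  Relation.ReflTransGen.trans h h'

theorem Linked.mono {U V : Finset E} (hUV : U ⊆ V) {a b : E}
    (h : Linked nb U a b) : Linked nb V a b := by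
  induction h with
  | refl => exact Relation.ReflTransGen.refl
  | tail _ hbc ih => exact ih.tail ⟨hUV hbc.1, hUV hbc.2.1, hbc.2.2⟩

theorem Linked.of_nb {U : Finset E} {a b : E} (ha : a ∈ U) (hb : b ∈ U) (h : b ∈ nb a) :
    Linked nb U a b := Relation.ReflTransGen.single ⟨ha, hb, h⟩

theorem cluster_eq_of_mem (hs : ∀ a b, b ∈ nb a → a ∈ nb b) {U : Finset E} {e f : E}
    (h : f ∈ cluster nb U e) : cluster nb U f = cluster nb U e := by
  have h' := (mem_cluster.1 h).2
  ext g
  rw [mem_cluster, mem_cluster]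
  exact ⟨fun hg => ⟨hg.1, h'.trans hg.2⟩, fun hg => ⟨hg.1, (h'.symm hs).trans hg.2⟩⟩

theorem cluster_mono {U V : Finset E} (h : U ⊆ V) (e : E) : cluster nb U e ⊆ cluster nb V e := by
  intro f hf
  rw [mem_cluster] at hf ⊢
  exact ⟨h hf.1, hf.2.mono h⟩

/-- If `B` is a union of clusters of `U`, the clusters of `B` are clusters of `U`. -/
theorem cluster_eq_of_saturated {U B : Finset E} (hB : B ⊆ U)
    (hsat : ∀ a ∈ B, ∀ b ∈ U, b ∈ nb a → b ∈ B) {e : E} (he : e ∈ B) :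
    cluster nb B e = cluster nb U e := by
  refine (cluster_mono hB e).antisymm fun f hf => ?_
  have key : ∀ f, Linked nb U e f → f ∈ B ∧ Linked nb B e f := by
    intro f hf
    induction hf with
    | refl => exact ⟨he, Relation.ReflTransGen.refl⟩
    | @tail a b _ hab ih =>
      have hb := hsat a ih.1 b hab.2.1 hab.2.2
      exact ⟨hb, ih.2.tail ⟨ih.1, hb, hab.2.2⟩⟩
  exact mem_cluster.2 (key f (mem_cluster.1 hf).2)

variable [DecidableEq E]

/-- The set of all clusters of `U`. -/
noncomputable def clusters (nb : E → Finset E) (U : Finset E) : Finset (Finset E) :=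
  U.image (cluster nb U)

theorem mem_clusters {U y : Finset E} :
    y ∈ clusters nb U ↔ ∃ e ∈ U, cluster nb U e = y := by
  simp [clusters]

theorem cluster_mem_clusters {U : Finset E} {e : E} (he : e ∈ U) :
    cluster nb U e ∈ clusters nb U := mem_clusters.2 ⟨e, he, rfl⟩

theorem eq_cluster_of_mem (hs : ∀ a b, b ∈ nb a → a ∈ nb b) {U y : Finset E} {e : E}
    (hy : y ∈ clusters nb U) (he : e ∈ y) : y = cluster nb U e := by
  obtain ⟨f, _, rfl⟩ := mem_clusters.1 hy
  exact (cluster_eq_of_mem hs he).symm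

theorem subset_of_mem_clusters {U y : Finset E} (hy : y ∈ clusters nb U) : y ⊆ U := by
  obtain ⟨f, _, rfl⟩ := mem_clusters.1 hy
  exact cluster_subset U f

/-- A cluster of `U` is closed under passing to a neighbour in `U`. -/
theorem mem_of_nb (hs : ∀ a b, b ∈ nb a → a ∈ nb b) {U y : Finset E} {e f : E}
    (hy : y ∈ clusters nb U) (he : e ∈ y) (hf : f ∈ U) (h : f ∈ nb e) : f ∈ y := by
  rw [eq_cluster_of_mem hs hy he, mem_cluster]
  exact ⟨hf, .of_nb (subset_of_mem_clusters hy he) hf h⟩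

/-- Every element of `U` lies in exactly one cluster, so a sum over the clusters that contain
it has a single term. -/
theorem sum_clusters_ite {A : Type*} [AddCommMonoid A] (hs : ∀ a b, b ∈ nb a → a ∈ nb b)
    {U : Finset E} (e : E) (c : A) :
    ∑ y ∈ clusters nb U, (if e ∈ y then c else 0) = if e ∈ U then c else 0 := by
  classical
  split_ifs with he
  · rw [Finset.sum_eq_single (cluster nb U e)]
    · rw [if_pos (mem_cluster_self he)]
    · intro y hy hne
      rw [if_neg]
      exact fun h => hne (eq_cluster_of_mem hs hy h)
    · exact fun h => absurd (cluster_mem_clusters he) h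
  · refine Finset.sum_eq_zero fun y hy => if_neg fun h => he (subset_of_mem_clusters hy h)

/-- Each cluster of `U' ⊆ U` lies in one cluster of `U`, so a sum over the clusters of `U'` can
be grouped by the clusters of `U`. -/
theorem sum_clusters_refine {A : Type*} [AddCommMonoid A]
    (hs : ∀ a b, b ∈ nb a → a ∈ nb b) {U U' : Finset E} (h : U' ⊆ U) (f : Finset E → A) :
    ∑ y ∈ clusters nb U, ∑ x ∈ (clusters nb U').filter (· ⊆ y), f x =
      ∑ x ∈ clusters nb U', f x := by
  classical
  simp_rw [Finset.sum_filter]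
  rw [Finset.sum_comm]
  refine Finset.sum_congr rfl fun x hx => ?_
  obtain ⟨e, he, rfl⟩ := mem_clusters.1 hx
  rw [← Finset.sum_congr rfl (g := fun y => if cluster nb U' e ⊆ y then f (cluster nb U' e) else 0)
    (f := fun y => if e ∈ y then f (cluster nb U' e) else 0)]
  · rw [sum_clusters_ite hs, if_pos (h he)]
  · intro y hy
    have : e ∈ y ↔ cluster nb U' e ⊆ y := by
      constructor
      · intro hey g hg
        rw [eq_cluster_of_mem hs hy hey, mem_cluster]
        have := mem_cluster.1 hg
        exact ⟨h this.1, this.2.mono h⟩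
      · exact fun hs => hs (mem_cluster_self he)
    simp [this]

/-- A cluster of `U ∪ S` is covered by the cluster of `e` in `U`, by `S`, and by the clusters
in `U` of the neighbours of `S`. -/
theorem cluster_union_subset {U S : Finset E} (e : E) :
    cluster nb (U ∪ S) e ⊆
      cluster nb U e ∪ (S ∪ S.biUnion fun s => (nb s ∩ U).biUnion (cluster nb U)) := by
  classical
  suffices H : ∀ f, Linked nb (U ∪ S) e f → Linked nb U e f ∨
      f ∈ S ∪ S.biUnion fun s => (nb s ∩ U).biUnion (cluster nb U) by
    intro f hf
    rw [mem_cluster] at hf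
    by_cases hfS : f ∈ S
    · simp [hfS]
    · have hfU : f ∈ U := by simpa [hfS] using hf.1
      rcases H f hf.2 with h | h
      · exact Finset.mem_union_left _ (mem_cluster.2 ⟨hfU, h⟩)
      · exact Finset.mem_union_right _ h
  intro f hf
  induction hf with
  | refl => exact Or.inl Relation.ReflTransGen.refl
  | @tail a b hea hab ih =>
    by_cases hbS : b ∈ S
    · exact Or.inr (Finset.mem_union_left _ hbS)
    have hbU : b ∈ U := by simpa [hbS] using hab.2.1
    by_cases haS : a ∈ S
    · refine Or.inr (Finset.mem_union_right _ ?_)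
      simp only [Finset.mem_biUnion, Finset.mem_inter]
      exact ⟨a, haS, b, ⟨hab.2.2, hbU⟩, mem_cluster_self hbU⟩
    have haU : a ∈ U := by simpa [haS] using hab.1
    rcases ih with h | h
    · exact Or.inl (h.tail ⟨haU, hbU, hab.2.2⟩)
    · refine Or.inr (Finset.mem_union_right _ ?_)
      simp only [haS, Finset.mem_union, Finset.mem_biUnion, Finset.mem_inter, false_or] at h ⊢
      obtain ⟨s, hs, c, hc, hac⟩ := h
      refine ⟨s, hs, c, hc, mem_cluster.2 ⟨hbU, ?_⟩⟩
      exact (mem_cluster.1 hac).2.tail ⟨haU, hbU, hab.2.2⟩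

/-- Adding few elements to a set multiplies the sizes of its clusters by a bounded factor. -/
theorem card_cluster_union_le {D : ℕ} (hD : ∀ e, (nb e).card ≤ D) {U S : Finset E} {M : ℝ}
    (hM : 0 ≤ M) (hU : ∀ e ∈ U, ((cluster nb U e).card : ℝ) ≤ M) (e : E) :
    ((cluster nb (U ∪ S) e).card : ℝ) ≤ M + (S.card + S.card * D * M) := by
  classical
  have hU' : ∀ e, ((cluster nb U e).card : ℝ) ≤ ⌊M⌋₊ := by
    intro e
    rw [Nat.cast_le]
    refine Nat.le_floor ?_
    by_cases he : e ∈ U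
    · exact hU e he
    · have : cluster nb U e = ∅ := by
        rw [Finset.eq_empty_iff_forall_notMem]
        intro f hf
        obtain ⟨hfU, hl⟩ := mem_cluster.1 hf
        rcases Relation.ReflTransGen.cases_head hl with rfl | ⟨c, hc, _⟩
        · exact he hfU
        · exact he hc.1
      simpa [this] using hM
  have h1 : (cluster nb (U ∪ S) e).card ≤ ⌊M⌋₊ + (S.card + S.card * (D * ⌊M⌋₊)) := by
    refine (Finset.card_le_card (cluster_union_subset e)).trans ?_
    refine (Finset.card_union_le _ _).trans (Nat.add_le_add (by exact_mod_cast hU' e) ?_)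
    refine (Finset.card_union_le _ _).trans (Nat.add_le_add le_rfl ?_)
    refine Finset.card_biUnion_le_card_mul _ _ _ fun s _ => ?_
    refine (Finset.card_biUnion_le_card_mul _ _ ⌊M⌋₊ fun s _ => by exact_mod_cast hU' s).trans ?_
    exact Nat.mul_le_mul_right _ ((Finset.card_le_card Finset.inter_subset_left).trans (hD s))
  have h2 : (⌊M⌋₊ : ℝ) ≤ M := Nat.floor_le hM
  calc ((cluster nb (U ∪ S) e).card : ℝ)
      ≤ ⌊M⌋₊ + (S.card + S.card * (D * ⌊M⌋₊)) := by exact_mod_cast h1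
    _ ≤ M + (S.card + S.card * (D * M)) := by gcongr
    _ = _ := by ring

end Clusters

/-! ### Counting sets with large clusters -/

section Counting

variable {E : Type} [DecidableEq E] [Fintype E] {nb : E → Finset E}

/-- The number of sets of `m` elements, all joined to the given roots inside the set, is at
most exponential in `m`.  Such a set `B` together with any `ω` that avoids the neighbourhood of
`B` determines `B ∪ ω`, and `B` is recovered from `B ∪ ω` as the part joined to the roots. -/
theorem card_rooted_le {D : ℕ} (hr : ∀ e, e ∈ nb e) (hD : ∀ e, (nb e).card ≤ D)
    (T : Finset E) (m : ℕ) (𝓕 : Finset (Finset E))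
    (hcard : ∀ B ∈ 𝓕, B.card = m) (hT : ∀ B ∈ 𝓕, T ⊆ B)
    (hroot : ∀ B ∈ 𝓕, ∀ b ∈ B, ∃ t ∈ T, Linked nb B t b) :
    𝓕.card ≤ 2 ^ (D * m) := by
  classical
  let far : Finset E → Finset E := fun B => (B.biUnion nb)ᶜ
  have hfar : ∀ B ∈ 𝓕, Fintype.card E - D * m ≤ (far B).card := by
    intro B hB
    rw [Finset.card_compl]
    have : (B.biUnion nb).card ≤ m * D := by
      rw [← hcard B hB]; exact Finset.card_biUnion_le_card_mul _ _ _ fun s _ => hD s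
    rw [mul_comm] at this
    omega
  have hrec : ∀ B ∈ 𝓕, ∀ ω, ω ⊆ far B →
      ∀ b, b ∈ B ↔ ∃ t ∈ T, Linked nb (B ∪ ω) t b := by
    intro B hB ω hω b
    constructor
    · intro hb
      obtain ⟨t, ht, h⟩ := hroot B hB b hb
      exact ⟨t, ht, h.mono Finset.subset_union_left⟩
    · rintro ⟨t, ht, h⟩
      induction h with
      | refl => exact hT B hB ht
      | @tail a c _ hac ih =>
        rcases Finset.mem_union.1 hac.2.1 with h | h
        · exact h
        · have := hω h
          simp only [far, Finset.mem_compl, Finset.mem_biUnion, not_exists, not_and] at this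
          exact absurd hac.2.2 (this a ih)
  have hdisj : ∀ B ∈ 𝓕, Disjoint B (Finset.univ.filter fun e => e ∈ far B) := by
    intro B _
    rw [Finset.disjoint_left]
    intro e he he'
    simp only [far, Finset.mem_filter, Finset.mem_compl, Finset.mem_biUnion] at he'
    exact he'.2 ⟨e, he, hr e⟩
  have hinj : Set.InjOn (fun x : (_ : Finset E) × Finset E => x.1 ∪ x.2)
      (𝓕.sigma fun B => (far B).powerset) := by
    rintro ⟨B, ω⟩ h ⟨B', ω'⟩ h' heq
    simp only [Finset.coe_sigma, Set.mem_sigma_iff, Finset.mem_coe, Finset.mem_powerset] at h h' heq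
    have hBB : B = B' := by
      ext b
      rw [hrec B h.1 ω h.2, hrec B' h'.1 ω' h'.2, heq]
    subst hBB
    have hω : ∀ ω, ω ⊆ far B → ω = (B ∪ ω) \ B := by
      intro ω hω
      rw [Finset.union_sdiff_left, Finset.sdiff_eq_self_of_disjoint]
      refine (Finset.disjoint_left.2 fun e he heB => ?_)
      exact Finset.disjoint_left.1 (hdisj B h.1) heB (by simpa using hω he)
    have : ω = ω' := by rw [hω ω h.2, hω ω' h'.2, heq]
    rw [this]
  have hle := Finset.card_le_card_of_injOn (t := (Finset.univ : Finset (Finset E)))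
    _ (fun _ _ => Finset.mem_univ _) hinj
  rw [Finset.card_sigma, Finset.card_univ, Fintype.card_finset] at hle
  have h2 : 𝓕.card * 2 ^ (Fintype.card E - D * m) ≤ 2 ^ Fintype.card E := by
    refine le_trans ?_ hle
    rw [← smul_eq_mul]
    refine Finset.card_nsmul_le_sum _ _ _ fun B hB => ?_
    rw [Finset.card_powerset]
    exact Nat.pow_le_pow_right (by norm_num) (hfar B hB)
  -- If `D m` exceeds `|E|`, the total number of subsets is already small enough.
  by_cases hc : D * m ≤ Fintype.card E
  · have h3 : 2 ^ Fintype.card E = 2 ^ (D * m) * 2 ^ (Fintype.card E - D * m) := by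
      rw [← pow_add]; congr 1; omega
    rw [h3] at h2
    exact Nat.le_of_mul_le_mul_right h2 (by positivity)
  · have : Fintype.card E - D * m = 0 := by omega
    rw [this, pow_zero, mul_one] at h2
    exact h2.trans (Nat.pow_le_pow_right (by norm_num) (by omega))

/-- There are at most `(|E| + 1) ^ k` sets of at most `k` elements. -/
theorem card_subsets_le (k : ℕ) :
    ((Finset.univ : Finset (Finset E)).filter fun T => T.card ≤ k).card ≤
      (Fintype.card E + 1) ^ k := by
  classical
  induction k with
  | zero =>
    have : ((Finset.univ : Finset (Finset E)).filter fun T => T.card ≤ 0) ⊆ {∅} := by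
      intro T hT; simpa using hT
    simpa using Finset.card_le_card this
  | succ k ih =>
    have hsub : ((Finset.univ : Finset (Finset E)).filter fun T => T.card ≤ k + 1) ⊆
        (((Finset.univ : Finset (Finset E)).filter fun T => T.card ≤ k) ×ˢ
          (Finset.univ : Finset (Option E))).image
          fun x => x.2.elim x.1 fun e => insert e x.1 := by
      intro T hT
      simp only [Finset.mem_filter, Finset.mem_univ, true_and] at hT
      rw [Finset.mem_image]
      rcases T.eq_empty_or_nonempty with rfl | ⟨e, he⟩
      · exact ⟨(∅, none), by simp, rfl⟩
      · refine ⟨(T.erase e, some e), ?_, by simp [Finset.insert_erase he]⟩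
        simp [Finset.card_erase_of_mem he, hT]
    refine (Finset.card_le_card hsub).trans (Finset.card_image_le.trans ?_)
    rw [Finset.card_product, Finset.card_univ, Fintype.card_option, pow_succ]
    exact Nat.mul_le_mul_right _ ih

/-- A set all of whose clusters have at least `L` elements is determined, up to an exponential
factor, by one root in each cluster, and there are at most `m / L` roots. -/
theorem card_large_clusters_le {D : ℕ} (hs : ∀ a b, b ∈ nb a → a ∈ nb b)
    (hr : ∀ e, e ∈ nb e) (hD : ∀ e, (nb e).card ≤ D)
    {L : ℝ} (hL : 0 < L) (m : ℕ) (𝓕 : Finset (Finset E)) (hcard : ∀ B ∈ 𝓕, B.card = m)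
    (hbig : ∀ B ∈ 𝓕, ∀ e ∈ B, L ≤ ((cluster nb B e).card : ℝ)) :
    (𝓕.card : ℝ) ≤ (Fintype.card E + 1 : ℝ) ^ ((m : ℝ) / L) * 2 ^ (D * m) := by
  classical
  have hroots : ∀ B ∈ 𝓕, ∃ T : Finset E, T.card ≤ ⌊(m : ℝ) / L⌋₊ ∧ T ⊆ B ∧
      ∀ b ∈ B, ∃ t ∈ T, Linked nb B t b := by
    intro B hB
    have hne : ∀ y : clusters nb B, ∃ e, e ∈ y.1 := by
      rintro ⟨y, hy⟩
      obtain ⟨e, he, rfl⟩ := mem_clusters.1 hy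
      exact ⟨e, mem_cluster_self he⟩
    choose root hroot using hne
    refine ⟨Finset.univ.image root, ?_, ?_, ?_⟩
    · refine Finset.card_image_le.trans ?_
      rw [Finset.card_univ, Fintype.card_coe]
      refine Nat.le_floor ?_
      rw [le_div_iff₀ hL]
      have hsum : ∑ y ∈ clusters nb B, (y.card : ℝ) = m := by
        have h1 : ∀ y ∈ clusters nb B, (y.card : ℝ) = ∑ e ∈ B, if e ∈ y then (1 : ℝ) else 0 := by
          intro y hy
          rw [← Finset.sum_filter, Finset.sum_const, nsmul_eq_mul, mul_one]
          congr 2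
          ext e
          simp only [Finset.mem_filter]
          exact ⟨fun h => ⟨subset_of_mem_clusters hy h, h⟩, fun h => h.2⟩
        rw [Finset.sum_congr rfl h1, Finset.sum_comm, ← hcard B hB]
        rw [Finset.sum_congr rfl fun e _ => sum_clusters_ite hs e (1 : ℝ)]
        rw [Finset.sum_congr rfl fun e he => if_pos he]
        simp
      rw [← hsum, ← nsmul_eq_mul]
      refine Finset.card_nsmul_le_sum _ _ _ fun y hy => ?_
      obtain ⟨e, he, rfl⟩ := mem_clusters.1 hy
      exact hbig B hB e he
    · intro e he
      obtain ⟨y, _, rfl⟩ := Finset.mem_image.1 he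
      exact subset_of_mem_clusters y.2 (hroot y)
    · intro b hb
      let y : clusters nb B := ⟨cluster nb B b, cluster_mem_clusters hb⟩
      refine ⟨root y, Finset.mem_image_of_mem _ (Finset.mem_univ _), ?_⟩
      exact (mem_cluster.1 (hroot y)).2.symm hs
  have hcover : 𝓕 ⊆ ((Finset.univ : Finset (Finset E)).filter
      fun T => T.card ≤ ⌊(m : ℝ) / L⌋₊).biUnion fun T =>
        𝓕.filter fun B => T ⊆ B ∧ ∀ b ∈ B, ∃ t ∈ T, Linked nb B t b := by
    intro B hB
    obtain ⟨T, h1, h2, h3⟩ := hroots B hB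
    simp only [Finset.mem_biUnion, Finset.mem_filter, Finset.mem_univ, true_and]
    exact ⟨T, h1, hB, h2, h3⟩
  have hnat : 𝓕.card ≤ (Fintype.card E + 1) ^ ⌊(m : ℝ) / L⌋₊ * 2 ^ (D * m) := by
    refine (Finset.card_le_card hcover).trans ?_
    refine (Finset.card_biUnion_le_card_mul _ _ (2 ^ (D * m)) fun T _ => ?_).trans
      (Nat.mul_le_mul_right _ (card_subsets_le _))
    refine card_rooted_le hr hD T m _ ?_ ?_ ?_
    · intro B hB; exact hcard B (Finset.mem_filter.1 hB).1
    · intro B hB; exact (Finset.mem_filter.1 hB).2.1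
    · intro B hB; exact (Finset.mem_filter.1 hB).2.2
  calc (𝓕.card : ℝ) ≤ (Fintype.card E + 1 : ℝ) ^ ⌊(m : ℝ) / L⌋₊ * 2 ^ (D * m) := by
        exact_mod_cast hnat
    _ ≤ _ := by
        gcongr
        rw [← Real.rpow_natCast]
        refine Real.rpow_le_rpow_of_exponent_le ?_ (Nat.floor_le (by positivity))
        have : (0 : ℝ) ≤ Fintype.card E := by positivity
        linarith

end Counting

/-! ### Domain walls on the torus and their fillings -/

section Torus

variable {n : ℕ} [NeZero n]

/-- The bonds whose base points differ by at most one in each coordinate.  The bonds of a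
plaquette, and the bonds at a site, are pairwise neighbours in this sense. -/
def nbBond (e : Bond n) : Finset (Bond n) :=
  ((({-1, 0, 1} : Finset (ZMod n)) ×ˢ ({-1, 0, 1} : Finset (ZMod n))) ×ˢ
    (Finset.univ : Finset Bool)).image fun x => (e.1 + x.1, x.2)

omit [NeZero n] in
theorem mem_nbBond {e f : Bond n} :
    f ∈ nbBond e ↔ (f.1.1 - e.1.1 = -1 ∨ f.1.1 - e.1.1 = 0 ∨ f.1.1 - e.1.1 = 1) ∧
      (f.1.2 - e.1.2 = -1 ∨ f.1.2 - e.1.2 = 0 ∨ f.1.2 - e.1.2 = 1) := by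
  simp only [nbBond, Finset.mem_image, Finset.mem_product, Finset.mem_insert,
    Finset.mem_singleton, Finset.mem_univ, and_true]
  constructor
  · rintro ⟨⟨⟨a, b⟩, c⟩, h, rfl⟩
    simpa using h
  · intro h
    exact ⟨((f.1.1 - e.1.1, f.1.2 - e.1.2), f.2), h, by ext <;> simp⟩

omit [NeZero n] in
theorem nbBond_symm (a b : Bond n) (h : b ∈ nbBond a) : a ∈ nbBond b := by
  rw [mem_nbBond] at h ⊢
  have key : ∀ x y : ZMod n, (x - y = -1 ∨ x - y = 0 ∨ x - y = 1) →
      (y - x = -1 ∨ y - x = 0 ∨ y - x = 1) := by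
    intro x y h
    rw [← neg_sub x y]
    rcases h with h | h | h <;> simp [h]
  exact ⟨key _ _ h.1, key _ _ h.2⟩

omit [NeZero n] in
theorem self_mem_nbBond (e : Bond n) : e ∈ nbBond e := by simp [mem_nbBond]

omit [NeZero n] in
theorem card_nbBond_le (e : Bond n) : (nbBond e).card ≤ 18 := by
  refine Finset.card_image_le.trans ?_
  rw [Finset.card_product, Finset.card_product]
  have : ({-1, 0, 1} : Finset (ZMod n)).card ≤ 3 := Finset.card_le_three
  have h2 := Nat.mul_le_mul this this
  simp only [Finset.card_univ, Fintype.card_bool]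
  omega

/-- The coboundary modulo two: whether the two ends of a bond carry different values. -/
def cobd (A : Torus n → ZMod 2) (e : Bond n) : ZMod 2 := A e.1 + A (bondEnd e)

/-- The restriction of a function of the bonds to `y`, extended by zero. -/
def restr (ξ : Bond n → ZMod 2) (y : Finset (Bond n)) (e : Bond n) : ZMod 2 :=
  if e ∈ y then ξ e else 0

/-- The column and the row through `v` do not meet `ξ`. -/
def CrossFree (ξ : Bond n → ZMod 2) (v : Torus n) : Prop :=
  (∀ t, ξ ((v.1, t), true) = 0) ∧ ∀ t, ξ ((t, v.2), false) = 0

/-- An even number of the bonds around each plaquette belong to `ξ`. -/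
def PlaquetteClosed (ξ : Bond n → ZMod 2) : Prop :=
  ∀ v : Torus n, ξ (v, false) + ξ ((v.1 + 1, v.2), true) + ξ ((v.1, v.2 + 1), false) +
    ξ (v, true) = 0

omit [NeZero n] in
theorem cobd_horizontal (A : Torus n → ZMod 2) (x y : ZMod n) :
    cobd A ((x, y), false) = A (x, y) + A (x + 1, y) := rfl

omit [NeZero n] in
theorem cobd_vertical (A : Torus n → ZMod 2) (x y : ZMod n) :
    cobd A ((x, y), true) = A (x, y) + A (x, y + 1) := rfl

omit [NeZero n] in
theorem cobd_add (A B : Torus n → ZMod 2) : cobd (A + B) = cobd A + cobd B := by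
  ext e; simp only [cobd, Pi.add_apply]; ring

omit [NeZero n] in
theorem cobd_sum {ι : Type*} (s : Finset ι) (A : ι → Torus n → ZMod 2) :
    cobd (∑ i ∈ s, A i) = ∑ i ∈ s, cobd (A i) := by
  ext e; simp [cobd, Finset.sum_add_distrib]

omit [NeZero n] in
theorem plaquetteClosed_cobd (A : Torus n → ZMod 2) : PlaquetteClosed (cobd A) := by
  rintro ⟨x, y⟩
  simp only [cobd_horizontal, cobd_vertical]
  have h : ∀ a b c d : ZMod 2, a + b + (b + c) + (d + c) + (a + d) = 0 := by decide
  exact h _ _ _ _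

theorem zmod_const {α : Type*} (f : ZMod n → α) (h : ∀ t, f (t + 1) = f t) (s t : ZMod n) :
    f s = f t := by
  have key : ∀ k : ℕ, f (k : ZMod n) = f 0 := by
    intro k
    induction k with
    | zero => simp
    | succ k ih => rw [Nat.cast_succ, h, ih]
  rw [← ZMod.natCast_zmod_val s, ← ZMod.natCast_zmod_val t, key, key]

omit [NeZero n] in
theorem zmod_two_eq_of_add {a b : ZMod 2} (h : a + b = 0) : b = a := by
  revert a b; decide

/-- Two free crosses of the coboundary of `A` meet, so `A` takes the same value on them. -/
theorem eq_of_crossFree {A : Torus n → ZMod 2} {v w : Torus n}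
    (hv : CrossFree (cobd A) v) (hw : CrossFree (cobd A) w) : A v = A w := by
  have h1 : A (v.1, v.2) = A (v.1, w.2) :=
    zmod_const (fun t => A (v.1, t)) (fun t => zmod_two_eq_of_add (hv.1 t)) _ _
  have h2 : A (v.1, w.2) = A (w.1, w.2) :=
    zmod_const (fun t => A (t, w.2)) (fun t => zmod_two_eq_of_add (hw.2 t)) _ _
  exact h1.trans h2

theorem eq_of_cobd_eq {A B : Torus n → ZMod 2} (h : cobd A = cobd B) {v : Torus n}
    (hv : A v = B v) : A = B := by
  have h0 : cobd (A + B) = 0 := by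
    rw [cobd_add, h]; ext e; exact CharTwo.add_self_eq_zero (cobd B e)
  have hc : ∀ w, CrossFree (cobd (A + B)) w := fun w => by simp [h0, CrossFree]
  ext w
  have := eq_of_crossFree (hc w) (hc v)
  simp only [Pi.add_apply, hv, CharTwo.add_self_eq_zero] at this
  exact (zmod_two_eq_of_add this).symm

/-- The Poincaré lemma on the torus: a set of bonds that is closed around the plaquettes and
avoids a row and a column is a cut.  The potential is obtained by going from the free row
up the columns. -/
theorem exists_potential {ξ : Bond n → ZMod 2} (hξ : PlaquetteClosed ξ) {o : Torus n}
    (ho : CrossFree ξ o) :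
    ∃ A, cobd A = ξ ∧ ∀ v, CrossFree ξ v → A v = 0 := by
  -- `G x k` is the potential `k` steps above the free row in column `x`.
  let G : ZMod n → ℕ → ZMod 2 := fun x k => ∑ s ∈ Finset.range k, ξ ((x, o.2 + s), true)
  have hrow : ∀ x k, G x k + G (x + 1) k = ξ ((x, o.2 + k), false) := by
    intro x k
    induction k with
    | zero => simpa [G] using (ho.2 x).symm
    | succ k ih =>
      have hp := hξ (x, o.2 + k)
      simp only [G, Finset.sum_range_succ] at ih ⊢
      simp only at hp
      have h : ∀ a b a' b' c d : ZMod 2, a + b = c → c + b' + d + a' = 0 →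
          a + a' + (b + b') = d := by decide
      rw [Nat.cast_succ, ← add_assoc, ← add_assoc, add_assoc (_ + _)]
      exact h _ _ _ _ _ _ ih hp
  -- Going once around a column gives the same total in all columns, and zero in the free one.
  have htot : ∀ x, G x n = 0 := by
    intro x
    have h1 : G x n = G o.1 n := by
      refine zmod_const (fun x => G x n) (fun x => zmod_two_eq_of_add ?_) _ _
      rw [hrow]; simpa using ho.2 x
    rw [h1]
    exact Finset.sum_eq_zero fun s _ => ho.1 _
  have hper : ∀ x, Function.Periodic (G x) n := by
    intro x k
    simp only [G]
    rw [add_comm, Finset.sum_range_add]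
    have := htot x
    simp only [G] at this
    rw [this, zero_add]
    simp
  let A : Torus n → ZMod 2 := fun v => G v.1 (v.2 - o.2).val
  have hA : ∀ x (k : ℕ), A (x, o.2 + k) = G x k := by
    intro x k
    simp only [A, add_sub_cancel_left, ZMod.val_natCast]
    exact (hper x).map_mod_nat k
  have hk : ∀ y : ZMod n, ∃ k : ℕ, y = o.2 + k := fun y =>
    ⟨(y - o.2).val, by rw [ZMod.natCast_zmod_val]; ring⟩
  have hcob : cobd A = ξ := by
    ext ⟨⟨x, y⟩, b⟩
    obtain ⟨k, rfl⟩ := hk y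
    cases b
    · rw [cobd_horizontal, hA, hA, hrow]
    · rw [cobd_vertical, hA, add_assoc, ← Nat.cast_succ, hA]
      simp only [G, Finset.sum_range_succ]
      rw [← add_assoc, CharTwo.add_self_eq_zero, zero_add]
  refine ⟨A, hcob, fun v hv => ?_⟩
  have h0 : A o = 0 := by simp [A, G]
  rw [← h0]
  rw [← hcob] at hv ho
  exact eq_of_crossFree hv ho

/-- Fewer than `n` bonds leave a column and a row free. -/
theorem exists_free_cross {y : Finset (Bond n)} (hy : y.card < n) :
    ∃ v : Torus n, (∀ t b, ((v.1, t), b) ∉ y) ∧ ∀ t b, ((t, v.2), b) ∉ y := by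
  have key : ∀ f : Bond n → ZMod n, ∃ x, ∀ e ∈ y, f e ≠ x := by
    intro f
    by_contra! h
    have : (Finset.univ : Finset (ZMod n)) ⊆ y.image f := fun x _ => by
      obtain ⟨e, he, rfl⟩ := h x
      exact Finset.mem_image_of_mem _ he
    have := (Finset.card_le_card this).trans Finset.card_image_le
    rw [Finset.card_univ, ZMod.card] at this
    omega
  obtain ⟨x, hx⟩ := key fun e => e.1.1
  obtain ⟨w, hw⟩ := key fun e => e.1.2
  exact ⟨(x, w), fun t b h => hx _ h rfl, fun t b h => hw _ h rfl⟩

omit [NeZero n] in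
theorem crossFree_restr {ξ : Bond n → ZMod 2} {y : Finset (Bond n)} {v : Torus n}
    (hv : (∀ t b, ((v.1, t), b) ∉ y) ∧ ∀ t b, ((t, v.2), b) ∉ y) : CrossFree (restr ξ y) v :=
  ⟨fun t => if_neg (hv.1 t _), fun t => if_neg (hv.2 t _)⟩

/-- The part of a closed set of bonds in one cluster is closed, as the bonds of a plaquette are
neighbours of each other. -/
theorem plaquetteClosed_restr {ξ : Bond n → ZMod 2} (hξ : PlaquetteClosed ξ)
    {U y : Finset (Bond n)} (hU : ∀ e, ξ e ≠ 0 → e ∈ U) (hy : y ∈ clusters nbBond U) :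
    PlaquetteClosed (restr ξ y) := by
  intro v
  have hnb : ∀ e f : Bond n, e ∈ ({(v, false), ((v.1 + 1, v.2), true), ((v.1, v.2 + 1), false),
      (v, true)} : Finset (Bond n)) → f ∈ ({(v, false), ((v.1 + 1, v.2), true),
      ((v.1, v.2 + 1), false), (v, true)} : Finset (Bond n)) → f ∈ nbBond e := by
    intro e f he hf
    simp only [Finset.mem_insert, Finset.mem_singleton] at he hf
    rw [mem_nbBond]
    rcases he with rfl | rfl | rfl | rfl <;> rcases hf with rfl | rfl | rfl | rfl <;> simp
  by_cases h : ∃ e ∈ ({(v, false), ((v.1 + 1, v.2), true), ((v.1, v.2 + 1), false),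
      (v, true)} : Finset (Bond n)), e ∈ y
  · obtain ⟨e, he, hey⟩ := h
    have key : ∀ f ∈ ({(v, false), ((v.1 + 1, v.2), true), ((v.1, v.2 + 1), false),
      (v, true)} : Finset (Bond n)), restr ξ y f = ξ f := by
      intro f hf
      by_cases h0 : ξ f = 0
      · simp [restr, h0]
      · exact if_pos (mem_of_nb nbBond_symm hy hey (hU f h0) (hnb e f he hf))
    rw [key _ (by simp), key _ (by simp), key _ (by simp), key _ (by simp)]
    exact hξ v
  · push Not at h
    have key : ∀ f ∈ ({(v, false), ((v.1 + 1, v.2), true), ((v.1, v.2 + 1), false),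
      (v, true)} : Finset (Bond n)), restr ξ y f = 0 := fun f hf => if_neg (h f hf)
    rw [key _ (by simp), key _ (by simp), key _ (by simp), key _ (by simp)]
    simp

open Classical in
/-- The filling of a small closed set of bonds `ξ`: the region it bounds, on the side that does
not contain the free crosses.  It is zero for `ξ` that bound no region. -/
noncomputable def fill (ξ : Bond n → ZMod 2) : Torus n → ZMod 2 :=
  if h : ∃ A, cobd A = ξ ∧ ∀ v, CrossFree ξ v → A v = 0 then h.choose else 0

theorem fill_spec {ξ : Bond n → ZMod 2} (hξ : PlaquetteClosed ξ)
    {U y : Finset (Bond n)} (hU : ∀ e, ξ e ≠ 0 → e ∈ U) (hy : y ∈ clusters nbBond U)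
    (hn : y.card < n) :
    cobd (fill (restr ξ y)) = restr ξ y ∧
      ∀ v, CrossFree (restr ξ y) v → fill (restr ξ y) v = 0 := by
  obtain ⟨o, ho⟩ := exists_free_cross hn
  have h := exists_potential (plaquetteClosed_restr hξ hU hy) (crossFree_restr (ξ := ξ) ho)
  rw [fill, dif_pos h]
  exact h.choose_spec

/-- The region enclosed by `ξ`, filled cluster by cluster along the clusters of `U`. -/
noncomputable def fillAll (U : Finset (Bond n)) (ξ : Bond n → ZMod 2) : Torus n → ZMod 2 :=
  ∑ y ∈ clusters nbBond U, fill (restr ξ y)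

/-- The enclosed region does not change when clusters are merged into larger, still small,
clusters. -/
theorem fillAll_refine {ξ : Bond n → ZMod 2} (hξ : PlaquetteClosed ξ)
    {U U' : Finset (Bond n)} (hUU : U' ⊆ U) (hU : ∀ e, ξ e ≠ 0 → e ∈ U')
    (hn : ∀ y ∈ clusters nbBond U, y.card < n) : fillAll U' ξ = fillAll U ξ := by
  rw [fillAll, ← sum_clusters_refine nbBond_symm hUU, fillAll]
  refine Finset.sum_congr rfl fun y hy => ?_
  obtain ⟨o, ho⟩ := exists_free_cross (hn y hy)
  have hspec : ∀ x ∈ (clusters nbBond U').filter (· ⊆ y), cobd (fill (restr ξ x)) = restr ξ x ∧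
      ∀ v, CrossFree (restr ξ x) v → fill (restr ξ x) v = 0 := by
    intro x hx
    rw [Finset.mem_filter] at hx
    exact fill_spec hξ hU hx.1 ((Finset.card_le_card hx.2).trans_lt (hn y hy))
  have hy' := fill_spec hξ (fun e he => hUU (hU e he)) hy (hn y hy)
  refine eq_of_cobd_eq (v := o) ?_ ?_
  · rw [cobd_sum, Finset.sum_congr rfl fun x hx => (hspec x hx).1, hy'.1]
    ext e
    rw [Finset.sum_apply, Finset.sum_filter]
    by_cases h0 : ξ e = 0
    · simp [restr, h0]
    have heU := hU e h0
    rw [← Finset.sum_congr rfl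
      (f := fun x => if e ∈ x then (if e ∈ y then ξ e else 0) else 0), sum_clusters_ite nbBond_symm,
      if_pos heU]
    · rfl
    · intro x hx
      by_cases hex : e ∈ x
      · have : x ⊆ y ↔ e ∈ y := by
          refine ⟨fun h => h hex, fun hey f hf => ?_⟩
          rw [eq_cluster_of_mem nbBond_symm hx hex] at hf
          rw [eq_cluster_of_mem nbBond_symm hy hey]
          exact cluster_mono hUU e hf
        simp [restr, hex, this]
      · simp [restr, hex]
  · rw [Finset.sum_apply, hy'.2 o (crossFree_restr ho)]
    refine Finset.sum_eq_zero fun x hx => (hspec x hx).2 o (crossFree_restr ?_)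
    have hxy := (Finset.mem_filter.1 hx).2
    exact ⟨fun t b h => ho.1 t b (hxy h), fun t b h => ho.2 t b (hxy h)⟩

end Torus

/-! ### The sign of the sea -/

section Sign

variable {n : ℕ} [NeZero n]

/-- The spins of a configuration as elements of `ℤ/2`. -/
def spinMod (z : Config (Torus n)) (v : Torus n) : ZMod 2 := bif z v then 1 else 0

/-- The excited bonds of a configuration. -/
def walls (z : Config (Torus n)) : Finset (Bond n) :=
  Finset.univ.filter fun e => isingCheck e z = true

theorem mem_walls {z : Config (Torus n)} {e : Bond n} : e ∈ walls z ↔ isingCheck e z = true := by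
  simp [walls]

theorem cobd_spinMod_ne_zero {z : Config (Torus n)} {e : Bond n} :
    cobd (spinMod z) e ≠ 0 ↔ e ∈ walls z := by
  rw [mem_walls]
  simp only [cobd, spinMod, isingCheck]
  cases z e.1 <;> cases z (bondEnd e) <;> decide

/-- The value of the spins outside all the domain walls, for a configuration all of whose
clusters of domain walls are small: the spin at a site, corrected by the number of domain walls
that enclose the site.  It is read off at the origin, as it is the same at all sites. -/
noncomputable def seaSign (z : Config (Torus n)) : ZMod 2 :=
  spinMod z 0 + fillAll (walls z) (cobd (spinMod z)) 0

/-- The bonds that meet `D`. -/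
def star (D : Finset (Torus n)) : Finset (Bond n) :=
  Finset.univ.filter fun e => e.1 ∈ D ∨ bondEnd e ∈ D

theorem mem_star {D : Finset (Torus n)} {e : Bond n} : e ∈ star D ↔ e.1 ∈ D ∨ bondEnd e ∈ D := by
  simp [star]

theorem card_star_le (D : Finset (Torus n)) : (star D).card ≤ 4 * D.card := by
  have : star D ⊆ D.biUnion fun v => {(v, false), (v, true), ((v.1 - 1, v.2), false),
      ((v.1, v.2 - 1), true)} := by
    rintro ⟨⟨x, y⟩, b⟩ he
    rw [mem_star] at he
    simp only [Finset.mem_biUnion, Finset.mem_insert, Finset.mem_singleton]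
    rcases he with he | he
    · exact ⟨(x, y), he, by cases b <;> simp⟩
    · cases b
      · exact ⟨(x + 1, y), he, by simp⟩
      · exact ⟨(x, y + 1), he, by simp⟩
  refine (Finset.card_le_card this).trans ?_
  rw [mul_comm]
  exact Finset.card_biUnion_le_card_mul _ _ _ fun v _ => Finset.card_le_four

omit [NeZero n] in
theorem mem_nbBond_of_endpoint {e : Bond n} {v : Torus n} (h : e.1 = v ∨ bondEnd e = v) :
    (v, false) ∈ nbBond e := by
  rw [mem_nbBond]
  rcases h with rfl | rfl
  · simp
  · rcases e with ⟨⟨x, y⟩, b⟩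
    cases b <;> simp [bondEnd]

/-- Flipping the spins in `D` changes the enclosed region exactly by `D`, as long as the walls
and the bonds that meet `D` form small clusters together. -/
theorem fillAll_flipOn {z : Config (Torus n)} {D : Finset (Torus n)} {U : Finset (Bond n)}
    (hz : walls z ⊆ U) (hD : star D ⊆ U) (hn : ∀ y ∈ clusters nbBond U, y.card < n)
    (v : Torus n) :
    fillAll U (cobd (spinMod (flipOn D z))) v =
      fillAll U (cobd (spinMod z)) v + if v ∈ D then 1 else 0 := by
  have hspin : spinMod (flipOn D z) = spinMod z + fun v => if v ∈ D then 1 else 0 := by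
    ext v
    simp only [spinMod, flipOn, Pi.add_apply]
    cases z v <;> by_cases hv : v ∈ D <;> simp [hv]
    all_goals decide
  have hmemD : ∀ w ∈ D, ∀ e : Bond n, (e.1 = w ∨ bondEnd e = w) → e ∈ U := by
    intro w hw e he
    refine hD ?_
    rw [mem_star]
    rcases he with rfl | rfl
    · exact Or.inl hw
    · exact Or.inr hw
  have hz1 : ∀ e, cobd (spinMod z) e ≠ 0 → e ∈ U := fun e he => hz (cobd_spinMod_ne_zero.1 he)
  have hz2 : ∀ e, cobd (spinMod (flipOn D z)) e ≠ 0 → e ∈ U := by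
    intro e he
    by_contra heU
    have h1 : e.1 ∉ D := fun h => heU (hmemD _ h e (Or.inl rfl))
    have h2 : bondEnd e ∉ D := fun h => heU (hmemD _ h e (Or.inr rfl))
    refine heU (hz1 e ?_)
    intro h0
    apply he
    rw [hspin, cobd_add, Pi.add_apply, h0]
    simp [cobd, h1, h2]
  have hmem : ∀ w ∈ D, ∀ y ∈ clusters nbBond U, ∀ e : Bond n, (e.1 = w ∨ bondEnd e = w) →
      (e ∈ y ↔ (w, false) ∈ y) := by
    intro w hw y hy e he
    have hnb := mem_nbBond_of_endpoint he
    exact ⟨fun h => mem_of_nb nbBond_symm hy h (hmemD w hw _ (Or.inl rfl)) hnb,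
      fun h => mem_of_nb nbBond_symm hy h (hmemD w hw _ he) (nbBond_symm _ _ hnb)⟩
  have key : ∀ y ∈ clusters nbBond U, fill (restr (cobd (spinMod (flipOn D z))) y) =
      fill (restr (cobd (spinMod z)) y) +
        fun v => if (v, false) ∈ y then (if v ∈ D then 1 else 0) else 0 := by
    intro y hy
    obtain ⟨o, ho⟩ := exists_free_cross (hn y hy)
    have s1 := fill_spec (plaquetteClosed_cobd _) hz1 hy (hn y hy)
    have s2 := fill_spec (plaquetteClosed_cobd _) hz2 hy (hn y hy)
    refine eq_of_cobd_eq (v := o) ?_ ?_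
    · rw [s2.1, cobd_add, s1.1, hspin, cobd_add]
      ext e
      simp only [restr, Pi.add_apply]
      have he1 := fun h : e.1 ∈ D => hmem _ h y hy e (Or.inl rfl)
      have he2 := fun h : bondEnd e ∈ D => hmem _ h y hy e (Or.inr rfl)
      simp only [cobd]
      by_cases hey : e ∈ y <;> by_cases h1 : e.1 ∈ D <;> by_cases h2 : bondEnd e ∈ D <;>
        simp_all
    · have : ((o, false) : Bond n) ∉ y := ho.1 o.2 false
      rw [s2.2 o (crossFree_restr ho), Pi.add_apply, s1.2 o (crossFree_restr ho)]
      simp [this]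
  rw [fillAll, Finset.sum_congr rfl key, Finset.sum_add_distrib, Pi.add_apply, ← fillAll,
    Finset.sum_apply, sum_clusters_ite nbBond_symm]
  congr 1
  split_ifs with h1 h2 h2
  · rfl
  · rfl
  · exact absurd (hmemD v h2 (v, false) (Or.inl rfl)) h1
  · rfl

theorem walls_flipOn_subset (z : Config (Torus n)) (D : Finset (Torus n)) :
    walls (flipOn D z) ⊆ walls z ∪ star D := by
  intro e he
  rw [Finset.mem_union]
  by_contra! h
  rw [mem_star, not_or] at h
  rw [mem_walls] at he h
  simp only [isingCheck, flipOn, h.2.1, h.2.2, if_false] at he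
  exact h.1 he

/-- A flip does not change the sign of the sea if the walls and the bonds that meet the flipped
sites form small clusters together: the walls before and after the flip can then be filled along
the same clusters. -/
theorem seaSign_eq_of_small {z : Config (Torus n)} {D : Finset (Torus n)}
    (hn : ∀ y ∈ clusters nbBond (walls z ∪ star D), y.card < n) :
    seaSign (flipOn D z) = seaSign z := by
  have hsub := walls_flipOn_subset z D
  rw [seaSign, seaSign,
    fillAll_refine (plaquetteClosed_cobd _) hsub (fun e => cobd_spinMod_ne_zero.1) hn,
    fillAll_refine (plaquetteClosed_cobd _) Finset.subset_union_left
      (fun e => cobd_spinMod_ne_zero.1) hn,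
    fillAll_flipOn Finset.subset_union_left Finset.subset_union_right hn]
  simp only [spinMod, flipOn]
  cases z 0 <;> by_cases hv : (0 : Torus n) ∈ D <;> simp [hv]
  all_goals
    generalize fillAll (walls z ∪ star D) _ 0 = a
    revert a
    decide

omit [NeZero n] in
theorem isingCheck_flipAll (e : Bond n) (z : Config (Torus n)) :
    isingCheck e (flipAll z) = isingCheck e z := by
  simp only [isingCheck, flipAll]
  cases z e.1 <;> cases z (bondEnd e) <;> rfl

theorem walls_flipAll (z : Config (Torus n)) : walls (flipAll z) = walls z := by
  ext e; rw [mem_walls, mem_walls, isingCheck_flipAll]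

theorem seaSign_flipAll (z : Config (Torus n)) : seaSign (flipAll z) = seaSign z + 1 := by
  have h : ∀ v, spinMod (flipAll z) v = spinMod z v + 1 := by
    intro v; simp only [spinMod, flipAll]; cases z v <;> decide
  have hc : cobd (spinMod (flipAll z)) = cobd (spinMod z) := by
    ext e; simp only [cobd, h]
    generalize spinMod z e.1 = a; generalize spinMod z (bondEnd e) = b
    revert a b; decide
  rw [seaSign, seaSign, walls_flipAll, hc, h]; ring

end Sign

/-! ### The bottleneck structure of the Ising model -/

section Structure

variable {n : ℕ} [NeZero n]

/-- All clusters of domain walls of `z` have fewer than `M` bonds. -/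
def SmallWalls (M : ℝ) (z : Config (Torus n)) : Prop :=
  ∀ e ∈ walls z, ((cluster nbBond (walls z) e).card : ℝ) < M

open Classical in
/-- The nonempty cuts all of whose clusters have at least `L` bonds. -/
noncomputable def largeCuts (n : ℕ) [NeZero n] (L : ℝ) : Finset (Finset (Bond n)) :=
  Finset.univ.filter fun B => B.Nonempty ∧
    (∃ A : Finset (Torus n), ∀ e, e ∈ B ↔ ¬(e.1 ∈ A ↔ bondEnd e ∈ A)) ∧
    ∀ e ∈ B, L ≤ ((cluster nbBond B e).card : ℝ)

open Classical in
/-- The wells hold the configurations with a given sign of the sea whose clusters of domain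
walls have fewer than `L` bonds, and the bottlenecks those with clusters of up to `M` bonds. -/
noncomputable def seaStructure (n : ℕ) [NeZero n] (L M : ℝ) :
    Bottleneck (Torus n) (Bond n) (ZMod 2) where
  well k := {z | SmallWalls L z ∧ seaSign z = k}
  neck k := {z | (SmallWalls M z ∧ ¬ SmallWalls L z) ∧ seaSign z = k}
  ind _ := (largeCuts n L).filter fun B => (B.card : ℝ) < M
  indOut := largeCuts n L

theorem SmallWalls.mono {L M : ℝ} (h : L ≤ M) {z : Config (Torus n)} (hz : SmallWalls L z) :
    SmallWalls M z := fun e he => (hz e he).trans_le h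

theorem mem_sector {L M : ℝ} (h : L ≤ M) {z : Config (Torus n)} {k : ZMod 2} :
    z ∈ (seaStructure n L M).sector k ↔ SmallWalls M z ∧ seaSign z = k := by
  simp only [Bottleneck.sector, seaStructure, Set.mem_union, Set.mem_ofPred_eq]
  constructor
  · rintro (h' | h')
    · exact ⟨h'.1.mono h, h'.2⟩
    · exact ⟨h'.1.1, h'.2⟩
  · intro h'
    by_cases hL : SmallWalls L z
    · exact Or.inl ⟨hL, h'.2⟩
    · exact Or.inr ⟨⟨h'.1, hL⟩, h'.2⟩

theorem mem_outer {L M : ℝ} (h : L ≤ M) {z : Config (Torus n)} :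
    z ∈ (seaStructure n L M).outer ↔ ¬ SmallWalls M z := by
  simp only [Bottleneck.outer, Set.mem_ofPred_eq, mem_sector h, not_and]
  exact ⟨fun h hs => h _ hs rfl, fun h _ hs => absurd hs h⟩

/-- A union of large clusters of domain walls is one of the large cuts as soon as it is a
coboundary. -/
theorem mem_largeCuts_of_saturated {L : ℝ} {z : Config (Torus n)} {B : Finset (Bond n)}
    (hB : B ⊆ walls z) (hne : B.Nonempty)
    (hsat : ∀ a ∈ B, ∀ b ∈ walls z, b ∈ nbBond a → b ∈ B)
    (hcut : ∃ A, cobd A = restr (cobd (spinMod z)) B)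
    (hL : ∀ e ∈ B, L ≤ ((cluster nbBond (walls z) e).card : ℝ)) : B ∈ largeCuts n L := by
  simp only [largeCuts, Finset.mem_filter, Finset.mem_univ, true_and]
  refine ⟨hne, ?_, fun e he => ?_⟩
  · obtain ⟨A, hA⟩ := hcut
    refine ⟨Finset.univ.filter fun v => A v = 1, fun e => ?_⟩
    have h1 : e ∈ B ↔ cobd A e ≠ 0 := by
      rw [hA, restr]
      by_cases he : e ∈ B
      · simp only [he, if_true, true_iff]
        exact cobd_spinMod_ne_zero.2 (hB he)
      · simp [he]
    rw [h1, cobd]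
    simp only [Finset.mem_filter, Finset.mem_univ, true_and]
    generalize A e.1 = a
    generalize A (bondEnd e) = b
    revert a b; decide
  · rw [cluster_eq_of_saturated hB hsat he]
    exact hL e he

theorem detects_of_subset_walls {z : Config (Torus n)} {B : Finset (Bond n)}
    (hB : B ⊆ walls z) : Detects isingCheck B z := fun _ he => mem_walls.1 (hB he)

/-- Outside the sectors, the clusters of at least `M` bonds form a large cut together: their
complement in the domain walls is a union of clusters that are small enough to be filled. -/
theorem exists_detect_outer {L M : ℝ} (hLM : L ≤ M) (hM : M ≤ n) {z : Config (Torus n)}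
    (hz : ¬ SmallWalls M z) : ∃ B ∈ largeCuts n L, Detects isingCheck B z := by
  classical
  set W := walls z with hW
  let B := W.filter fun e => M ≤ ((cluster nbBond W e).card : ℝ)
  have hBW : B ⊆ W := Finset.filter_subset _ _
  refine ⟨B, mem_largeCuts_of_saturated hBW ?_ ?_ ?_ ?_, detects_of_subset_walls hBW⟩
  · simp only [SmallWalls, not_forall, not_lt] at hz
    obtain ⟨e, he, h⟩ := hz
    exact ⟨e, Finset.mem_filter.2 ⟨he, h⟩⟩
  · intro a ha b hb hab
    have ha' := Finset.mem_filter.1 ha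
    refine Finset.mem_filter.2 ⟨hb, ?_⟩
    rw [cluster_eq_of_mem nbBond_symm (mem_cluster.2 ⟨hb, .of_nb ha'.1 hb hab⟩)]
    exact ha'.2
  · refine ⟨spinMod z + ∑ y ∈ (clusters nbBond W).filter (fun y => ¬ M ≤ (y.card : ℝ)),
      fill (restr (cobd (spinMod z)) y), ?_⟩
    rw [cobd_add, cobd_sum]
    have hspec : ∀ y ∈ (clusters nbBond W).filter (fun y => ¬ M ≤ (y.card : ℝ)),
        cobd (fill (restr (cobd (spinMod z)) y)) = restr (cobd (spinMod z)) y := by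
      intro y hy
      rw [Finset.mem_filter, not_le] at hy
      refine (fill_spec (plaquetteClosed_cobd _) (fun e => cobd_spinMod_ne_zero.1) hy.1 ?_).1
      exact_mod_cast hy.2.trans_le hM
    rw [Finset.sum_congr rfl hspec]
    ext e
    rw [Pi.add_apply, Finset.sum_apply, Finset.sum_filter]
    have h1 : ∀ y ∈ clusters nbBond W,
        (if ¬ M ≤ (y.card : ℝ) then restr (cobd (spinMod z)) y e else 0) =
        if e ∈ y then (if e ∈ B then 0 else cobd (spinMod z) e) else 0 := by
      intro y hy
      by_cases hey : e ∈ y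
      · have : e ∈ B ↔ M ≤ (y.card : ℝ) := by
          simp only [B, Finset.mem_filter, subset_of_mem_clusters hy hey, true_and]
          rw [← eq_cluster_of_mem nbBond_symm hy hey]
        simp only [restr, hey, if_true, this]
        split_ifs <;> simp_all
      · simp [restr, hey]
    rw [Finset.sum_congr rfl h1, sum_clusters_ite nbBond_symm]
    by_cases heW : e ∈ W
    · rw [if_pos heW, restr]
      split_ifs
      · simp
      · exact CharTwo.add_self_eq_zero _
    · have h0 : cobd (spinMod z) e = 0 := by
        by_contra h; exact heW (cobd_spinMod_ne_zero.1 h)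
      simp [heW, restr, h0]
  · intro e he
    exact hLM.trans (Finset.mem_filter.1 he).2

/-- In a bottleneck, a single cluster of at least `L` and fewer than `M` bonds is a large cut. -/
theorem exists_detect_neck {L M : ℝ} (hM : M ≤ n) {z : Config (Torus n)}
    (hz : SmallWalls M z) (hz' : ¬ SmallWalls L z) :
    ∃ B ∈ (largeCuts n L).filter (fun B => (B.card : ℝ) < M), Detects isingCheck B z := by
  simp only [SmallWalls, not_forall, not_lt] at hz'
  obtain ⟨e, he, h⟩ := hz'
  have hc := cluster_mem_clusters (nb := nbBond) he
  have hsub := subset_of_mem_clusters hc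
  refine ⟨cluster nbBond (walls z) e, Finset.mem_filter.2 ⟨?_, hz e he⟩,
    detects_of_subset_walls hsub⟩
  refine mem_largeCuts_of_saturated hsub ⟨e, mem_cluster_self he⟩ ?_ ?_ ?_
  · exact fun a ha b hb hab => mem_of_nb nbBond_symm hc ha hb hab
  · refine ⟨_, (fill_spec (plaquetteClosed_cobd _) (fun e => cobd_spinMod_ne_zero.1) hc ?_).1⟩
    exact_mod_cast (hz e he).trans_le hM
  · intro f hf
    rw [cluster_eq_of_mem nbBond_symm hf]
    exact h

/-- Two configurations differ by the flip of as many spins as their Hamming distance. -/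
theorem exists_flipOn {Λ : Type} [Fintype Λ] [DecidableEq Λ] (z z' : Config Λ) :
    ∃ D : Finset Λ, D.card = hammingDist z z' ∧ z' = flipOn D z := by
  refine ⟨Finset.univ.filter fun i => z i ≠ z' i, rfl, ?_⟩
  ext i
  simp only [flipOn, Finset.mem_filter, Finset.mem_univ, true_and]
  cases h : z i <;> cases h' : z' i <;> simp

/-- The clusters after adding the bonds that meet few sites. -/
theorem card_cluster_union_star_le {R : ℕ} {M : ℝ} (hM : 0 ≤ M) {z : Config (Torus n)}
    (hz : SmallWalls M z) {D : Finset (Torus n)} (hD : D.card ≤ R) (e : Bond n) :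
    ((cluster nbBond (walls z ∪ star D) e).card : ℝ) ≤ M + (4 * R + 72 * R * M) := by
  refine (card_cluster_union_le card_nbBond_le hM (fun e he => (hz e he).le) e).trans ?_
  have h1 : ((star D).card : ℝ) ≤ 4 * R := by
    exact_mod_cast (card_star_le D).trans (Nat.mul_le_mul_left 4 hD)
  have h2 : ((star D).card : ℝ) * (18 : ℕ) * M ≤ 72 * R * M := by
    push_cast
    nlinarith [mul_le_mul_of_nonneg_right h1 hM]
  linarith

theorem seaSign_eq_of_near {R : ℕ} {M : ℝ} (hM : 0 ≤ M) (hn : M + (4 * R + 72 * R * M) < n)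
    {z z' : Config (Torus n)} (hz : SmallWalls M z) (hd : hammingDist z z' ≤ R) :
    seaSign z' = seaSign z := by
  obtain ⟨D, hD, rfl⟩ := exists_flipOn z z'
  refine seaSign_eq_of_small fun y hy => ?_
  obtain ⟨e, _, rfl⟩ := mem_clusters.1 hy
  exact_mod_cast (card_cluster_union_star_le hM hz (hD.le.trans hd) e).trans_lt hn

/-- Sectors with different signs of the sea are far apart. -/
theorem sector_sep {R : ℕ} {L M : ℝ} (hM : 0 ≤ M) (hLM : L ≤ M)
    (hn : M + (4 * R + 72 * R * M) < n) {k k' : ZMod 2} (hk : k ≠ k')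
    {z z' : Config (Torus n)} (hz : z ∈ (seaStructure n L M).sector k)
    (hz' : z' ∈ (seaStructure n L M).sector k') : R < hammingDist z z' := by
  rw [mem_sector hLM] at hz hz'
  by_contra! h
  exact hk (hz.2 ▸ hz'.2 ▸ (seaSign_eq_of_near hM hn hz.1 h).symm)

theorem smallWalls_flipAll {M : ℝ} {z : Config (Torus n)} :
    SmallWalls M (flipAll z) ↔ SmallWalls M z := by rw [SmallWalls, walls_flipAll]; rfl

theorem flipAll_flipAll {Λ : Type} (z : Config Λ) : flipAll (flipAll z) = z := by
  ext i; simp [flipAll]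

omit [NeZero n] in
theorem isingCheck_congr {e : Bond n} {z z' : Config (Torus n)} (h1 : z e.1 = z' e.1)
    (h2 : z (bondEnd e) = z' (bondEnd e)) : isingCheck e z = isingCheck e z' := by
  rw [isingCheck, isingCheck, h1, h2]

omit [NeZero n] in
theorem endpoint_of_actsOn {e : Bond n} {i : Torus n} (h : ActsOn (isingCheck e) i) :
    i = e.1 ∨ i = bondEnd e := by
  by_contra! hi
  obtain ⟨z, b, h⟩ := h
  exact h (isingCheck_congr (Function.update_of_ne hi.1.symm _ _)
    (Function.update_of_ne hi.2.symm _ _))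

theorem seaStructure_isBottleneck {R : ℕ} (hR : 1 ≤ R) {L M : ℝ} (hL : 0 ≤ L) (hLM : L ≤ M)
    (hgrow : L + (4 * R + 72 * R * L) < M) (hn : M + (4 * R + 72 * R * M) < n) :
    IsBottleneck isingCheck 4 R (seaStructure n L M) where
  one_le := hR
  check_local e := by
    have : {i | ActsOn (isingCheck e) i} ⊆ (({e.1, bondEnd e} : Finset (Torus n)) : Set _) := by
      intro i hi; simpa using endpoint_of_actsOn hi
    refine (Set.ncard_le_ncard this (Finset.finite_toSet _)).trans ?_
    rw [Set.ncard_coe_finset]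
    exact Finset.card_le_two.trans (by norm_num)
  check_degree i := by
    have : {e | ActsOn (isingCheck e) i} ⊆ ((star {i} : Finset (Bond n)) : Set _) := by
      intro e he
      simp only [Finset.mem_coe, mem_star, Finset.mem_singleton]
      rcases endpoint_of_actsOn he with h | h
      · exact Or.inl h.symm
      · exact Or.inr h.symm
    refine ⟨(Set.ncard_le_ncard this (Finset.finite_toSet _)).trans ?_,
      (Finset.finite_toSet _).subset this⟩
    rw [Set.ncard_coe_finset]
    simpa using card_star_le {i}
  well_sep k k' hk z hz z' hz' :=
    sector_sep (hL.trans hLM) hLM hn hk (Or.inl hz) (Or.inl hz')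
  neck_disjoint k := by
    rw [Set.disjoint_left]
    exact fun z hz hz' => hz'.1.2 hz.1
  neck_nbhd k z hz z' hd := by
    rw [mem_sector hLM]
    refine ⟨fun e he => ?_, ?_⟩
    · obtain ⟨D, hD, rfl⟩ := exists_flipOn z z'
      refine lt_of_le_of_lt ?_ hgrow
      refine le_trans ?_ (card_cluster_union_star_le hL hz.1 (hD.le.trans hd) e)
      exact_mod_cast Finset.card_le_card (cluster_mono (walls_flipOn_subset z D) e)
    · rw [seaSign_eq_of_near (hL.trans hLM) hn (hz.1.mono hLM) hd]
      exact hz.2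
  neck_detect k z hz := by
    refine exists_detect_neck ?_ hz.1.1 hz.1.2
    have : 0 ≤ (4 * R + 72 * R * M : ℝ) := by
      have := hL.trans hLM
      positivity
    linarith

theorem seaStructure_isSSB {R : ℕ} (hR : 1 ≤ R) {L M : ℝ} (hL : 0 < L) (hLM : L ≤ M)
    (hgrow : L + (4 * R + 72 * R * L) < M) (hn : M + (4 * R + 72 * R * M) < n) :
    IsSSB isingCheck 4 R (seaStructure n L M) where
  bottleneck := seaStructure_isBottleneck hR hL.le hLM hgrow hn
  check_symm := isingCheck_flipAll
  well_nonempty k := by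
    have hz : SmallWalls L (fun _ : Torus n => false) := by
      intro e he
      rw [mem_walls] at he
      simp [isingCheck] at he
    have h2 : ∀ a b : ZMod 2, a = b ∨ a + 1 = b := by decide
    rcases h2 (seaSign fun _ : Torus n => false) k with h | h
    · exact ⟨_, hz, h⟩
    · exact ⟨flipAll fun _ => false, smallWalls_flipAll.2 hz, by rw [seaSign_flipAll, h]⟩
  well_flip k := by
    ext z
    constructor
    · rintro ⟨w, hw, rfl⟩
      exact ⟨smallWalls_flipAll.2 hw.1, by rw [seaSign_flipAll, hw.2]⟩
    · intro hz
      refine ⟨flipAll z, ⟨smallWalls_flipAll.2 hz.1, ?_⟩, flipAll_flipAll z⟩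
      rw [seaSign_flipAll, hz.2, add_assoc, CharTwo.add_self_eq_zero, add_zero]
  neck_flip k := by
    ext z
    constructor
    · rintro ⟨w, hw, rfl⟩
      exact ⟨⟨smallWalls_flipAll.2 hw.1.1, fun h => hw.1.2 (smallWalls_flipAll.1 h)⟩,
        by rw [seaSign_flipAll, hw.2]⟩
    · intro hz
      refine ⟨flipAll z, ⟨⟨smallWalls_flipAll.2 hz.1.1,
        fun h => hz.1.2 (smallWalls_flipAll.1 h)⟩, ?_⟩, flipAll_flipAll z⟩
      rw [seaSign_flipAll, hz.2, add_assoc, CharTwo.add_self_eq_zero, add_zero]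

theorem le_card_of_mem_largeCuts {L : ℝ} {B : Finset (Bond n)} (hB : B ∈ largeCuts n L) :
    L ≤ (B.card : ℝ) := by
  simp only [largeCuts, Finset.mem_filter] at hB
  obtain ⟨-, ⟨e, he⟩, -, h⟩ := hB
  exact (h e he).trans (by exact_mod_cast Finset.card_le_card (cluster_subset B e))

theorem exists_cut_of_mem_largeCuts {L : ℝ} {B : Finset (Bond n)} (hB : B ∈ largeCuts n L) :
    ∃ A : Finset (Torus n), ∀ e, e ∈ B ↔ ¬(e.1 ∈ A ↔ bondEnd e ∈ A) := by
  simp only [largeCuts, Finset.mem_filter] at hB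
  exact hB.2.2.1

theorem card_largeCuts_filter_le {L : ℝ} (hL : 0 < L)
    (hlog : Real.log (2 * n ^ 2 + 1) ≤ L) (m : ℕ) :
    (((largeCuts n L).filter fun B => B.card = m).card : ℝ) ≤ Real.exp (19 * m) := by
  have h := card_large_clusters_le (nb := nbBond) nbBond_symm self_mem_nbBond card_nbBond_le hL m
    ((largeCuts n L).filter fun B => B.card = m) (fun B hB => (Finset.mem_filter.1 hB).2)
    (fun B hB => by
      have := (Finset.mem_filter.1 hB).1
      simp only [largeCuts, Finset.mem_filter] at this
      exact this.2.2.2)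
  refine h.trans ?_
  have hcard : (Fintype.card (Bond n) : ℝ) = 2 * n ^ 2 := by
    simp only [Fintype.card_prod, ZMod.card, Fintype.card_bool]
    push_cast; ring
  rw [hcard]
  have h1 : (2 * n ^ 2 + 1 : ℝ) ^ ((m : ℝ) / L) ≤ Real.exp m := by
    rw [Real.rpow_def_of_pos (by positivity)]
    refine Real.exp_le_exp.2 ?_
    rw [mul_div_assoc', div_le_iff₀ hL, mul_comm]
    exact mul_le_mul_of_nonneg_left hlog (Nat.cast_nonneg m)
  have h2 : (2 : ℝ) ^ (18 * m) ≤ Real.exp (18 * m) := by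
    have : (2 : ℝ) ≤ Real.exp 1 := by linarith [Real.add_one_le_exp 1]
    calc (2 : ℝ) ^ (18 * m) ≤ Real.exp 1 ^ (18 * m) := by gcongr
      _ = Real.exp (18 * m) := by rw [← Real.exp_nat_mul]; push_cast; ring_nf
  calc (2 * n ^ 2 + 1 : ℝ) ^ ((m : ℝ) / L) * 2 ^ (18 * m)
      ≤ Real.exp m * Real.exp (18 * m) := by gcongr
    _ = Real.exp (19 * m) := by rw [← Real.exp_add]; ring_nf

theorem card_ind_le {L M : ℝ} (hL : 0 < L) (hM : 0 ≤ M)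
    (hlog : Real.log (2 * n ^ 2 + 1) ≤ L) :
    (((largeCuts n L).filter fun B => (B.card : ℝ) < M).card : ℝ) ≤ Real.exp (20 * M) := by
  classical
  have hsub : ((largeCuts n L).filter fun B => (B.card : ℝ) < M) ⊆
      ((Finset.range ⌈M⌉₊).filter fun m : ℕ => (m : ℝ) < M).biUnion
        fun m => (largeCuts n L).filter fun B => B.card = m := by
    intro B hB
    rw [Finset.mem_filter] at hB
    simp only [Finset.mem_biUnion, Finset.mem_filter, Finset.mem_range]
    exact ⟨B.card, ⟨Nat.lt_ceil.2 hB.2, hB.2⟩, hB.1, rfl⟩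
  have h1 : (((largeCuts n L).filter fun B => (B.card : ℝ) < M).card : ℝ) ≤
      ∑ m ∈ (Finset.range ⌈M⌉₊).filter (fun m : ℕ => (m : ℝ) < M), Real.exp (19 * M) := by
    refine le_trans (b := ((∑ m ∈ (Finset.range ⌈M⌉₊).filter (fun m : ℕ => (m : ℝ) < M),
      ((largeCuts n L).filter fun B => B.card = m).card : ℕ) : ℝ)) ?_ ?_
    · exact_mod_cast (Finset.card_le_card hsub).trans Finset.card_biUnion_le
    · rw [Nat.cast_sum]
      refine Finset.sum_le_sum fun m hm => (card_largeCuts_filter_le hL hlog m).trans ?_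
      have := (Finset.mem_filter.1 hm).2
      exact Real.exp_le_exp.2 (by linarith)
  refine h1.trans ?_
  rw [Finset.sum_const, nsmul_eq_mul]
  have h2 : (((Finset.range ⌈M⌉₊).filter fun m : ℕ => (m : ℝ) < M).card : ℝ) ≤ M + 1 := by
    refine le_trans (b := (⌈M⌉₊ : ℝ)) ?_ (Nat.ceil_lt_add_one hM).le
    exact_mod_cast (Finset.card_filter_le _ _).trans (Finset.card_range _).le
  calc _ ≤ (M + 1) * Real.exp (19 * M) := by gcongr
    _ ≤ Real.exp M * Real.exp (19 * M) := by gcongr; exact Real.add_one_le_exp M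
    _ = Real.exp (20 * M) := by rw [← Real.exp_add]; ring_nf

end Structure

/-! ### Matrix elements of operators -/

section Entries

variable {Λ : Type} [Fintype Λ] [DecidableEq Λ]

theorem apply_eq_sum (O : Op Λ) (ψ : Hilb Λ) (z : Config Λ) :
    O ψ z = ∑ z', entry O z z' * ψ z' := by
  have h : ψ = ∑ z', ψ z' • (EuclideanSpace.single z' (1 : ℂ) : Hilb Λ) := by
    ext w
    simp [Pi.single_apply]
  conv_lhs => rw [h, map_sum]
  simp only [map_smul, WithLp.ofLp_sum, Finset.sum_apply, WithLp.ofLp_smul, Pi.smul_apply,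
    smul_eq_mul]
  exact Finset.sum_congr rfl fun w _ => mul_comm _ _

theorem op_ext {O O' : Op Λ} (h : ∀ z z', entry O z z' = entry O' z z') : O = O' := by
  ext ψ z
  rw [apply_eq_sum, apply_eq_sum]
  simp only [h]

theorem entry_toEuclideanCLM (M : Matrix (Config Λ) (Config Λ) ℂ) (z z' : Config Λ) :
    entry (Matrix.toEuclideanCLM (𝕜 := ℂ) M) z z' = M z z' := by
  rw [entry, Matrix.ofLp_toEuclideanCLM, PiLp.ofLp_single, Matrix.mulVec_single_one]
  rfl

theorem entry_diagOp (f : Config Λ → ℝ) (z z' : Config Λ) :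
    entry (diagOp f) z z' = if z = z' then (f z : ℂ) else 0 := by
  rw [diagOp, entry_toEuclideanCLM, Matrix.diagonal_apply]

theorem entry_mul (O O' : Op Λ) (z z' : Config Λ) :
    entry (O * O') z z' = ∑ w, entry O z w * entry O' w z' := by
  rw [entry, mul_apply_eq_comp, apply_eq_sum]
  rfl

theorem entry_add (O O' : Op Λ) (z z' : Config Λ) :
    entry (O + O') z z' = entry O z z' + entry O' z z' := rfl

theorem entry_smul (c : ℂ) (O : Op Λ) (z z' : Config Λ) :
    entry (c • O) z z' = c * entry O z z' := rfl

theorem entry_sum {ι : Type*} (s : Finset ι) (O : ι → Op Λ) (z z' : Config Λ) :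
    entry (∑ i ∈ s, O i) z z' = ∑ i ∈ s, entry (O i) z z' := by
  simp [entry]

theorem diagOp_apply (f : Config Λ → ℝ) (ψ : Hilb Λ) (z : Config Λ) :
    diagOp f ψ z = f z * ψ z := by
  rw [apply_eq_sum]
  simp [entry_diagOp]

open Classical in
theorem projOn_apply (X : Set (Config Λ)) (ψ : Hilb Λ) (z : Config Λ) :
    projOn X ψ z = if z ∈ X then ψ z else 0 := by
  rw [projOn, diagOp_apply]
  split_ifs <;> simp

open Classical in
theorem entry_projOn_mul (X : Set (Config Λ)) (O : Op Λ) (z z' : Config Λ) :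
    entry (projOn X * O) z z' = if z ∈ X then entry O z z' else 0 := by
  rw [entry, mul_apply_eq_comp, projOn_apply]
  rfl

open Classical in
theorem entry_mul_projOn (X : Set (Config Λ)) (O : Op Λ) (z z' : Config Λ) :
    entry (O * projOn X) z z' = if z' ∈ X then entry O z z' else 0 := by
  rw [entry_mul]
  simp only [projOn, entry_diagOp]
  rw [Finset.sum_eq_single z']
  · rw [if_pos rfl]
    split_ifs <;> simp
  · intro w _ hw; simp [hw]
  · simp

/-- Two sets of configurations are decoupled by an operator without matrix elements between
them. -/
theorem projOn_mul_mul_projOn_eq_zero {X Y : Set (Config Λ)} {O : Op Λ}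
    (h : ∀ z ∈ X, ∀ z' ∈ Y, entry O z z' = 0) : projOn X * O * projOn Y = 0 := by
  classical
  refine op_ext fun z z' => ?_
  rw [entry_mul_projOn, entry_projOn_mul]
  split_ifs with h1 h2
  · exact h z h2 z' h1
  · rfl
  · rfl

theorem one_sub_projOn (X : Set (Config Λ)) : 1 - projOn X = projOn Xᶜ := by
  classical
  ext ψ z
  have : (1 - projOn X : Op Λ) ψ z = ψ z - projOn X ψ z := rfl
  rw [this, projOn_apply, projOn_apply]
  by_cases h : z ∈ X <;> simp [h]

theorem isSelfAdjoint_diagOp (f : Config Λ → ℝ) : IsSelfAdjoint (diagOp f : Op Λ) := by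
  rw [diagOp, IsSelfAdjoint, ← map_star]
  congr 1
  rw [Matrix.star_eq_conjTranspose, Matrix.diagonal_conjTranspose]
  congr 1
  ext z
  simp

theorem inner_eq_sum (φ ψ : Hilb Λ) : inner ℂ φ ψ = ∑ z, (starRingEnd ℂ) (φ z) * ψ z := by
  rw [PiLp.inner_apply]
  refine Finset.sum_congr rfl fun z _ => ?_
  rw [RCLike.inner_apply, mul_comm]

theorem inner_apply_eq_sum (O : Op Λ) (φ ψ : Hilb Λ) :
    inner ℂ φ (O ψ) = ∑ z, ∑ z', (starRingEnd ℂ) (φ z) * (entry O z z' * ψ z') := by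
  rw [inner_eq_sum]
  refine Finset.sum_congr rfl fun z _ => ?_
  rw [apply_eq_sum, Finset.mul_sum]

theorem norm_sq_eq_sum (ψ : Hilb Λ) : ‖ψ‖ ^ 2 = ∑ z, ‖ψ z‖ ^ 2 :=
  EuclideanSpace.norm_sq_eq ψ

theorem energy_add (O O' : Op Λ) (ψ : Hilb Λ) : energy (O + O') ψ = energy O ψ + energy O' ψ := by
  simp [energy]

theorem energy_sum {ι : Type*} (s : Finset ι) (O : ι → Op Λ) (ψ : Hilb Λ) :
    energy (∑ i ∈ s, O i) ψ = ∑ i ∈ s, energy (O i) ψ := by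
  simp [energy]

theorem energy_diagOp (f : Config Λ → ℝ) (ψ : Hilb Λ) :
    energy (diagOp f) ψ = ∑ z, f z * ‖ψ z‖ ^ 2 := by
  rw [energy, inner_eq_sum, Complex.re_sum]
  refine Finset.sum_congr rfl fun z _ => ?_
  rw [diagOp_apply]
  have : (starRingEnd ℂ) (ψ z) * (f z * ψ z) = f z * ((starRingEnd ℂ) (ψ z) * ψ z) := by ring
  rw [this, RCLike.conj_mul, Complex.re_ofReal_mul]
  norm_cast

theorem abs_energy_le (O : Op Λ) (ψ : Hilb Λ) : |energy O ψ| ≤ ‖O‖ * ‖ψ‖ ^ 2 := by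
  refine (Complex.abs_re_le_norm _).trans ((norm_inner_le_norm _ _).trans ?_)
  calc ‖ψ‖ * ‖O ψ‖ ≤ ‖ψ‖ * (‖O‖ * ‖ψ‖) := by gcongr; exact O.le_opNorm ψ
    _ = _ := by ring

theorem energy_smul (O : Op Λ) (c : ℝ) (ψ : Hilb Λ) :
    energy O ((c : ℂ) • ψ) = c ^ 2 * energy O ψ := by
  rw [energy, energy, map_smul, inner_smul_left, inner_smul_right, ← mul_assoc]
  rw [Complex.conj_ofReal, ← Complex.ofReal_mul, Complex.re_ofReal_mul]; ring

theorem bddBelow_energies (H : Op Λ) (X : Set (Config Λ)) :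
    BddBelow {x | ∃ ψ : Hilb Λ, ‖ψ‖ = 1 ∧ InSpan X ψ ∧ x = energy H ψ} := by
  refine ⟨-‖H‖, ?_⟩
  rintro x ⟨ψ, hψ, -, rfl⟩
  have := abs_le.1 (abs_energy_le H ψ)
  rw [hψ] at this
  linarith

/-- The variational principle for vectors that need not be normalized. -/
theorem minEnergyOn_mul_le (H : Op Λ) {X : Set (Config Λ)} {ψ : Hilb Λ} (hψ : InSpan X ψ) :
    minEnergyOn H X * ‖ψ‖ ^ 2 ≤ energy H ψ := by
  by_cases h0 : ψ = 0
  · simp [h0, energy]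
  have hn : 0 < ‖ψ‖ := norm_pos_iff.2 h0
  have h1 : ‖((‖ψ‖⁻¹ : ℝ) : ℂ) • ψ‖ = 1 := by
    rw [norm_smul, Complex.norm_real, Real.norm_of_nonneg (by positivity)]
    field_simp
  have h2 : minEnergyOn H X ≤ energy H (((‖ψ‖⁻¹ : ℝ) : ℂ) • ψ) := by
    refine csInf_le (bddBelow_energies H X) ⟨_, h1, fun z hz => ?_, rfl⟩
    simp [hψ z hz]
  rw [energy_smul] at h2
  calc minEnergyOn H X * ‖ψ‖ ^ 2 ≤ (‖ψ‖⁻¹ ^ 2 * energy H ψ) * ‖ψ‖ ^ 2 := by gcongr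
    _ = energy H ψ := by field_simp

theorem minEnergy_mul_le (H : Op Λ) (ψ : Hilb Λ) : minEnergy H * ‖ψ‖ ^ 2 ≤ energy H ψ :=
  minEnergyOn_mul_le H fun z hz => absurd (Set.mem_univ z) hz

/-- The lowest energy is attained at an eigenvector. -/
theorem exists_ground_state {H : Op Λ} (hH : IsSelfAdjoint H) :
    ∃ φ : Hilb Λ, ‖φ‖ = 1 ∧ H φ = ((minEnergy H : ℝ) : ℂ) • φ := by
  have hre : ∀ ψ : Hilb Λ, H.reApplyInnerSelf ψ = energy H ψ := by
    intro ψ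
    rw [ContinuousLinearMap.reApplyInnerSelf_apply, energy]
    exact inner_re_symm (𝕜 := ℂ) _ _
  have hne : (Metric.sphere (0 : Hilb Λ) 1).Nonempty :=
    ⟨EuclideanSpace.single (fun _ => false) 1, by simp⟩
  obtain ⟨φ, hφ, hmin⟩ := (isCompact_sphere (0 : Hilb Λ) 1).exists_isMinOn hne
    H.reApplyInnerSelf_continuous.continuousOn
  have hφ1 : ‖φ‖ = 1 := by simpa using hφ
  have hE : minEnergy H = energy H φ := by
    refine le_antisymm ?_ ?_
    · simpa [hφ1] using minEnergy_mul_le H φ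
    · refine le_csInf ⟨_, φ, hφ1, fun z hz => absurd (Set.mem_univ z) hz, rfl⟩ ?_
      rintro x ⟨ψ, hψ, -, rfl⟩
      have := isMinOn_iff.1 hmin ψ (by simpa using hψ)
      rwa [hre, hre] at this
  refine ⟨φ, hφ1, ?_⟩
  have hext : IsLocalExtrOn H.reApplyInnerSelf (Metric.sphere (0 : Hilb Λ) ‖φ‖) φ := by
    rw [hφ1]
    exact Or.inl hmin.localize
  rw [hE, hH.eq_smul_self_of_isLocalExtrOn hext]
  congr 2
  rw [ContinuousLinearMap.rayleighQuotient, hre, hφ1]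
  simp only [one_pow, div_one]
  rfl

theorem norm_sq_projOn (X : Set (Config Λ)) (ψ : Hilb Λ) [DecidablePred (· ∈ X)] :
    ‖projOn X ψ‖ ^ 2 = ∑ z, if z ∈ X then ‖ψ z‖ ^ 2 else 0 := by
  rw [norm_sq_eq_sum]
  refine Finset.sum_congr rfl fun z _ => ?_
  rw [projOn_apply]
  by_cases h : z ∈ X <;> simp [h]

theorem inSpan_projOn (X : Set (Config Λ)) (ψ : Hilb Λ) : InSpan X (projOn X ψ) := by
  classical
  intro z hz
  rw [projOn_apply, if_neg hz]

theorem norm_projOn_mono {X Y : Set (Config Λ)} (h : X ⊆ Y) (ψ : Hilb Λ) :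
    ‖projOn X ψ‖ ≤ ‖projOn Y ψ‖ := by
  classical
  refine le_of_sq_le_sq ?_ (norm_nonneg _)
  rw [norm_sq_projOn, norm_sq_projOn]
  refine Finset.sum_le_sum fun z _ => ?_
  by_cases hx : z ∈ X
  · simp [hx, h hx]
  · simp only [hx, if_false]; positivity

theorem norm_projOn_le (X : Set (Config Λ)) (ψ : Hilb Λ) : ‖projOn X ψ‖ ≤ ‖ψ‖ := by
  classical
  refine le_of_sq_le_sq ?_ (norm_nonneg _)
  rw [norm_sq_projOn, norm_sq_eq_sum]
  refine Finset.sum_le_sum fun z _ => ?_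
  split_ifs
  · rfl
  · positivity

end Entries

/-! ### Truncated flips and locally symmetric perturbations -/

section Flips

variable {Λ E : Type} [Fintype Λ] [DecidableEq Λ]

omit [Fintype Λ] in
theorem flipOn_flipOn (A : Finset Λ) (z : Config Λ) : flipOn A (flipOn A z) = z := by
  ext i
  by_cases h : i ∈ A <;> simp [flipOn, h]

/-- The truncated flip as a permutation of the configurations. -/
def flipEquiv (A : Finset Λ) : Config Λ ≃ Config Λ where
  toFun := flipOn A
  invFun := flipOn A
  left_inv := flipOn_flipOn A
  right_inv := flipOn_flipOn A

theorem flipOn_univ (z : Config Λ) : flipOn Finset.univ z = flipAll z := by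
  ext i; simp [flipOn, flipAll]

/-- The truncated flip `ℓ_A` acting on vectors. -/
def flipState (A : Finset Λ) (ψ : Hilb Λ) : Hilb Λ := WithLp.toLp 2 fun z => ψ (flipOn A z)

theorem norm_flipState (A : Finset Λ) (ψ : Hilb Λ) : ‖flipState A ψ‖ = ‖ψ‖ := by
  rw [← sq_eq_sq₀ (norm_nonneg _) (norm_nonneg _), norm_sq_eq_sum, norm_sq_eq_sum]
  exact Equiv.sum_comp (flipEquiv A) fun z => ‖ψ z‖ ^ 2

/-- `O` commutes with the truncated flip `ℓ_A`. -/
def FlipInvariant (A : Finset Λ) (O : Op Λ) : Prop :=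
  ∀ z z', entry O (flipOn A z) (flipOn A z') = entry O z z'

theorem FlipInvariant.energy_eq {A : Finset Λ} {O : Op Λ} (h : FlipInvariant A O) (ψ : Hilb Λ) :
    energy O (flipState A ψ) = energy O ψ := by
  rw [energy, energy, inner_apply_eq_sum, inner_apply_eq_sum]
  congr 1
  rw [← Equiv.sum_comp (flipEquiv A)
    fun z => ∑ z', (starRingEnd ℂ) (ψ z) * (entry O z z' * ψ z')]
  refine Finset.sum_congr rfl fun z _ => ?_
  rw [← Equiv.sum_comp (flipEquiv A)
    fun z' => (starRingEnd ℂ) (ψ (flipEquiv A z)) * (entry O (flipEquiv A z) z' * ψ z')]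
  refine Finset.sum_congr rfl fun z' _ => ?_
  rw [show entry O (flipEquiv A z) (flipEquiv A z') = entry O z z' from h z z']
  rfl

theorem FlipInvariant.mul {A : Finset Λ} {O O' : Op Λ} (h : FlipInvariant A O)
    (h' : FlipInvariant A O') : FlipInvariant A (O * O') := by
  intro z z'
  rw [entry_mul, entry_mul,
    ← Equiv.sum_comp (flipEquiv A) fun w => entry O (flipOn A z) w * entry O' w (flipOn A z')]
  exact Finset.sum_congr rfl fun w _ => congrArg₂ (· * ·) (h z w) (h' w z')

theorem flipInvariant_one (A : Finset Λ) : FlipInvariant A (1 : Op Λ) := by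
  have h : ∀ z z' : Config Λ, entry (1 : Op Λ) z z' = if z = z' then 1 else 0 := by
    intro z z'
    rw [entry, one_apply_eq_self, PiLp.single_apply]
  intro z z'
  rw [h, h]
  simp only [(flipEquiv A).injective.eq_iff' rfl, show flipOn A = flipEquiv A from rfl]

theorem FlipInvariant.list_prod {A : Finset Λ} {l : List (Op Λ)}
    (h : ∀ O ∈ l, FlipInvariant A O) : FlipInvariant A l.prod := by
  induction l with
  | nil => exact flipInvariant_one A
  | cons O l ih =>
    rw [List.prod_cons]
    exact (h O (by simp)).mul (ih fun O' h' => h O' (by simp [h']))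

theorem entry_flipOp (z z' : Config Λ) :
    entry (flipOp : Op Λ) z z' = if z = flipAll z' then 1 else 0 := by
  rw [flipOp, entry_toEuclideanCLM, Matrix.of_apply]

theorem entry_flipAll_of_commute {O : Op Λ} (h : flipOp * O = O * flipOp) (z z' : Config Λ) :
    entry O (flipAll z) (flipAll z') = entry O z z' := by
  have h1 : entry (flipOp * O) (flipAll z) z' = entry O z z' := by
    rw [entry_mul, Finset.sum_eq_single z]
    · simp [entry_flipOp]
    · intro w _ hw
      rw [entry_flipOp, if_neg, zero_mul]
      intro h
      apply hw
      rw [← flipAll_flipAll w, ← h, flipAll_flipAll]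
    · simp
  have h2 : entry (O * flipOp) (flipAll z) z' = entry O (flipAll z) (flipAll z') := by
    rw [entry_mul, Finset.sum_eq_single (flipAll z')]
    · simp [entry_flipOp]
    · intro w _ hw
      rw [entry_flipOp, if_neg hw, mul_zero]
    · simp
  rw [← h2, ← h, h1]

/-- A symmetric operator commutes with a truncated flip that does not cut its support. -/
theorem flipInvariant_of_supportedOn {F A : Finset Λ} {O : Op Λ} (hO : SupportedOn F O)
    (hsym : flipOp * O = O * flipOp) (hA : F ⊆ A ∨ Disjoint F A) : FlipInvariant A O := by
  intro z z'
  by_cases hz : ∃ i, i ∉ F ∧ z i ≠ z' i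
  · rw [hO.1 z z' hz]
    obtain ⟨i, hi, hne⟩ := hz
    refine hO.1 _ _ ⟨i, hi, ?_⟩
    simp only [flipOn]
    split_ifs
    · simpa using hne
    · exact hne
  · push Not at hz
    have hflip : ∀ i, i ∉ F → flipOn A z i = flipOn A z' i := by
      intro i hi
      simp only [flipOn, hz i hi]
    rcases hA with hA | hA
    · rw [← entry_flipAll_of_commute hsym z z']
      refine hO.2 _ _ _ _ (fun i hi => ?_) fun i hi => ⟨hflip i hi, ?_⟩
      · simp [flipOn, flipAll, hA hi]
      · simp [flipAll, hz i hi]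
    · refine hO.2 _ _ _ _ (fun i hi => ?_) fun i hi => ⟨hflip i hi, hz i hi⟩
      simp [flipOn, Finset.disjoint_left.1 hA hi]

variable {C : E → Config Λ → Bool} {q : ℕ} {V : Finset Λ → Op Λ}

/-- A term that does not commute with `ℓ_A` has a connected piece that `A` cuts, so it acts on
the inner boundary of `A`. -/
theorem exists_mem_innerBoundary (hV : IsLocallySymmetric C q V) {A F : Finset Λ}
    (h : ¬ FlipInvariant A (V F)) : ∃ i ∈ F, i ∈ innerBoundary C A := by
  obtain ⟨m, part, op, c, -, hF, hconn, hsupp, hsym, hVF⟩ := hV.decomposition F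
  by_contra! hno
  apply h
  have hop : FlipInvariant A (List.ofFn op).prod := by
    refine FlipInvariant.list_prod fun O hO => ?_
    obtain ⟨a, rfl⟩ := (List.mem_ofFn' _ _).1 hO
    refine flipInvariant_of_supportedOn (hsupp a) (hsym a) ?_
    by_contra! hcut
    obtain ⟨hsub, hdis⟩ := hcut
    rw [Finset.not_subset] at hsub
    rw [Finset.not_disjoint_iff] at hdis
    obtain ⟨v, hv, hvA⟩ := hsub
    obtain ⟨u, hu, huA⟩ := hdis
    obtain ⟨p⟩ := (hconn a).preconnected ⟨u, hu⟩ ⟨v, hv⟩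
    obtain ⟨d, -, hd1, hd2⟩ := p.exists_boundary_dart {x | x.1 ∈ A} huA hvA
    refine hno d.fst.1 ?_ ⟨hd1, d.snd.1, hd2, d.adj⟩
    rw [← hF]
    exact Finset.mem_biUnion.2 ⟨a, Finset.mem_univ _, d.fst.2⟩
  intro z z'
  rw [hVF, entry_smul, entry_smul, hop]

theorem flipInvariant_univ (hV : IsLocallySymmetric C q V) (F : Finset Λ) :
    FlipInvariant Finset.univ (V F) := by
  by_contra h
  obtain ⟨i, _, _, j, hj, _⟩ := exists_mem_innerBoundary hV h
  exact hj (Finset.mem_univ j)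

theorem sum_norm_le_localStrength (V : Finset Λ → Op Λ) (i : Λ) :
    ∑ F with i ∈ F, ‖V F‖ ≤ localStrength V :=
  le_ciSup (f := fun i : Λ => ∑ F with i ∈ F, ‖V F‖) (Set.finite_range _).bddAbove i

theorem localStrength_nonneg (V : Finset Λ → Op Λ) : 0 ≤ localStrength V :=
  Real.iSup_nonneg fun _ => Finset.sum_nonneg fun _ _ => norm_nonneg _

/-- The terms that meet a set of sites have total norm at most its size times the strength. -/
theorem sum_norm_le_of_meet (V : Finset Λ → Op Λ) (S : Finset Λ) (𝓕 : Finset (Finset Λ))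
    (h : ∀ F ∈ 𝓕, ∃ i ∈ F, i ∈ S) : ∑ F ∈ 𝓕, ‖V F‖ ≤ S.card * localStrength V := by
  have hone : ∀ F ∈ 𝓕, ‖V F‖ ≤ ∑ i ∈ S, if i ∈ F then ‖V F‖ else 0 := by
    intro F hF
    obtain ⟨i, hi, hS⟩ := h F hF
    refine le_trans (le_of_eq (if_pos hi).symm) (Finset.single_le_sum
      (f := fun i => if i ∈ F then ‖V F‖ else 0) (fun j _ => ?_) hS)
    split_ifs <;> simp
  calc ∑ F ∈ 𝓕, ‖V F‖
      ≤ ∑ F ∈ 𝓕, ∑ i ∈ S, (if i ∈ F then ‖V F‖ else 0) := Finset.sum_le_sum hone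
    _ ≤ ∑ F, ∑ i ∈ S, (if i ∈ F then ‖V F‖ else 0) :=
        Finset.sum_le_sum_of_subset_of_nonneg (Finset.subset_univ _) fun F _ _ =>
          Finset.sum_nonneg fun i _ => by split_ifs <;> simp
    _ = ∑ i ∈ S, ∑ F with i ∈ F, ‖V F‖ := by
        rw [Finset.sum_comm]
        simp only [Finset.sum_filter]
    _ ≤ ∑ _i ∈ S, localStrength V := Finset.sum_le_sum fun i _ => sum_norm_le_localStrength V i
    _ = _ := by rw [Finset.sum_const, nsmul_eq_mul]

/-- A truncated flip changes the energy of the perturbation by a boundary term only. -/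
theorem energy_flipState_perturbation (hV : IsLocallySymmetric C q V) (A : Finset Λ)
    (ψ : Hilb Λ) :
    energy (∑ F, V F) (flipState A ψ) -
      2 * ((innerBoundary C A).ncard * localStrength V) * ‖ψ‖ ^ 2 ≤ energy (∑ F, V F) ψ := by
  classical
  have hfin : (innerBoundary C A).Finite := Set.toFinite _
  have h1 := sum_norm_le_of_meet V hfin.toFinset
    (Finset.univ.filter fun F => ¬ FlipInvariant A (V F)) (by
      intro F hF
      obtain ⟨i, hi, hb⟩ := exists_mem_innerBoundary hV (Finset.mem_filter.1 hF).2
      exact ⟨i, hi, hfin.mem_toFinset.2 hb⟩)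
  rw [← Set.ncard_eq_toFinset_card _ hfin] at h1
  have h2 : energy (∑ F, V F) (flipState A ψ) - energy (∑ F, V F) ψ ≤
      ∑ F with ¬ FlipInvariant A (V F), 2 * ‖V F‖ * ‖ψ‖ ^ 2 := by
    rw [energy_sum, energy_sum, ← Finset.sum_sub_distrib, Finset.sum_filter]
    refine Finset.sum_le_sum fun F _ => ?_
    split_ifs with h
    · rw [h.energy_eq, sub_self]
    · have e1 := (abs_le.1 (abs_energy_le (V F) (flipState A ψ))).2
      have e2 := (abs_le.1 (abs_energy_le (V F) ψ)).1
      rw [norm_flipState] at e1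
      linarith
  rw [← Finset.sum_mul, ← Finset.mul_sum] at h2
  have h3 := mul_le_mul_of_nonneg_right h1 (sq_nonneg ‖ψ‖)
  nlinarith

/-- The strengthened classical estimate survives the perturbation, with a smaller gap. -/
theorem energy_flipState_le (hV : IsLocallySymmetric C q V) {H₀ : Config Λ → ℝ} {Δ c : ℝ}
    {A : Finset Λ} {B : Finset E} (hA : ((innerBoundary C A).ncard : ℝ) ≤ c * B.card)
    (hest : ∀ z ∈ window C B, Δ * B.card + H₀ (flipOn A z) ≤ H₀ z) {ψ : Hilb Λ}
    (hψ : InSpan (window C B) ψ) :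
    (Δ - 2 * c * localStrength V) * B.card * ‖ψ‖ ^ 2 +
      energy (diagOp H₀ + ∑ F, V F) (flipState A ψ) ≤ energy (diagOp H₀ + ∑ F, V F) ψ := by
  have h1 := energy_flipState_perturbation hV A ψ
  have h2 : Δ * B.card * ‖ψ‖ ^ 2 + energy (diagOp H₀) (flipState A ψ) ≤
      energy (diagOp H₀) ψ := by
    rw [energy_diagOp, energy_diagOp, norm_sq_eq_sum, Finset.mul_sum,
      ← Equiv.sum_comp (flipEquiv A), ← Finset.sum_add_distrib]
    rw [← Equiv.sum_comp (flipEquiv A) fun z => H₀ z * ‖ψ z‖ ^ 2]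
    refine Finset.sum_le_sum fun z _ => ?_
    have hs : flipState A ψ z = ψ (flipEquiv A z) := rfl
    rw [hs]
    by_cases hz : flipEquiv A z ∈ window C B
    · have := hest _ hz
      rw [show flipOn A (flipEquiv A z) = z from flipOn_flipOn A z] at this
      nlinarith [sq_nonneg ‖ψ (flipEquiv A z)‖]
    · simp [hψ _ hz]
  rw [energy_add, energy_add]
  have h3 := mul_le_mul_of_nonneg_right hA (localStrength_nonneg V)
  have h4 := mul_le_mul_of_nonneg_right h3 (sq_nonneg ‖ψ‖)
  nlinarith

theorem hammingDist_le_of_entry_ne_zero {F : Finset Λ} {O : Op Λ} (hO : SupportedOn F O)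
    {z z' : Config Λ} (h : entry O z z' ≠ 0) : hammingDist z z' ≤ F.card := by
  refine Finset.card_le_card fun i hi => ?_
  by_contra hF
  exact h (hO.1 z z' ⟨i, hF, (Finset.mem_filter.1 hi).2⟩)

theorem entry_hamiltonian (H₀ : Config Λ → ℝ) {z z' : Config Λ} (h : z ≠ z') :
    entry (diagOp H₀ + ∑ F, V F) z z' = ∑ F, entry (V F) z z' := by
  rw [entry_add, entry_diagOp, if_neg h, zero_add, entry_sum]

/-- The perturbed Hamiltonian only connects configurations at distance at most `q`. -/
theorem entry_hamiltonian_eq_zero (hV : IsLocallySymmetric C q V) (H₀ : Config Λ → ℝ)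
    {z z' : Config Λ} (h : q < hammingDist z z') :
    entry (diagOp H₀ + ∑ F, V F) z z' = 0 := by
  have hne : z ≠ z' := by
    rintro rfl; simp at h
  rw [entry_hamiltonian H₀ hne]
  refine Finset.sum_eq_zero fun F _ => ?_
  by_contra h0
  have h1 := hammingDist_le_of_entry_ne_zero (hV.supported F) h0
  have h2 : V F ≠ 0 := by
    intro hF
    apply h0
    rw [hF]; rfl
  have := hV.card_le F h2
  omega

end Flips

/-! ### The number of excited checks under local changes -/

section Excited

variable {Λ E : Type} [Fintype Λ] [DecidableEq Λ] {C : E → Config Λ → Bool} {g : ℕ}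

/-- A check only depends on the spins on which it acts. -/
theorem check_congr {c : Config Λ → Bool} {z z' : Config Λ}
    (h : ∀ i, ActsOn c i → z i = z' i) : c z' = c z := by
  classical
  have key : ∀ T : Finset Λ, c (fun i => if i ∈ T then z' i else z i) = c z := by
    intro T
    induction T using Finset.induction_on with
    | empty => simp
    | insert a T ha ih =>
      rw [← ih]
      have hup : (fun i => if i ∈ insert a T then z' i else z i) =
          Function.update (fun i => if i ∈ T then z' i else z i) a (z' a) := by
        ext i
        by_cases hi : i = a
        · subst hi; simp
        · simp [hi]
      rw [hup]
      by_contra hne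
      have hact : ActsOn c a := ⟨_, _, hne⟩
      apply hne
      congr 1
      rw [Function.update_eq_self_iff]
      simp [ha, h a hact]
  simpa using key Finset.univ

theorem check_eq_of_off {e : E} {F : Finset Λ} {z z' : Config Λ} (hz : ∀ i, i ∉ F → z i = z' i)
    (h : ∀ i ∈ F, ¬ ActsOn (C e) i) : C e z' = C e z := by
  refine check_congr fun i hi => ?_
  by_cases hF : i ∈ F
  · exact absurd hi (h i hF)
  · exact hz i hF

theorem excited_le_add (hdeg : ∀ i, {e | ActsOn (C e) i}.ncard ≤ g ∧
    {e | ActsOn (C e) i}.Finite) (B : Finset E) {F : Finset Λ} {z z' : Config Λ}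
    (hz : ∀ i, i ∉ F → z i = z' i) : excited C B z ≤ excited C B z' + F.card * g := by
  classical
  have hsub : (B.filter fun e => C e z = true) ⊆ (B.filter fun e => C e z' = true) ∪
      F.biUnion fun i => (hdeg i).2.toFinset := by
    intro e he
    rw [Finset.mem_filter] at he
    by_cases h : ∃ i ∈ F, ActsOn (C e) i
    · obtain ⟨i, hi, ha⟩ := h
      refine Finset.mem_union_right _ (Finset.mem_biUnion.2 ⟨i, hi, ?_⟩)
      simpa using ha
    · push Not at h
      refine Finset.mem_union_left _ (Finset.mem_filter.2 ⟨he.1, ?_⟩)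
      rw [check_eq_of_off hz h]; exact he.2
  refine (Finset.card_le_card hsub).trans ((Finset.card_union_le _ _).trans ?_)
  refine Nat.add_le_add le_rfl (Finset.card_biUnion_le_card_mul _ _ _ fun i _ => ?_)
  rw [← Set.ncard_eq_toFinset_card _ (hdeg i).2]
  exact (hdeg i).1

open Classical in
/-- The sites on which the checks of `B` act. -/
noncomputable def actSites (C : E → Config Λ → Bool) (B : Finset E) : Finset Λ :=
  B.biUnion fun e => Finset.univ.filter fun i => ActsOn (C e) i

theorem card_actSites_le (hloc : ∀ e, {i | ActsOn (C e) i}.ncard ≤ g) (B : Finset E) :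
    (actSites C B).card ≤ B.card * g := by
  classical
  refine Finset.card_biUnion_le_card_mul _ _ _ fun e _ => ?_
  refine le_trans (le_of_eq ?_) (hloc e)
  rw [← Set.ncard_coe_finset]
  congr 1
  ext i; simp

theorem excited_eq_of_disjoint {B : Finset E} {F : Finset Λ} (hF : Disjoint F (actSites C B))
    {z z' : Config Λ} (hz : ∀ i, i ∉ F → z i = z' i) : excited C B z = excited C B z' := by
  classical
  rw [excited, excited]
  congr 1
  refine Finset.filter_congr fun e he => ?_
  rw [check_eq_of_off (C := C) (e := e) hz fun i hi ha => Finset.disjoint_left.1 hF hi ?_]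
  simp only [actSites, Finset.mem_biUnion, Finset.mem_filter, Finset.mem_univ, true_and]
  exact ⟨e, he, ha⟩

end Excited

/-! ### Sums over indicators -/

/-- A family of sets of size at least `L`, with at most `exp (θ m)` members of size `m`, has a
geometrically small generating function. -/
theorem sum_pow_card_le {E : Type} (𝓑 : Finset (Finset E)) {L θ s r : ℝ}
    (hsize : ∀ B ∈ 𝓑, L ≤ (B.card : ℝ))
    (hcount : ∀ m : ℕ, ((𝓑.filter fun B => B.card = m).card : ℝ) ≤ Real.exp (θ * m))
    (hs : 0 ≤ s) (hr : 0 < r) (hr1 : r < 1) (hsr : Real.exp θ * s ≤ r) :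
    ∑ B ∈ 𝓑, s ^ B.card ≤ r ^ L / (1 - r) := by
  classical
  have hk : ∀ B ∈ 𝓑, ⌈L⌉₊ ≤ B.card := fun B hB => Nat.ceil_le.2 (hsize B hB)
  obtain ⟨N, hN⟩ : ∃ N, ∀ B ∈ 𝓑, B.card < N :=
    ⟨𝓑.sup Finset.card + 1, fun B hB => Nat.lt_succ_of_le (Finset.le_sup hB)⟩
  have h1 : ∑ B ∈ 𝓑, s ^ B.card =
      ∑ m ∈ Finset.Ico ⌈L⌉₊ N, ((𝓑.filter fun B => B.card = m).card : ℝ) * s ^ m := by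
    rw [← Finset.sum_fiberwise_of_maps_to (s := 𝓑) (t := Finset.Ico ⌈L⌉₊ N) (g := Finset.card)
      fun B hB => Finset.mem_Ico.2 ⟨hk B hB, hN B hB⟩]
    refine Finset.sum_congr rfl fun m _ => ?_
    rw [← nsmul_eq_mul, ← Finset.sum_const]
    exact Finset.sum_congr rfl fun B hB => by rw [(Finset.mem_filter.1 hB).2]
  rw [h1]
  calc ∑ m ∈ Finset.Ico ⌈L⌉₊ N, ((𝓑.filter fun B => B.card = m).card : ℝ) * s ^ m
      ≤ ∑ m ∈ Finset.Ico ⌈L⌉₊ N, r ^ m := by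
        refine Finset.sum_le_sum fun m _ => ?_
        calc ((𝓑.filter fun B => B.card = m).card : ℝ) * s ^ m
            ≤ Real.exp (θ * m) * s ^ m := by gcongr; exact hcount m
          _ = (Real.exp θ * s) ^ m := by rw [mul_pow, ← Real.exp_nat_mul, mul_comm θ]
          _ ≤ r ^ m := by gcongr
    _ ≤ r ^ ⌈L⌉₊ / (1 - r) := geom_sum_Ico_le_of_lt_one hr.le hr1
    _ ≤ r ^ L / (1 - r) := by
        have : 0 < 1 - r := by linarith
        gcongr
        rw [← Real.rpow_natCast]
        exact Real.rpow_le_rpow_of_exponent_ge hr hr1.le (Nat.le_ceil L)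

/-! ### Leakage of low-energy eigenvectors -/

section Leakage

variable {Λ E K : Type} [Fintype Λ] [DecidableEq Λ] {C : E → Config Λ → Bool} {g q : ℕ}
  {V : Finset Λ → Op Λ} {H₀ : Config Λ → ℝ}

theorem inner_apply_congr {X Y : Set (Config Λ)} {O O' : Op Λ} {φ χ : Hilb Λ}
    (hφ : InSpan X φ) (hχ : InSpan Y χ) (h : ∀ z ∈ X, ∀ z' ∈ Y, entry O z z' = entry O' z z') :
    inner ℂ φ (O χ) = inner ℂ φ (O' χ) := by
  rw [inner_apply_eq_sum, inner_apply_eq_sum]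
  refine Finset.sum_congr rfl fun z _ => Finset.sum_congr rfl fun z' _ => ?_
  by_cases hz : z ∈ X
  · by_cases hz' : z' ∈ Y
    · rw [h z hz z' hz']
    · simp only [hχ z' hz', mul_zero]
  · rw [hφ z hz, map_zero, zero_mul, zero_mul]

theorem inner_apply_eq_zero {X Y : Set (Config Λ)} {O : Op Λ} {φ χ : Hilb Λ}
    (hφ : InSpan X φ) (hχ : InSpan Y χ) (h : ∀ z ∈ X, ∀ z' ∈ Y, entry O z z' = 0) :
    inner ℂ φ (O χ) = 0 := by
  rw [inner_apply_congr (O' := 0) hφ hχ fun z hz z' hz' => (h z hz z' hz').trans rfl]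
  simp

theorem inner_projOn_self (X : Set (Config Λ)) (ψ : Hilb Λ) :
    inner ℂ (projOn X ψ) ψ = ((‖projOn X ψ‖ ^ 2 : ℝ) : ℂ) := by
  classical
  rw [norm_sq_projOn, inner_eq_sum, Complex.ofReal_sum]
  refine Finset.sum_congr rfl fun z _ => ?_
  rw [projOn_apply]
  split_ifs
  · rw [RCLike.conj_mul]; norm_cast
  · simp

/-- One step of the decay estimate.  On the configurations with at least `m` excited checks of
`B`, an eigenvector of low energy is driven only by the terms of the perturbation that act on
the checks of `B`, and these change the number of excited checks by at most `q g`. -/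
theorem norm_level_le
    (hloc : ∀ e, {i | ActsOn (C e) i}.ncard ≤ g)
    (hdeg : ∀ i, {e | ActsOn (C e) i}.ncard ≤ g ∧ {e | ActsOn (C e) i}.Finite)
    (hV : IsLocallySymmetric C q V) {B : Finset E} {ψ : Hilb Λ} {e G : ℝ}
    (hψ : (diagOp H₀ + ∑ F, V F) ψ = (e : ℂ) • ψ)
    (hgap : ∀ φ : Hilb Λ, InSpan (window C B) φ →
      G * ‖φ‖ ^ 2 ≤ energy (diagOp H₀ + ∑ F, V F) φ)
    {m : ℕ} (hm : 4 / 5 * (B.card : ℝ) ≤ m) :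
    (G - e) * ‖projOn {z | m ≤ excited C B z} ψ‖ ≤
      B.card * g * localStrength V * ‖projOn {z | m - q * g ≤ excited C B z} ψ‖ := by
  classical
  set H : Op Λ := diagOp H₀ + ∑ F, V F with hH
  set X : Set (Config Λ) := {z | m ≤ excited C B z} with hX
  set Y : Set (Config Λ) := {z | m - q * g ≤ excited C B z} with hY
  -- `ψ` is split by levels: at least `m`, within reach below `m`, and the rest.
  set ψ₁ := projOn X ψ with hψ₁
  set χ := projOn (Y \ X) ψ with hχ
  set ρ := projOn Yᶜ ψ with hρ
  let VB : Op Λ := ∑ F with ¬ Disjoint F (actSites C B), V F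
  have hXY : X ⊆ Y := by
    intro z hz
    simp only [hX, hY, Set.mem_ofPred_eq] at hz ⊢
    omega
  have hsplit : ψ = ψ₁ + χ + ρ := by
    ext z
    simp only [hψ₁, hχ, hρ, PiLp.add_apply, projOn_apply, Set.mem_sdiff, Set.mem_compl_iff]
    by_cases hx : z ∈ X
    · simp [hx, hXY hx]
    · by_cases hy : z ∈ Y <;> simp [hx, hy]
  have hVnorm : ‖VB‖ ≤ B.card * g * localStrength V := by
    refine (norm_sum_le _ _).trans ((sum_norm_le_of_meet V (actSites C B) _ ?_).trans ?_)
    · intro F hF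
      have := (Finset.mem_filter.1 hF).2
      rwa [Finset.not_disjoint_iff] at this
    · have := card_actSites_le hloc B
      have h2 : ((actSites C B).card : ℝ) ≤ B.card * g := by exact_mod_cast this
      exact mul_le_mul_of_nonneg_right h2 (localStrength_nonneg V)
  have hoff : ∀ F z z', entry (V F) z z' ≠ 0 → ∀ i, i ∉ F → z i = z' i := by
    intro F z z' h i hi
    by_contra hne
    exact h ((hV.supported F).1 z z' ⟨i, hi, hne⟩)
  have h1 : inner ℂ ψ₁ (H χ) = inner ℂ ψ₁ (VB χ) := by
    refine inner_apply_congr (inSpan_projOn X ψ) (inSpan_projOn _ ψ) fun z hz z' hz' => ?_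
    have hne : z ≠ z' := by rintro rfl; exact hz'.2 hz
    rw [hH, entry_hamiltonian H₀ hne, entry_sum, Finset.sum_filter]
    refine Finset.sum_congr rfl fun F _ => ?_
    split_ifs with hF
    · by_contra h0
      have := excited_eq_of_disjoint (C := C) (not_not.1 (by simpa using hF)) (hoff F z z' h0)
      simp only [hX, Set.mem_sdiff, Set.mem_ofPred_eq] at hz hz'
      omega
    · rfl
  have h2 : inner ℂ ψ₁ (H ρ) = 0 := by
    refine inner_apply_eq_zero (inSpan_projOn X ψ) (inSpan_projOn _ ψ) fun z hz z' hz' => ?_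
    have hne : z ≠ z' := by rintro rfl; exact hz' (hXY hz)
    rw [hH, entry_hamiltonian H₀ hne]
    refine Finset.sum_eq_zero fun F _ => ?_
    by_contra h0
    have h3 := excited_le_add hdeg B (hoff F z z' h0)
    have hVF : V F ≠ 0 := by
      intro hF; apply h0; rw [hF]; rfl
    have h4 := Nat.mul_le_mul_right g (hV.card_le F hVF)
    simp only [hX, hY, Set.mem_compl_iff, Set.mem_ofPred_eq] at hz hz'
    omega
  have h3 : inner ℂ ψ₁ (H ψ) = ((e * ‖ψ₁‖ ^ 2 : ℝ) : ℂ) := by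
    rw [hψ, inner_smul_right, inner_projOn_self, Complex.ofReal_mul]
  have h4 : energy H ψ₁ = e * ‖ψ₁‖ ^ 2 - (inner ℂ ψ₁ (VB χ)).re := by
    have : inner ℂ ψ₁ (H ψ) = inner ℂ ψ₁ (H ψ₁) + inner ℂ ψ₁ (H χ) + inner ℂ ψ₁ (H ρ) := by
      rw [← inner_add_right, ← inner_add_right, ← map_add, ← map_add, ← hsplit]
    rw [h3, h1, h2, add_zero] at this
    rw [energy, ← Complex.ofReal_re (e * ‖ψ₁‖ ^ 2), this, Complex.add_re]
    ring
  have h5 : |(inner ℂ ψ₁ (VB χ)).re| ≤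
      ‖ψ₁‖ * (B.card * g * localStrength V * ‖projOn Y ψ‖) := by
    refine (Complex.abs_re_le_norm _).trans ((norm_inner_le_norm _ _).trans ?_)
    refine mul_le_mul_of_nonneg_left ?_ (norm_nonneg _)
    exact (VB.le_opNorm χ).trans (mul_le_mul hVnorm (norm_projOn_mono Set.sdiff_subset ψ)
      (norm_nonneg _) ((norm_nonneg _).trans hVnorm))
  have h6 := hgap ψ₁ (by
    intro z hz
    refine inSpan_projOn X ψ z fun hx => hz ?_
    simp only [hX, Set.mem_ofPred_eq] at hx
    have : (m : ℝ) ≤ excited C B z := by exact_mod_cast hx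
    exact hm.trans this)
  rw [h4] at h6
  rcases (norm_nonneg ψ₁).eq_or_lt with h0 | h0
  · rw [← h0, mul_zero]
    exact mul_nonneg ((norm_nonneg _).trans hVnorm) (norm_nonneg _)
  · have h7 := (abs_le.1 h5).1
    refine le_of_mul_le_mul_left ?_ h0
    nlinarith

/-- The amplitude of a low-energy eigenvector on the configurations detected by `B` is
exponentially small in the size of `B`. -/
theorem norm_detects_le (hg : 1 ≤ g) (hq : 1 ≤ q)
    (hloc : ∀ e, {i | ActsOn (C e) i}.ncard ≤ g)
    (hdeg : ∀ i, {e | ActsOn (C e) i}.ncard ≤ g ∧ {e | ActsOn (C e) i}.Finite)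
    (hV : IsLocallySymmetric C q V) {B : Finset E} (hB : 0 < B.card) {ψ : Hilb Λ}
    {e Δ Em : ℝ} (hΔ : 0 < Δ)
    (hψ : (diagOp H₀ + ∑ F, V F) ψ = (e : ℂ) • ψ)
    (hgap : ∀ φ : Hilb Λ, InSpan (window C B) φ →
      (Δ * B.card + Em) * ‖φ‖ ^ 2 ≤ energy (diagOp H₀ + ∑ F, V F) φ)
    (he : e ≤ Δ / 2 * B.card + Em) (hx : 2 * g * localStrength V / Δ ≤ 1) :
    ‖projOn {z | Detects C B z} ψ‖ ≤
      (2 * g * localStrength V / Δ) ^ ((B.card : ℝ) / (5 * q * g)) * ‖ψ‖ := by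
  set x := 2 * g * localStrength V / Δ with hxdef
  have hx0 : 0 ≤ x := by
    have := localStrength_nonneg V
    positivity
  have hBr : (0 : ℝ) < B.card := by exact_mod_cast hB
  have hw : 0 < q * g := Nat.mul_pos hq hg
  have hstep : ∀ m : ℕ, 4 / 5 * (B.card : ℝ) ≤ m →
      ‖projOn {z | m ≤ excited C B z} ψ‖ ≤ x * ‖projOn {z | m - q * g ≤ excited C B z} ψ‖ := by
    intro m hm
    have h := norm_level_le hloc hdeg hV hψ hgap hm
    set a := ‖projOn {z | m ≤ excited C B z} ψ‖
    set b := ‖projOn {z | m - q * g ≤ excited C B z} ψ‖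
    have ha : 0 ≤ a := norm_nonneg _
    have h1 : Δ / 2 * B.card * a ≤ B.card * g * localStrength V * b := by
      refine le_trans ?_ h
      refine mul_le_mul_of_nonneg_right ?_ ha
      linarith
    have h2 : Δ / 2 * a ≤ g * localStrength V * b := by
      refine le_of_mul_le_mul_left ?_ hBr
      linarith
    rw [hxdef, div_mul_eq_mul_div, le_div_iff₀ hΔ]
    linarith
  have hiter : ∀ j : ℕ, 5 * ((j - 1) * (q * g)) ≤ B.card →
      ‖projOn {z | B.card ≤ excited C B z} ψ‖ ≤
        x ^ j * ‖projOn {z | B.card - j * (q * g) ≤ excited C B z} ψ‖ := by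
    intro j
    induction j with
    | zero => intro _; simp
    | succ j ih =>
      intro hj
      rw [Nat.add_sub_cancel] at hj
      have hj' : 5 * ((j - 1) * (q * g)) ≤ B.card :=
        le_trans (Nat.mul_le_mul_left 5 (Nat.mul_le_mul_right _ (Nat.sub_le j 1))) hj
      have h1 : 4 / 5 * (B.card : ℝ) ≤ ((B.card - j * (q * g) : ℕ) : ℝ) := by
        have h2 : j * (q * g) ≤ B.card := by omega
        rw [Nat.cast_sub h2]
        have h3 : (5 : ℝ) * ((j * (q * g) : ℕ) : ℝ) ≤ B.card := by exact_mod_cast hj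
        linarith
      have h2 := hstep _ h1
      have h3 : B.card - j * (q * g) - q * g = B.card - (j + 1) * (q * g) := by
        rw [Nat.sub_sub, add_mul, one_mul]
      rw [h3] at h2
      calc _ ≤ x ^ j * _ := ih hj'
        _ ≤ x ^ j * (x * _) := by gcongr
        _ = _ := by rw [pow_succ]; ring
  have hdet : ‖projOn {z | Detects C B z} ψ‖ ≤ ‖projOn {z | B.card ≤ excited C B z} ψ‖ := by
    refine norm_projOn_mono ?_ ψ
    intro z hz
    simp only [Set.mem_ofPred_eq, excited] at hz ⊢
    rw [Finset.filter_true_of_mem hz]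
  have hw5 : 0 < 5 * (q * g) := by omega
  -- The level stays in the window for `|B| / (5 q g)` steps down from the top, and the step out of
  -- the window still counts.
  have hlast := hiter (B.card / (5 * (q * g)) + 1) (by
    rw [Nat.add_sub_cancel, ← mul_assoc, mul_comm 5, mul_assoc]
    exact Nat.div_mul_le_self _ _)
  refine hdet.trans (hlast.trans ?_)
  gcongr
  · rcases hx0.eq_or_lt with h0 | h0
    · rw [← h0, zero_pow (Nat.succ_ne_zero _)]
      positivity
    · rw [← Real.rpow_natCast]
      refine Real.rpow_le_rpow_of_exponent_ge h0 hx ?_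
      have hlt : B.card < 5 * (q * g) * (B.card / (5 * (q * g)) + 1) :=
        Nat.lt_mul_div_succ _ hw5
      have h3 : (0 : ℝ) < 5 * q * g := by
        have : (0 : ℝ) < ((5 * (q * g) : ℕ) : ℝ) := by exact_mod_cast hw5
        push_cast at this; linarith
      rw [div_le_iff₀ h3]
      have h4 : (B.card : ℝ) ≤ ((5 * (q * g) * (B.card / (5 * (q * g)) + 1) : ℕ) : ℝ) := by
        exact_mod_cast hlt.le
      refine h4.trans (le_of_eq ?_)
      rw [Nat.cast_mul]
      push_cast; ring
  · exact norm_projOn_le _ _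

/-- The weight outside the sectors is bounded by a sum over the indicators. -/
theorem norm_sq_outer_le {S : Bottleneck Λ E K} {ψ : Hilb Λ} {y : ℝ}
    (hdet : ∀ z ∈ S.outer, ∃ B ∈ S.indOut, Detects C B z)
    (hle : ∀ B ∈ S.indOut, ‖projOn {z | Detects C B z} ψ‖ ^ 2 ≤ y ^ B.card * ‖ψ‖ ^ 2) :
    ‖projOn S.outer ψ‖ ^ 2 ≤ (∑ B ∈ S.indOut, y ^ B.card) * ‖ψ‖ ^ 2 := by
  classical
  rw [Finset.sum_mul]
  refine le_trans ?_ (Finset.sum_le_sum hle)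
  rw [norm_sq_projOn, Finset.sum_congr rfl fun B _ => norm_sq_projOn {z | Detects C B z} ψ,
    Finset.sum_comm]
  refine Finset.sum_le_sum fun z _ => ?_
  have hnn : ∀ B ∈ S.indOut, 0 ≤ if z ∈ {z | Detects C B z} then ‖ψ z‖ ^ 2 else 0 := by
    intro B _
    split_ifs <;> positivity
  split_ifs with hz
  · obtain ⟨B, hB, hd⟩ := hdet z hz
    refine le_trans (le_of_eq ?_) (Finset.single_le_sum hnn hB)
    exact (if_pos (show z ∈ {z | Detects C B z} from hd)).symm
  · exact Finset.sum_nonneg hnn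

end Leakage

/-! ### Stability of the Peierls condition -/

section Robust

variable {Λ E : Type} [Fintype Λ] [DecidableEq Λ] {C : E → Config Λ → Bool} {g R : ℕ}
  {S : Bottleneck Λ E (ZMod 2)} {H₀ : Config Λ → ℝ} {V : Finset Λ → Op Λ} {q : ℕ}

theorem image_flipAll_sector (hS : IsSSB C g R S) (k : ZMod 2) :
    flipAll '' S.sector k = S.sector (k + 1) := by
  rw [Bottleneck.sector, Set.image_union, hS.well_flip, hS.neck_flip]; rfl

theorem flipInvariant_univ_hamiltonian (hV : IsLocallySymmetric C q V)
    (hH₀ : ∀ z, H₀ (flipAll z) = H₀ z) :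
    FlipInvariant Finset.univ (diagOp H₀ + ∑ F, V F) := by
  intro z z'
  rw [entry_add, entry_add, entry_sum, entry_sum,
    Finset.sum_congr rfl fun F _ => flipInvariant_univ hV F z z']
  congr 1
  have hinj : flipOn Finset.univ z = flipOn Finset.univ z' ↔ z = z' :=
    (flipEquiv Finset.univ).injective.eq_iff
  rw [entry_diagOp, entry_diagOp, flipOn_univ z, hH₀, ← flipOn_univ z]
  simp only [hinj]

/-- The global flip exchanges the sectors, so their lowest energies agree. -/
theorem minEnergyOn_sector_succ_le (hS : IsSSB C g R S) {H : Op Λ}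
    (hH : FlipInvariant Finset.univ H) (k : ZMod 2) :
    minEnergyOn H (S.sector (k + 1)) ≤ minEnergyOn H (S.sector k) := by
  obtain ⟨w, hw⟩ := hS.well_nonempty k
  refine le_csInf ⟨_, EuclideanSpace.single w 1, by simp, fun z hz => ?_, rfl⟩ ?_
  · rw [PiLp.single_apply, if_neg]
    rintro rfl
    exact hz (Or.inl hw)
  · rintro x ⟨ψ, hψ, hs, rfl⟩
    rw [← hH.energy_eq ψ]
    refine csInf_le (bddBelow_energies H _) ⟨_, by rw [norm_flipState, hψ], fun z hz => ?_, rfl⟩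
    refine hs _ fun h => hz ?_
    rw [← image_flipAll_sector hS]
    exact ⟨_, h, by rw [← flipOn_univ, flipOn_flipOn]⟩

/-- If the ground state leaks little out of the sectors, each sector holds a state with nearly
the lowest energy. -/
theorem minEnergyOn_sector_le (hS : IsSSB C g R S)
    (hsep : ∀ k k', k ≠ k' → ∀ z ∈ S.sector k, ∀ z' ∈ S.sector k', R < hammingDist z z')
    (hH₀ : ∀ z, H₀ (flipAll z) = H₀ z) (hV : IsLocallySymmetric C q V) (hqR : q ≤ R)
    {φ : Hilb Λ} (hφ : ‖φ‖ = 1)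
    (hground : (diagOp H₀ + ∑ F, V F) φ = ((minEnergy (diagOp H₀ + ∑ F, V F) : ℝ) : ℂ) • φ)
    {δ : ℝ} (hδ : ‖projOn S.outer φ‖ ≤ δ) (hδ2 : δ ^ 2 ≤ 1 / 2) (k : ZMod 2) :
    minEnergyOn (diagOp H₀ + ∑ F, V F) (S.sector k) ≤
      minEnergy (diagOp H₀ + ∑ F, V F) + 2 * (Fintype.card Λ * localStrength V * δ) := by
  classical
  set H : Op Λ := diagOp H₀ + ∑ F, V F with hH
  have hδ0 : 0 ≤ δ := (norm_nonneg _).trans hδ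
  have hdisj : ∀ k k', k ≠ k' → ∀ z ∈ S.sector k, z ∉ S.sector k' := by
    intro k k' hk z hz hz'
    have := hsep k k' hk z hz z hz'
    simp at this
  have htot : ‖projOn (S.sector 0) φ‖ ^ 2 + ‖projOn (S.sector 1) φ‖ ^ 2 +
      ‖projOn S.outer φ‖ ^ 2 = 1 := by
    rw [show (1 : ℝ) = ‖φ‖ ^ 2 by rw [hφ, one_pow], norm_sq_eq_sum φ, norm_sq_projOn, norm_sq_projOn, norm_sq_projOn,
      ← Finset.sum_add_distrib, ← Finset.sum_add_distrib]
    refine Finset.sum_congr rfl fun z _ => ?_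
    have hout : z ∈ S.outer ↔ z ∉ S.sector 0 ∧ z ∉ S.sector 1 := by
      refine ⟨fun h => ⟨h 0, h 1⟩, fun h k => ?_⟩
      have : k = 0 ∨ k = 1 := by revert k; decide
      rcases this with rfl | rfl
      · exact h.1
      · exact h.2
    by_cases h0 : z ∈ S.sector 0
    · have h1 := hdisj 0 1 (by decide) z h0
      simp [h0, h1, hout]
    · by_cases h1 : z ∈ S.sector 1 <;> simp [h0, h1, hout]
  -- One of the two sectors carries at least a quarter of the weight of the ground state.
  obtain ⟨k₀, hk₀⟩ : ∃ k₀, 1 / 2 ≤ ‖projOn (S.sector k₀) φ‖ := by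
    by_contra! h
    have h0 := h 0
    have h1 := h 1
    have e0 : ‖projOn (S.sector 0) φ‖ ^ 2 < (1 / 2) ^ 2 := by gcongr
    have e1 : ‖projOn (S.sector 1) φ‖ ^ 2 < (1 / 2) ^ 2 := by gcongr
    have e2 : ‖projOn S.outer φ‖ ^ 2 ≤ δ ^ 2 := by gcongr
    linarith
  have hmain : minEnergyOn H (S.sector k₀) ≤
      minEnergy H + 2 * (Fintype.card Λ * localStrength V * δ) := by
    set φ₁ := projOn (S.sector k₀) φ with hφ₁
    set φ₂ := projOn (S.sector (k₀ + 1)) φ with hφ₂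
    set ρ := projOn S.outer φ with hρ
    have hkne : k₀ ≠ k₀ + 1 := (by decide : ∀ k : ZMod 2, k ≠ k + 1) k₀
    have hsplit : φ = φ₁ + φ₂ + ρ := by
      ext z
      have hout : z ∈ S.outer ↔ z ∉ S.sector k₀ ∧ z ∉ S.sector (k₀ + 1) := by
        refine ⟨fun h => ⟨h _, h _⟩, fun h k => ?_⟩
        have : ∀ k k₀ : ZMod 2, k = k₀ ∨ k = k₀ + 1 := by decide
        rcases this k k₀ with rfl | rfl
        · exact h.1
        · exact h.2
      simp only [hφ₁, hφ₂, hρ, PiLp.add_apply, projOn_apply]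
      by_cases h0 : z ∈ S.sector k₀
      · have h1 := hdisj _ _ hkne z h0
        simp [h0, h1, hout]
      · by_cases h1 : z ∈ S.sector (k₀ + 1) <;> simp [h0, h1, hout]
    let V' : Op Λ := ∑ F with F.Nonempty, V F
    have hV' : ‖V'‖ ≤ Fintype.card Λ * localStrength V := by
      refine (norm_sum_le _ _).trans (sum_norm_le_of_meet V Finset.univ _ ?_)
      intro F hF
      obtain ⟨i, hi⟩ := (Finset.mem_filter.1 hF).2
      exact ⟨i, hi, Finset.mem_univ i⟩
    have h1 : inner ℂ φ₁ (H φ₂) = 0 :=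
      inner_apply_eq_zero (inSpan_projOn _ φ) (inSpan_projOn _ φ) fun z hz z' hz' =>
        entry_hamiltonian_eq_zero hV H₀ (hqR.trans_lt (hsep _ _ hkne z hz z' hz'))
    have h2 : inner ℂ φ₁ (H ρ) = inner ℂ φ₁ (V' ρ) := by
      refine inner_apply_congr (inSpan_projOn _ φ) (inSpan_projOn _ φ) fun z hz z' hz' => ?_
      have hne : z ≠ z' := by rintro rfl; exact hz' k₀ hz
      rw [hH, entry_hamiltonian H₀ hne, entry_sum, Finset.sum_filter]
      refine Finset.sum_congr rfl fun F _ => ?_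
      split_ifs with hF
      · rfl
      · rw [Finset.not_nonempty_iff_eq_empty] at hF
        subst hF
        obtain ⟨i, hi⟩ := Function.ne_iff.1 hne
        exact (hV.supported ∅).1 z z' ⟨i, by simp, hi⟩
    have h3 : energy H φ₁ = minEnergy H * ‖φ₁‖ ^ 2 - (inner ℂ φ₁ (V' ρ)).re := by
      have h4 : inner ℂ φ₁ (H φ) = inner ℂ φ₁ (H φ₁) + inner ℂ φ₁ (H φ₂) + inner ℂ φ₁ (H ρ) := by
        rw [← inner_add_right, ← inner_add_right, ← map_add, ← map_add, ← hsplit]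
      rw [h1, h2, add_zero, hground, inner_smul_right, inner_projOn_self,
        ← Complex.ofReal_mul] at h4
      rw [energy, ← Complex.ofReal_re (minEnergy H * ‖φ₁‖ ^ 2), h4, Complex.add_re]
      ring
    have h5 : |(inner ℂ φ₁ (V' ρ)).re| ≤ ‖φ₁‖ * (Fintype.card Λ * localStrength V * δ) := by
      refine (Complex.abs_re_le_norm _).trans ((norm_inner_le_norm _ _).trans ?_)
      refine mul_le_mul_of_nonneg_left ?_ (norm_nonneg _)
      exact (V'.le_opNorm ρ).trans (mul_le_mul hV' hδ (norm_nonneg _)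
        ((norm_nonneg _).trans hV'))
    have h6 := minEnergyOn_mul_le H (inSpan_projOn (S.sector k₀) φ)
    rw [← hφ₁, h3] at h6
    have h7 := (abs_le.1 h5).1
    have hpos : 0 < ‖φ₁‖ := lt_of_lt_of_le (by norm_num) hk₀
    set D := Fintype.card Λ * localStrength V * δ with hD
    have hD0 : 0 ≤ D := mul_nonneg ((norm_nonneg _).trans hV') hδ0
    have h8 : (minEnergyOn H (S.sector k₀) - minEnergy H) * ‖φ₁‖ ≤ D := by
      refine le_of_mul_le_mul_left ?_ hpos
      nlinarith
    by_contra! hlt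
    nlinarith
  have hstep := minEnergyOn_sector_succ_le hS (flipInvariant_univ_hamiltonian hV hH₀) k₀
  have hk : ∀ k k₀ : ZMod 2, k = k₀ ∨ k = k₀ + 1 := by decide
  rcases hk k k₀ with rfl | rfl
  · exact hmain
  · exact hstep.trans hmain

/-- The smallness assumption makes the amplitude lost per excited check beat the entropy of the
indicators. -/
theorem IsSmall.leak_factor (hg : 1 ≤ g) (hq : 1 ≤ q) {Δ θ ζ ε : ℝ} (hε : 0 ≤ ε) (hζ : 0 < ζ)
    (hΔ : 0 < Δ) (h : IsSmall Δ θ q g ζ ε) :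
    Real.exp θ * (2 * g * ε / Δ) ^ (2 / (5 * q * g : ℝ)) ≤
      Real.exp (-(2 / (5 * q * g) * Real.log (1 / ζ))) := by
  have hgr : (0 : ℝ) < g := by exact_mod_cast hg
  have hqr : (0 : ℝ) < q := by exact_mod_cast hq
  have hx : 2 * g * ε / Δ ≤ ζ * Real.exp (-(5 / 2 * q * g * θ)) := by
    rw [div_le_iff₀ hΔ]
    have h1 := h.1
    have h2 : 3 * g * ε ≤ ζ * Real.exp (-(5 / 2 * q * g * θ)) * Δ := by
      calc 3 * g * ε ≤ 3 * g * (ζ * (Δ / (3 * g)) * Real.exp (-(5 / 2 * q * g * θ))) := by gcongr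
        _ = _ := by field_simp
    have : 0 ≤ g * ε := by positivity
    linarith
  calc Real.exp θ * (2 * g * ε / Δ) ^ (2 / (5 * q * g : ℝ))
      ≤ Real.exp θ * (ζ * Real.exp (-(5 / 2 * q * g * θ))) ^ (2 / (5 * q * g : ℝ)) := by gcongr
    _ = _ := by
      rw [Real.mul_rpow hζ.le (Real.exp_pos _).le, Real.rpow_def_of_pos hζ, ← Real.exp_mul,
        ← Real.exp_add, ← Real.exp_add, one_div, Real.log_inv]
      congr 1
      field_simp
      ring

/-- Stability of the Peierls condition: a classical Hamiltonian with the strengthened estimate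
and more gap than entropy keeps the Peierls condition, and its symmetric low-energy
eigenvectors break the symmetry, under every small locally symmetric perturbation.  The unit
of slack in the constant of the boundary term pays for the difference between the lowest energy
of a sector and the lowest energy overall. -/
theorem robustSSB_of_strongEstimate (hg : 1 ≤ g) (hS : IsSSB C g R S)
    (hsep : ∀ k k', k ≠ k' → ∀ z ∈ S.sector k, ∀ z' ∈ S.sector k', R < hammingDist z z')
    (hH₀ : ∀ z, H₀ (flipAll z) = H₀ z) {Δ θ θ₀ L c : ℝ} (hL : 2 ≤ L)
    (hθ : θ₀ + 1 ≤ θ)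
    (hdet : ∀ z ∈ S.outer, ∃ B ∈ S.indOut, Detects C B z)
    (hsize : ∀ B ∈ S.indOut, L ≤ (B.card : ℝ))
    (hcount : ∀ m : ℕ, ((S.indOut.filter fun B => B.card = m).card : ℝ) ≤ Real.exp (θ₀ * m))
    (hind : ∀ k, ((S.ind k).card : ℝ) ≤ Real.exp (θ * L))
    (hindsize : ∀ k, ∀ B ∈ S.ind k, L ≤ (B.card : ℝ))
    (hvol : Fintype.card Λ * √(2 * Real.exp (-L)) ≤ L)
    (hest : StrongEstimate C S Δ c H₀) :
    RobustSSB C g R S Δ θ L (c + 1) H₀ := by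
  intro q V ζ hq hqR hζ hζ1 hV hsmall
  set ε := localStrength V with hε
  have hε0 : 0 ≤ ε := localStrength_nonneg V
  set Δt := Δ - 2 * (c + 1) * ε with hΔt
  have hgr : (0 : ℝ) < g := by exact_mod_cast hg
  have hqr : (0 : ℝ) < q := by exact_mod_cast hq
  have hΔ0 : 0 < Δt := by
    have h1 := hε0.trans_lt hsmall.2
    have h2 : 0 < min (1 / √2) (Real.exp (-(5 / 2 * q * g * θ))) :=
      lt_min (by positivity) (Real.exp_pos _)
    have h3 := (pos_iff_pos_of_mul_pos h1).2 h2
    by_contra hneg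
    exact absurd h3 (not_lt.2 (div_nonpos_of_nonpos_of_nonneg (not_lt.1 hneg) (by positivity)))
  set H : Op Λ := diagOp H₀ + ∑ F, V F with hH
  have hherm : IsSelfAdjoint H := IsSelfAdjoint.add (R := Op Λ) (isSelfAdjoint_diagOp H₀) hV.hermitian
  have hloc := hS.bottleneck.check_local
  have hdeg := hS.bottleneck.check_degree
  -- The energy gap of a window, with the lowest energy of the whole space.
  have hgap' : ∀ B, (B ∈ S.indOut ∨ ∃ k, B ∈ S.ind k) → ∀ ψ : Hilb Λ, InSpan (window C B) ψ →
      ((Δ - 2 * c * ε) * B.card + minEnergy H) * ‖ψ‖ ^ 2 ≤ energy H ψ := by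
    intro B hB ψ hψ
    obtain ⟨A, hA, hAest⟩ := hest B hB
    have h1 := energy_flipState_le hV hA hAest hψ
    have h2 := minEnergy_mul_le H (flipState A ψ)
    rw [norm_flipState] at h2
    rw [add_mul]
    linarith
  have hslack : Δ - 2 * c * ε = Δt + 2 * ε := by rw [hΔt]; ring
  have hgap : ∀ B ∈ S.indOut, ∀ ψ : Hilb Λ, InSpan (window C B) ψ →
      (Δt * B.card + minEnergy H) * ‖ψ‖ ^ 2 ≤ energy H ψ := by
    intro B hB ψ hψ
    refine le_trans ?_ (hgap' B (Or.inl hB) ψ hψ)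
    rw [hslack]
    have : 0 ≤ ε * B.card := by positivity
    refine mul_le_mul_of_nonneg_right ?_ (sq_nonneg _)
    linarith
  -- The decay of low-energy eigenvectors on the indicators.
  set x := 2 * g * ε / Δt with hx
  have hx0 : 0 ≤ x := by positivity
  have hx1 : x ≤ 1 := by
    rw [hx, div_le_one hΔ0]
    have h1 := hsmall.2.le
    have h2 : min (1 / √2) (Real.exp (-(5 / 2 * q * g * θ))) ≤ 1 := by
      refine (min_le_left _ _).trans ?_
      rw [div_le_one (by positivity)]
      exact Real.one_le_sqrt.2 (by norm_num)
    have h3 : ε ≤ Δt / (3 * g) := h1.trans (mul_le_of_le_one_right (by positivity) h2)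
    rw [le_div_iff₀ (by positivity)] at h3
    have : 0 ≤ ε * g := by positivity
    linarith
  set y := x ^ (2 / (5 * q * g : ℝ)) with hy
  have hy0 : 0 ≤ y := Real.rpow_nonneg hx0 _
  have hleak : ∀ (ψ : Hilb Λ) (e : ℝ), H ψ = (e : ℂ) • ψ → e ≤ Δt / 2 * L + minEnergy H →
      ‖projOn S.outer ψ‖ ^ 2 ≤ (∑ B ∈ S.indOut, y ^ B.card) * ‖ψ‖ ^ 2 := by
    intro ψ e hψ he
    refine norm_sq_outer_le hdet fun B hB => ?_
    have hBL := hsize B hB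
    have hB0 : 0 < B.card := by
      have : (0 : ℝ) < B.card := by linarith
      exact_mod_cast this
    have h := norm_detects_le hg hq hloc hdeg hV hB0 hΔ0 hψ (hgap B hB) (he.trans (by
      have := mul_le_mul_of_nonneg_left hBL (by positivity : 0 ≤ Δt / 2)
      linarith)) hx1
    calc ‖projOn {z | Detects C B z} ψ‖ ^ 2
        ≤ (x ^ ((B.card : ℝ) / (5 * q * g)) * ‖ψ‖) ^ 2 := by gcongr
      _ = y ^ B.card * ‖ψ‖ ^ 2 := by
        rw [mul_pow, hy, ← Real.rpow_natCast, ← Real.rpow_natCast _ B.card, ← Real.rpow_mul hx0,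
          ← Real.rpow_mul hx0]
        congr 2
        push_cast; ring
  set r := Real.exp (-(2 / (5 * q * g) * Real.log (1 / ζ))) with hr
  have hyr : Real.exp θ * y ≤ r := hsmall.leak_factor hg hq hε0 hζ hΔ0
  have hlogζ : 0 < Real.log (1 / ζ) := Real.log_pos (by rw [lt_div_iff₀ hζ]; linarith)
  have hr1 : r < 1 := by
    rw [hr, Real.exp_lt_one_iff, neg_lt_zero]; positivity
  have hr0 : 0 < r := Real.exp_pos _
  -- The ground state leaks exponentially little, because `θ₀` is smaller than `θ`.
  obtain ⟨φ, hφ1, hφ⟩ := exists_ground_state hherm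
  have hδ : ‖projOn S.outer φ‖ ^ 2 ≤ 2 * Real.exp (-L) := by
    have h1 := hleak φ _ hφ (by
      have : 0 ≤ Δt / 2 * L := by positivity
      linarith)
    have he1 : Real.exp (-1) ≤ 1 / 2 := by
      rw [Real.exp_neg, one_div]
      gcongr
      linarith [Real.add_one_le_exp 1]
    have h2 := sum_pow_card_le S.indOut hsize hcount hy0 (r := Real.exp (-1)) (Real.exp_pos _)
      (by linarith) (by
        have h3 : Real.exp θ₀ ≤ Real.exp (-1) * Real.exp θ := by
          rw [← Real.exp_add]; exact Real.exp_le_exp.2 (by linarith)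
        calc Real.exp θ₀ * y ≤ Real.exp (-1) * Real.exp θ * y := by gcongr
          _ = Real.exp (-1) * (Real.exp θ * y) := by ring
          _ ≤ Real.exp (-1) * 1 := by gcongr; exact hyr.trans hr1.le
          _ = _ := mul_one _)
    rw [hφ1, one_pow, mul_one] at h1
    refine h1.trans (h2.trans ?_)
    rw [← Real.exp_mul, div_le_iff₀ (by linarith)]
    have : Real.exp (-1 * L) = Real.exp (-L) := by ring_nf
    rw [this]
    nlinarith [Real.exp_pos (-L)]
  have hsector : ∀ k, minEnergyOn H (S.sector k) ≤ minEnergy H + 2 * (ε * L) := by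
    intro k
    have hsq : √(2 * Real.exp (-L)) ^ 2 = 2 * Real.exp (-L) := Real.sq_sqrt (by positivity)
    have h1 := minEnergyOn_sector_le hS hsep hH₀ hV hqR hφ1 hφ
      (δ := √(2 * Real.exp (-L))) (Real.le_sqrt_of_sq_le hδ) (by
        rw [hsq]
        have h2 : Real.exp (-L) ≤ 1 / 4 := by
          have h3 : Real.exp (-L) ≤ Real.exp (-2) := Real.exp_le_exp.2 (by linarith)
          have h4 : Real.exp (-2) = Real.exp (-1) * Real.exp (-1) := by
            rw [← Real.exp_add]; norm_num
          have he1 : Real.exp (-1) ≤ 1 / 2 := by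
            rw [Real.exp_neg, one_div]
            gcongr
            linarith [Real.add_one_le_exp 1]
          nlinarith [Real.exp_pos (-1)]
        linarith) k
    refine h1.trans ?_
    have := mul_le_mul_of_nonneg_left hvol hε0
    linarith
  have hnb : ∀ k, ∀ z ∉ S.sector k, ∀ z' ∈ S.well k, R < hammingDist z z' := by
    intro k z hz z' hz'
    by_contra! h
    exact hz (hS.bottleneck.neck_nbhd k z' hz' z (by rwa [hammingDist_comm]))
  have hcount' : ∀ m : ℕ, ((S.indOut.filter fun B => B.card = m).card : ℝ) ≤
      Real.exp (θ * m) := by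
    intro m
    refine (hcount m).trans (Real.exp_le_exp.2 ?_)
    have : (0 : ℝ) ≤ m := Nat.cast_nonneg m
    nlinarith
  refine ⟨⟨⟨hS.bottleneck, hherm, fun k => ?_, hind, hindsize, fun k B hB ψ hψ1 hψ => ?_⟩,
    fun k k' hk => ?_, fun k k' hk => ?_, hdet, fun B hB ψ hψ1 hψ => ?_, hsize, hcount'⟩,
    fun ψ e _ hψ hsym he => ⟨hsym, hS, hsep, ?_⟩⟩
  · rw [one_sub_projOn]
    exact projOn_mul_mul_projOn_eq_zero fun z hz z' hz' =>
      entry_hamiltonian_eq_zero hV H₀ (hqR.trans_lt (hnb k z hz z' hz'))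
  · have h1 := hgap' B (Or.inr ⟨k, hB⟩) ψ fun z hz => hψ z fun h => hz h.2
    rw [hψ1, one_pow, mul_one, hslack] at h1
    have h2 := mul_le_mul_of_nonneg_left (hindsize k B hB) hε0
    have h3 := hsector k
    linarith
  · rw [Set.disjoint_left]
    intro z hz hz'
    have := hsep k k' hk z hz z hz'
    simp at this
  · exact projOn_mul_mul_projOn_eq_zero fun z hz z' hz' =>
      entry_hamiltonian_eq_zero hV H₀ (hqR.trans_lt (hsep k k' hk z hz z' hz'))
  · simpa [hψ1] using hgap B hB ψ hψ
  · have h1 := (hleak ψ e hψ he).trans (mul_le_mul_of_nonneg_right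
      (sum_pow_card_le S.indOut hsize hcount' hy0 hr0 hr1 hyr) (sq_nonneg _))
    refine le_of_sq_le_sq (h1.trans (le_of_eq ?_))
      (mul_nonneg (by rw [leakage]; positivity) (norm_nonneg _))
    have h2 : 0 < 1 - r := by linarith
    rw [mul_pow, leakage, mul_pow, ← hr, div_pow, one_pow, Real.sq_sqrt h2.le, ← Real.exp_nat_mul,
      hr, ← Real.exp_mul, ← hr]
    rw [one_div_mul_eq_div]
    congr 3
    push_cast
    ring

end Robust

/-! ### The Ising energy -/

section Energy

variable {n : ℕ} [NeZero n]

theorem isingEnergy_eq (J : Bond n → ℝ) (z : Config (Torus n)) :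
    isingEnergy J z = ∑ e, if isingCheck e z = true then J e else 0 := by
  refine Finset.sum_congr rfl fun e _ => ?_
  simp only [isingCheck, spin]
  by_cases h1 : z e.1 = true <;> by_cases h2 : z (bondEnd e) = true <;> simp [h1, h2]

theorem isingEnergy_flipAll (J : Bond n → ℝ) (z : Config (Torus n)) :
    isingEnergy J (flipAll z) = isingEnergy J z := by
  simp only [isingEnergy_eq, isingCheck_flipAll]

omit [NeZero n] in
theorem isingCheck_flipOn (A : Finset (Torus n)) (e : Bond n) (z : Config (Torus n)) :
    isingCheck e (flipOn A z) =
      if (e.1 ∈ A ↔ bondEnd e ∈ A) then isingCheck e z else !isingCheck e z := by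
  simp only [isingCheck, flipOn]
  by_cases h1 : e.1 ∈ A <;> by_cases h2 : bondEnd e ∈ A <;>
    cases z e.1 <;> cases z (bondEnd e) <;> simp [h1, h2]

omit [NeZero n] in
theorem ncard_innerBoundary_le {A : Finset (Torus n)} {B : Finset (Bond n)}
    (hA : ∀ e, e ∈ B ↔ ¬(e.1 ∈ A ↔ bondEnd e ∈ A)) :
    (innerBoundary (isingCheck (n := n)) A).ncard ≤ 2 * B.card := by
  have hsub : innerBoundary (isingCheck (n := n)) A ⊆
      ((B.biUnion fun e => {e.1, bondEnd e} : Finset (Torus n)) : Set (Torus n)) := by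
    rintro i ⟨hi, j, hj, hij, e, hei, hej⟩
    simp only [Finset.coe_biUnion, Set.mem_iUnion, Finset.mem_coe, Finset.mem_insert,
      Finset.mem_singleton]
    have h1 := endpoint_of_actsOn hei
    refine ⟨e, (hA e).2 fun h => ?_, h1⟩
    rcases h1 with rfl | rfl <;> rcases endpoint_of_actsOn hej with rfl | rfl <;> tauto
  refine (Set.ncard_le_ncard hsub (Finset.finite_toSet _)).trans ?_
  rw [Set.ncard_coe_finset, mul_comm]
  exact Finset.card_biUnion_le_card_mul _ _ _ fun e _ => Finset.card_le_two

/-- The bonds of `B` whose coupling does not exceed `t`. -/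
noncomputable def weakBonds (t : ℝ) (B : Finset (Bond n)) (J : Bond n → ℝ) : Finset (Bond n) :=
  B.filter fun e => J e ≤ t

/-- If few bonds of each cut are weak, flipping one side of a cut that is mostly excited lowers
the energy by `Δ` per bond of the cut. -/
theorem strongEstimate_isingEnergy {L M J₁ J₂ Δ Δ' : ℝ} (hJ₁ : 0 ≤ J₁) (hΔ : 0 < Δ')
    (hJ₂ : 0 ≤ J₂) {J : Bond n → ℝ} (hJ : ∀ e, J e ∈ Set.Icc (-J₁) J₂)
    (hweak : ∀ B ∈ largeCuts n L,
      ((weakBonds Δ' B J).card : ℝ) ≤ fractionA J₁ J₂ Δ Δ' * B.card) :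
    StrongEstimate isingCheck (seaStructure n L M) Δ 2 (isingEnergy J) := by
  intro B hB
  have hB' : B ∈ largeCuts n L := by
    rcases hB with h | ⟨k, h⟩
    · exact h
    · exact (Finset.mem_filter.1 h).1
  obtain ⟨A, hA⟩ := exists_cut_of_mem_largeCuts hB'
  refine ⟨A, by exact_mod_cast ncard_innerBoundary_le hA, fun z hz => ?_⟩
  have hdiff : isingEnergy J z - isingEnergy J (flipOn A z) =
      ∑ e ∈ B, if isingCheck e z = true then J e else -J e := by
    rw [isingEnergy_eq, isingEnergy_eq, ← Finset.sum_sub_distrib]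
    rw [← Finset.sum_subset (Finset.subset_univ B)]
    · refine Finset.sum_congr rfl fun e he => ?_
      rw [isingCheck_flipOn, if_neg ((hA e).1 he)]
      cases isingCheck e z <;> simp
    · intro e _ he
      rw [isingCheck_flipOn, if_pos (not_not.1 (mt (hA e).2 he)), sub_self]
  have hlow : ∀ e ∈ B, Δ' - (Δ' + J₂) * (if isingCheck e z = true then 0 else 1) -
      (Δ' + J₁) * (if J e ≤ Δ' then 1 else 0) ≤ if isingCheck e z = true then J e else -J e := by
    intro e _
    have h := hJ e
    rw [Set.mem_Icc] at h
    split_ifs with h1 h2 h2 <;> linarith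
  have hsum := Finset.sum_le_sum hlow
  rw [← hdiff, Finset.sum_sub_distrib, Finset.sum_sub_distrib, ← Finset.mul_sum, ← Finset.mul_sum,
    Finset.sum_const, nsmul_eq_mul] at hsum
  have hw : ∑ e ∈ B, (if J e ≤ Δ' then (1 : ℝ) else 0) = (weakBonds Δ' B J).card := by
    rw [weakBonds, Finset.sum_boole]
  have hu : ∑ e ∈ B, (if isingCheck e z = true then (0 : ℝ) else 1) =
      B.card - excited isingCheck B z := by
    rw [excited, Finset.card_eq_sum_ones, Nat.cast_sum, ← Finset.sum_boole,
      ← Finset.sum_sub_distrib]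
    refine Finset.sum_congr rfl fun e _ => ?_
    split_ifs <;> simp
  rw [hw, hu] at hsum
  have hz' : 4 / 5 * (B.card : ℝ) ≤ excited isingCheck B z := hz
  have h1 := mul_le_mul_of_nonneg_left (hweak B hB') (by linarith : 0 ≤ Δ' + J₁)
  have h2 : (Δ' + J₁) * (fractionA J₁ J₂ Δ Δ' * B.card) =
      (4 * Δ' - 5 * Δ - J₂) / 5 * B.card := by
    have : Δ' + J₁ ≠ 0 := by linarith
    rw [fractionA]; field_simp
  have h3 : (Δ' + J₂) * (B.card - excited isingCheck B z) ≤ (Δ' + J₂) * (1 / 5 * B.card) :=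
    mul_le_mul_of_nonneg_left (by linarith) (by linarith)
  linarith

end Energy

/-! ### Large deviations of the number of weak bonds -/

section Probability

/-- The exponential Markov inequality for the number of weak bonds in `B`. -/
theorem measure_weakBonds_ge_le {n : ℕ} [NeZero n] (μ : Measure ℝ) [IsProbabilityMeasure μ]
    {t a p : ℝ} (hp : 0 < p) (hpa : p < a) (hμ : μ.real (Set.Ioi t) = 1 - p)
    (B : Finset (Bond n)) :
    (Measure.pi fun _ : Bond n => μ) {J | a * B.card ≤ ((weakBonds t B J).card : ℝ)} ≤
      ENNReal.ofReal (Real.exp (-rateChi a p) ^ B.card) := by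
  classical
  have ha : 0 < a := hp.trans hpa
  have hap : 1 ≤ a / p := by rw [le_div_iff₀ hp]; linarith
  let f : Bond n → ℝ → ENNReal := fun e x =>
    if e ∈ B then Set.indicator (Set.Iic t) (fun _ => ENNReal.ofReal (a / p)) x +
      Set.indicator (Set.Ioi t) (fun _ => 1) x else 1
  have hf : ∀ e, Measurable (f e) := by
    intro e
    simp only [f]
    split_ifs
    · exact (measurable_const.indicator measurableSet_Iic).add
        (measurable_const.indicator measurableSet_Ioi)
    · exact measurable_const
  have hIoi : μ (Set.Ioi t) = ENNReal.ofReal (1 - p) := by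
    rw [← hμ, ofReal_measureReal]
  have hIic : μ (Set.Iic t) = ENNReal.ofReal p := by
    have h := probReal_compl_eq_one_sub (μ := μ) (measurableSet_Ioi (a := t))
    rw [Set.compl_Ioi, hμ] at h
    rw [← ofReal_measureReal, h]; congr 1; ring
  have hp1 : 0 ≤ 1 - p := hμ ▸ measureReal_nonneg
  have hint : ∀ e, ∫⁻ x, f e x ∂μ ≤ if e ∈ B then ENNReal.ofReal (Real.exp (a - p)) else 1 := by
    intro e
    simp only [f]
    split_ifs
    · rw [lintegral_add_left (measurable_const.indicator measurableSet_Iic),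
        lintegral_indicator_const measurableSet_Iic, lintegral_indicator_const measurableSet_Ioi,
        hIoi, hIic, one_mul, ← ENNReal.ofReal_mul (by positivity),
        ← ENNReal.ofReal_add (by positivity) hp1]
      refine ENNReal.ofReal_le_ofReal ?_
      rw [div_mul_cancel₀ _ hp.ne']
      linarith [Real.add_one_le_exp (a - p)]
    · simp
  have hprod : ∫⁻ J : Bond n → ℝ, ∏ e, f e (J e) ∂(Measure.pi fun _ : Bond n => μ) ≤
      ENNReal.ofReal (Real.exp (a - p) ^ B.card) := by
    rw [ProbabilityTheory.lintegral_prod_eq_prod_lintegral_of_indepFun Finset.univ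
      (fun e (J : Bond n → ℝ) => f e (J e))
      (ProbabilityTheory.iIndepFun_pi fun e => (hf e).aemeasurable)
      fun e => (hf e).comp (measurable_pi_apply e)]
    calc ∏ e, ∫⁻ J : Bond n → ℝ, f e (J e) ∂(Measure.pi fun _ : Bond n => μ)
        = ∏ e, ∫⁻ x, f e x ∂μ := Finset.prod_congr rfl fun e _ =>
          (measurePreserving_eval (fun _ : Bond n => μ) e).lintegral_comp (hf e)
      _ ≤ ∏ e, if e ∈ B then ENNReal.ofReal (Real.exp (a - p)) else 1 :=
          Finset.prod_le_prod' fun e _ => hint e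
      _ = ENNReal.ofReal (Real.exp (a - p) ^ B.card) := by
          rw [Finset.prod_ite_mem, Finset.univ_inter, Finset.prod_const,
            ENNReal.ofReal_pow (Real.exp_pos _).le]
  have hbad : {J : Bond n → ℝ | a * B.card ≤ ((weakBonds t B J).card : ℝ)} ⊆
      {J | ENNReal.ofReal ((a / p) ^ (a * B.card)) ≤ ∏ e, f e (J e)} := by
    intro J hJ
    simp only [Set.mem_ofPred_eq] at hJ ⊢
    have h1 : ∏ e, f e (J e) = ENNReal.ofReal (a / p) ^ (weakBonds t B J).card := by
      rw [weakBonds, ← Finset.prod_const, Finset.prod_filter,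
        ← Finset.prod_subset (Finset.subset_univ B)]
      · refine Finset.prod_congr rfl fun e he => ?_
        by_cases h : J e ≤ t
        · simp [f, he, h]
        · simp [f, he, h, not_le.1 h]
      · intro e _ he
        simp [f, he]
    rw [h1, ← ENNReal.ofReal_pow (by positivity), ← Real.rpow_natCast]
    exact ENNReal.ofReal_le_ofReal (Real.rpow_le_rpow_of_exponent_le hap hJ)
  refine (measure_mono hbad).trans ?_
  have hpos : 0 < (a / p) ^ (a * B.card) := by positivity
  have hmarkov := meas_ge_le_lintegral_div (μ := Measure.pi fun _ : Bond n => μ)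
    (f := fun J : Bond n → ℝ => ∏ e, f e (J e))
    (Finset.measurable_prod _ fun e _ => (hf e).comp (measurable_pi_apply e)).aemeasurable
    (ε := ENNReal.ofReal ((a / p) ^ (a * B.card)))
    (by simpa using hpos) ENNReal.ofReal_ne_top
  refine hmarkov.trans ((ENNReal.div_le_div_right hprod _).trans (le_of_eq ?_))
  rw [← ENNReal.ofReal_div_of_pos hpos]
  congr 1
  rw [← Real.exp_nat_mul, ← Real.exp_nat_mul, Real.rpow_def_of_pos (by positivity), ← Real.exp_sub,
    rateChi]
  congr 1
  ring

end Probability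

/-! ### Couplings with few weak bonds -/

section Assembly

theorem isLocallySymmetric_zero {Λ E : Type} [Fintype Λ] [DecidableEq Λ]
    (C : E → Config Λ → Bool) (q : ℕ) : IsLocallySymmetric C q (fun _ => (0 : Op Λ)) := by
  have hsupp : ∀ F : Finset Λ, SupportedOn F (0 : Op Λ) :=
    fun F => ⟨fun _ _ _ => rfl, fun _ _ _ _ _ _ => rfl⟩
  refine ⟨by rw [Finset.sum_const_zero]; exact IsSelfAdjoint.zero (Op Λ), hsupp,
    fun F h => absurd rfl h, fun F => ?_⟩
  refine ⟨F.card, fun a => {(F.equivFin.symm a).1}, fun _ => 0, 0, ?_, ?_, ?_, fun a => hsupp _,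
    fun a => by simp, op_ext fun z z' => by rw [entry_smul, zero_mul]; rfl⟩
  · intro a b hab
    rw [Finset.disjoint_singleton]
    intro h
    exact hab (F.equivFin.symm.injective (Subtype.ext h))
  · ext i
    simp only [Finset.mem_biUnion, Finset.mem_univ, true_and, Finset.mem_singleton]
    constructor
    · rintro ⟨a, rfl⟩
      exact (F.equivFin.symm a).2
    · intro hi
      exact ⟨F.equivFin ⟨i, hi⟩, by simp⟩
  · intro a
    rw [Finset.coe_singleton]
    have : Nonempty ({(F.equivFin.symm a).1} : Set Λ) := ⟨⟨_, rfl⟩⟩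
    exact SimpleGraph.Connected.mk (SimpleGraph.Preconnected.of_subsingleton)

/-- Without a perturbation, robustness contains the Peierls condition of the classical
Hamiltonian itself. -/
theorem RobustSSB.isGlobalQPC {Λ E : Type} [Fintype Λ] [DecidableEq Λ]
    {C : E → Config Λ → Bool} {g R : ℕ} {S : Bottleneck Λ E (ZMod 2)} {Δ θ L c : ℝ}
    {H₀ : Config Λ → ℝ} (h : RobustSSB C g R S Δ θ L c H₀) (hg : 1 ≤ g) (hR : 1 ≤ R)
    (hΔ : 0 < Δ) : IsGlobalQPC C g R S Δ θ L (diagOp H₀) := by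
  have h0 : localStrength (fun _ : Finset Λ => (0 : Op Λ)) = 0 := by
    simp [localStrength]
  have hgr : (0 : ℝ) < g := by exact_mod_cast hg
  have h1 := (h 1 (fun _ => 0) (1 / 2) le_rfl hR (by norm_num) (by norm_num)
    (isLocallySymmetric_zero C 1) (by
      rw [h0, mul_zero, sub_zero]
      refine ⟨by positivity, ?_⟩
      have : 0 < min (1 / √2) (Real.exp (-(5 / 2 * ((1 : ℕ) : ℝ) * g * θ))) :=
        lt_min (by positivity) (Real.exp_pos _)
      positivity)).1
  rwa [h0, mul_zero, sub_zero, Finset.sum_const_zero, add_zero] at h1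

/-- For large `n`, the length `L = c n` exceeds the logarithm of the number of bonds, and the
leakage of the ground state is small against the number of sites. -/
theorem exists_large_size {c : ℝ} (hc : 0 < c) : ∃ N : ℕ, ∀ n : ℕ, N ≤ n →
    2 ≤ c * n ∧ Real.log (2 * n ^ 2 + 1) ≤ c * n ∧
      (n * n : ℕ) * √(2 * Real.exp (-(c * n))) ≤ c * n := by
  refine ⟨⌈144 / c ^ 3⌉₊ + ⌈2 / c⌉₊ + 1, fun n hn => ?_⟩
  have hn1 : (1 : ℝ) ≤ n := by exact_mod_cast (by omega : 1 ≤ n)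
  have hn2 : 2 / c ≤ n := (Nat.le_ceil _).trans (by exact_mod_cast (by omega : ⌈2 / c⌉₊ ≤ n))
  have hn3 : 144 / c ^ 3 ≤ n :=
    (Nat.le_ceil _).trans (by exact_mod_cast (by omega : ⌈144 / c ^ 3⌉₊ ≤ n))
  rw [div_le_iff₀ hc] at hn2
  rw [div_le_iff₀ (by positivity)] at hn3
  have hL : 2 ≤ c * n := by linarith
  -- The cubic term of the exponential series suffices.
  have hexp : 2 * (n : ℝ) ^ 2 + 1 ≤ Real.exp (c * n / 2) := by
    have h1 := Real.pow_div_factorial_le_exp (c * n / 2) (by positivity) 3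
    have h2 : ((Nat.factorial 3 : ℕ) : ℝ) = 6 := by norm_num [Nat.factorial]
    rw [h2] at h1
    have h3 : 144 * (n : ℝ) ^ 2 ≤ n * c ^ 3 * n ^ 2 := by gcongr
    have h4 : (c * n / 2) ^ 3 / 6 = n * c ^ 3 * n ^ 2 / 48 := by ring
    rw [h4] at h1
    nlinarith
  refine ⟨hL, ?_, ?_⟩
  · rw [Real.log_le_iff_le_exp (by positivity)]
    exact hexp.trans (Real.exp_le_exp.2 (by linarith))
  · have hsq : √(2 * Real.exp (-(c * n))) ≤ 2 * Real.exp (-(c * n / 2)) := by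
      refine Real.sqrt_le_iff.2 ⟨by positivity, ?_⟩
      rw [mul_pow, ← Real.exp_nat_mul]
      have : ((2 : ℕ) : ℝ) * -(c * n / 2) = -(c * n) := by push_cast; ring
      rw [this]
      nlinarith [Real.exp_pos (-(c * n))]
    have h5 : 2 * (n : ℝ) ^ 2 * Real.exp (-(c * n / 2)) ≤ 1 := by
      rw [Real.exp_neg, ← div_eq_mul_inv, div_le_one (Real.exp_pos _)]
      linarith
    push_cast
    calc (n * n : ℝ) * √(2 * Real.exp (-(c * n)))
        ≤ (n * n : ℝ) * (2 * Real.exp (-(c * n / 2))) := by gcongr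
      _ = 2 * (n : ℝ) ^ 2 * Real.exp (-(c * n / 2)) := by ring
      _ ≤ c * n := by linarith

/-- The deterministic part: couplings that are weak on few bonds of every large cut satisfy all
the conclusions. -/
theorem conclusions_of_few_weak {n R : ℕ} [NeZero n] (hR : 1 ≤ R) {L M J₁ J₂ Δ Δ' : ℝ}
    (hL : 2 ≤ L) (hM : M = 80 * R * L) (hn : (n : ℝ) = 80 * R * M)
    (hlog : Real.log (2 * n ^ 2 + 1) ≤ L)
    (hvol : (n * n : ℕ) * √(2 * Real.exp (-L)) ≤ L)
    (hJ₁ : 0 ≤ J₁) (hJΔ : J₁ < Δ) (hΔΔ : Δ < Δ') (hΔJ : Δ' < J₂) {J : Bond n → ℝ}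
    (hJ : ∀ e, J e ∈ Set.Icc (-J₁) J₂)
    (hweak : ∀ B ∈ largeCuts n L,
      ((weakBonds Δ' B J).card : ℝ) ≤ fractionA J₁ J₂ Δ Δ' * B.card) :
    IsGlobalQPC isingCheck 4 R (seaStructure n L M) Δ (20 * (80 * R)) L
        (diagOp (isingEnergy J)) ∧
      StrongEstimate isingCheck (seaStructure n L M) Δ 3 (isingEnergy J) ∧
      RobustSSB isingCheck 4 R (seaStructure n L M) Δ (20 * (80 * R)) L 3 (isingEnergy J) := by
  have hRr : (1 : ℝ) ≤ R := by exact_mod_cast hR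
  have hRL : L ≤ R * L := le_mul_of_one_le_left (by linarith) hRr
  have hLM : L ≤ M := by rw [hM]; linarith
  have hM0 : 0 ≤ M := by linarith
  have hRM : M ≤ R * M := le_mul_of_one_le_left hM0 hRr
  have hRL2 : 2 * R ≤ R * L := by rw [mul_comm]; gcongr
  have hRM2 : R * L ≤ R * M := by gcongr
  have hgrow : L + (4 * R + 72 * R * L) < M := by rw [hM]; linarith
  have hn' : M + (4 * R + 72 * R * M) < n := by rw [hn]; linarith
  have hest := strongEstimate_isingEnergy (M := M) hJ₁ (by linarith) (by linarith) hJ hweak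
  have hrob : RobustSSB isingCheck 4 R (seaStructure n L M) Δ (20 * (80 * R)) L (2 + 1)
      (isingEnergy J) := by
    refine robustSSB_of_strongEstimate (θ₀ := 19) (by norm_num)
      (seaStructure_isSSB hR (by linarith) hLM hgrow hn') ?_ (isingEnergy_flipAll J) hL
      (by linarith) ?_ ?_ ?_ ?_ ?_ ?_ hest
    · exact fun k k' hk z hz z' hz' => sector_sep hM0 hLM hn' hk hz hz'
    · intro z hz
      rw [mem_outer hLM] at hz
      refine exists_detect_outer hLM ?_ hz
      have : 0 ≤ (R : ℝ) * M := by positivity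
      linarith
    · exact fun B hB => le_card_of_mem_largeCuts hB
    · exact card_largeCuts_filter_le (by linarith) hlog
    · intro k
      have : 20 * (80 * R) * L = 20 * M := by rw [hM]; ring
      rw [this]
      exact card_ind_le (by linarith) hM0 hlog
    · exact fun k B hB => le_card_of_mem_largeCuts (Finset.mem_filter.1 hB).1
    · simpa [ZMod.card] using hvol
  rw [show (2 + 1 : ℝ) = 3 by norm_num] at hrob
  refine ⟨hrob.isGlobalQPC (by norm_num) hR (by linarith), fun B hB => ?_, hrob⟩
  obtain ⟨A, hA, h⟩ := hest B hB
  refine ⟨A, hA.trans ?_, h⟩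
  have : (0 : ℝ) ≤ B.card := Nat.cast_nonneg _
  linarith

end Assembly

end RBIM

theorem mainTheorem3 (R : ℕ) (hR : 1 ≤ R) :
    ∃ θ : ℝ, 0 < θ ∧ ∃ cR : ℝ, 0 < cR ∧ ∃ cb : ℝ, 0 < cb ∧ ∃ N : ℕ,
      ∀ (n : ℕ) [NeZero n], N ≤ n →
        ∃ S : RBIM.Bottleneck (RBIM.Torus n) (RBIM.Bond n) (ZMod 2),
          RBIM.IsSSB RBIM.isingCheck 4 R S ∧
          ∀ (J₁ J₂ Δ Δ' p : ℝ) (μ : Measure ℝ) [IsProbabilityMeasure μ],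
            0 ≤ J₁ → J₁ < Δ → Δ < Δ' → Δ' < J₂ →
            (∀ᵐ x ∂μ, x ∈ Set.Icc (-J₁) J₂) →
            μ.real (Set.Ioi Δ') = 1 - p → 0 < p →
            p < RBIM.fractionA J₁ J₂ Δ Δ' →
            θ < RBIM.rateChi (RBIM.fractionA J₁ J₂ Δ Δ') p →
            (Measure.pi fun _ : RBIM.Bond n => μ)
                {J | ¬ (RBIM.IsGlobalQPC RBIM.isingCheck 4 R S Δ θ (cR * n)
                          (RBIM.diagOp (RBIM.isingEnergy J)) ∧
                        RBIM.StrongEstimate RBIM.isingCheck S Δ cb (RBIM.isingEnergy J) ∧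
                        RBIM.RobustSSB RBIM.isingCheck 4 R S Δ θ (cR * n) cb
                          (RBIM.isingEnergy J))} ≤
              ENNReal.ofReal
                (Real.exp (-((RBIM.rateChi (RBIM.fractionA J₁ J₂ Δ Δ') p - θ) * (cR * n))) /
                  (1 - Real.exp (-(RBIM.rateChi (RBIM.fractionA J₁ J₂ Δ Δ') p - θ)))) := by
  have hRr : (1 : ℝ) ≤ R := by exact_mod_cast hR
  have hκ : (0 : ℝ) < 80 * R := by linarith
  have hc : (0 : ℝ) < 1 / (80 * R) ^ 2 := by positivity
  obtain ⟨N, hN⟩ := RBIM.exists_large_size hc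
  -- With `κ = 80 R`, adding the bonds at `R` sites enlarges clusters by less than a factor `κ`.
  -- So `M = κ L`, and `κ M = n` makes `n` the threshold below which clusters can be filled.  The
  -- at most `exp (20 M)` indicators of a bottleneck require `θ = 20 κ`.
  refine ⟨20 * (80 * R), by positivity, 1 / (80 * R) ^ 2, hc, 3, by norm_num, N, ?_⟩
  intro n _ hn
  obtain ⟨hL, hlog, hvol⟩ := hN n hn
  set L : ℝ := 1 / (80 * R) ^ 2 * n with hLdef
  have hnM : (n : ℝ) = 80 * R * (80 * R * L) := by rw [hLdef]; field_simp
  have hRL : L ≤ R * L := le_mul_of_one_le_left (by linarith) hRr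
  have hRRL : R * L ≤ R * (80 * R * L) := by
    refine mul_le_mul_of_nonneg_left ?_ (by linarith)
    linarith
  have hR2 : 2 * R ≤ R * L := by rw [mul_comm]; gcongr
  refine ⟨RBIM.seaStructure n L (80 * R * L), RBIM.seaStructure_isSSB hR (by linarith)
    (by linarith) (by linarith) (by rw [hnM]; nlinarith), ?_⟩
  intro J₁ J₂ Δ Δ' p μ _ hJ₁ hJΔ hΔΔ hΔJ hsupp hμ hp hpa hχ
  set a := RBIM.fractionA J₁ J₂ Δ Δ' with ha
  set χ := RBIM.rateChi a p with hχdef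
  set θ : ℝ := 20 * (80 * R) with hθ
  have hsub : {J : RBIM.Bond n → ℝ |
      ¬ (RBIM.IsGlobalQPC RBIM.isingCheck 4 R (RBIM.seaStructure n L (80 * R * L)) Δ θ L
          (RBIM.diagOp (RBIM.isingEnergy J)) ∧
        RBIM.StrongEstimate RBIM.isingCheck (RBIM.seaStructure n L (80 * R * L)) Δ 3
          (RBIM.isingEnergy J) ∧
        RBIM.RobustSSB RBIM.isingCheck 4 R (RBIM.seaStructure n L (80 * R * L)) Δ θ L 3
          (RBIM.isingEnergy J))} ⊆
      {J | ¬ ∀ e, J e ∈ Set.Icc (-J₁) J₂} ∪ ⋃ B ∈ RBIM.largeCuts n L,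
        {J | a * B.card ≤ ((RBIM.weakBonds Δ' B J).card : ℝ)} := by
    intro J hJ
    by_contra hgood
    simp only [Set.mem_union, Set.mem_iUnion, Set.mem_ofPred_eq, not_or, not_exists, not_not,
      not_le] at hgood
    exact hJ (RBIM.conclusions_of_few_weak hR hL rfl hnM hlog hvol hJ₁ hJΔ hΔΔ hΔJ hgood.1
      fun B hB => (hgood.2 B hB).le)
  have hnull : (Measure.pi fun _ : RBIM.Bond n => μ) {J | ¬ ∀ e, J e ∈ Set.Icc (-J₁) J₂} = 0 := by
    have h : ∀ᵐ J ∂(Measure.pi fun _ : RBIM.Bond n => μ), ∀ e, J e ∈ Set.Icc (-J₁) J₂ :=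
      ae_all_iff.2 fun e => (Measure.tendsto_eval_ae_ae (i := e)).eventually hsupp
    exact ae_iff.1 h
  refine (measure_mono hsub).trans ((measure_union_le _ _).trans ?_)
  rw [hnull, zero_add]
  refine (measure_biUnion_finset_le _ _).trans
    ((Finset.sum_le_sum fun B _ => RBIM.measure_weakBonds_ge_le μ hp hpa hμ B).trans ?_)
  rw [← ENNReal.ofReal_sum_of_nonneg fun B _ => by positivity]
  refine ENNReal.ofReal_le_ofReal ?_
  have hgeom := RBIM.sum_pow_card_le (RBIM.largeCuts n L) (θ := θ) (s := Real.exp (-χ))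
    (r := Real.exp (-(χ - θ))) (fun B hB => RBIM.le_card_of_mem_largeCuts hB) (fun m => by
      refine (RBIM.card_largeCuts_filter_le (by linarith) hlog m).trans (Real.exp_le_exp.2 ?_)
      have : (0 : ℝ) ≤ m := Nat.cast_nonneg m
      refine mul_le_mul_of_nonneg_right ?_ this
      rw [hθ]; linarith) (Real.exp_pos _).le (Real.exp_pos _)
    (Real.exp_lt_one_iff.2 (by linarith)) (by
      rw [← Real.exp_add]; exact (congrArg Real.exp (by ring)).le)
  refine hgeom.trans (le_of_eq ?_)
  rw [← Real.exp_mul, neg_mul]
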